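/- Let $\mathsf A,\mathsf B,\mathsf C$ be finite-dimensional complex Hilbert spaces and let $\mathrm D(\mathsf H)$ denote the set of positive semidefinite operators of unit trace on $\mathsf H$. For $\alpha\in(\frac12,1)\cup(1,\infty)$, $\alpha'=\frac{\alpha-1}{\alpha}$, and positive semidefinite operators $\rho\neq 0$ and $\sigma$ on the same space, the sandwiched Rényi divergence is $$D_\alpha(\rho\|\sigma)=\frac1{\alpha-1}\log\left(\frac1{\operatorname{tr}\rho}\operatorname{tr}\left[\left(\sigma^{-\alpha'/2}\rho\,\sigma^{-\alpha'/2}\right)^{\alpha}\right]\right),$$ unless $\alpha>1$ and $\operatorname{Supp}\rho\not\subseteq\operatorname{Supp}\sigma$, in which case $D_\alpha(\rho\|\sigma)=\infty$. Here powers of an operator are taken on its support, $\log$ is the binary logarithm and $\log 0=-\infty$. For a state $\rho_{AB}$ and $\sigma_B\in\mathrm D(\mathsf B)$ put $$H_\alpha(A|B)_{\rho|\sigma}=-D_\alpha(\rho_{AB}\|\mathrm{id}_A\otimes\sigma_B),\qquad H_\alpha(A|B)_\rho=-\inf_{\omega_B\in\mathrm D(\mathsf B)}D_\alpha(\rho_{AB}\|\mathrm{id}_A\otimes\omega_B).$$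 **Theorem.** Let $\rho_{ABC}\in\mathrm D(\mathsf A\otimes\mathsf B\otimes\mathsf C)$ and let $\alpha,\beta,\gamma\in(\frac12,1)\cup(1,\infty)$ satisfy $\frac{\alpha}{\alpha-1}=\frac{\beta}{\beta-1}+\frac{\gamma}{\gamma-1}$. 1. If $(\alpha-1)(\beta-1)(\gamma-1)>0$, then $H_\alpha(AB|C)_\rho\ge H_\beta(A|BC)_\rho+H_\gamma(B|C)_\rho$. 2. If $(\alpha-1)(\beta-1)(\gamma-1)<0$, then $H_\alpha(AB|C)_\rho\le H_\beta(A|BC)_\rho+H_\gamma(B|C)_\rho$. 3. If $\alpha>1$, then for every $\sigma_C\in\mathrm D(\mathsf C)$, in $[-\infty,\infty]$: $H_\alpha(AB|C)_{\rho|\sigma}\ge H_\beta(A|BC)_\rho+H_\gamma(B|C)_{\rho|\sigma}$ if $(\alpha-1)(\beta-1)(\gamma-1)>0$, and $H_\alpha(AB|C)_{\rho|\sigma}\le H_\beta(A|BC)_\rho+H_\gamma(B|C)_{\rho|\sigma}$ if $(\alpha-1)(\beta-1)(\gamma-1)<0$. The entropies of $B|C$ are those of the reduced state $\rho_{BC}=\operatorname{tr}_A\rho_{ABC}$.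 -/

import Mathlib

open scoped Kronecker ComplexOrder

noncomputable section

namespace RenyiChain

/-- Density operators `D(H)` on the finite-dimensional Hilbert space `H = ℂ^n`: positive
semidefinite operators of unit trace, written as matrices in the computational basis. -/
def IsDensity {n : Type*} [Fintype n] (ρ : Matrix n n ℂ) : Prop :=
  ρ.PosSemidef ∧ ρ.trace = 1

/-- The real power `X ^ s` of a positive semidefinite operator, by functional calculus.
Since `(0 : ℝ) ^ s = 0` for `s ≠ 0`, powers (negative ones too) are taken on the support of `X`. -/
def mpow {n : Type*} [Fintype n] [DecidableEq n] (X : Matrix n n ℂ) (s : ℝ) : Matrix n n ℂ :=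
  cfc (fun x : ℝ => x ^ s) X

/-- The support of a Hermitian operator, i.e. the orthogonal complement of its kernel, which is
its range. -/
def supp {n : Type*} [Fintype n] (X : Matrix n n ℂ) : Submodule ℂ (n → ℂ) :=
  LinearMap.range X.mulVecLin

/-- The binary logarithm of a nonnegative real number, with `log 0 = -∞`. -/
def elog (x : ℝ) : EReal :=
  if x = 0 then ⊥ else ((Real.logb 2 x : ℝ) : EReal)

/-- `tr [(σ ^ (-α' / 2) * ρ * σ ^ (-α' / 2)) ^ α]` with `α' = (α - 1) / α`. -/
def sandwichedTrace {n : Type*} [Fintype n] [DecidableEq n]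
    (α : ℝ) (ρ σ : Matrix n n ℂ) : ℝ :=
  (mpow (mpow σ (-((α - 1) / α) / 2) * ρ * mpow σ (-((α - 1) / α) / 2)) α).trace.re

open scoped Classical in
/-- The sandwiched Rényi divergence `D_α(ρ ‖ σ)`. -/
def divergence {n : Type*} [Fintype n] [DecidableEq n]
    (α : ℝ) (ρ σ : Matrix n n ℂ) : EReal :=
  if 1 < α ∧ ¬ supp ρ ≤ supp σ then ⊤
  else ((1 / (α - 1) : ℝ) : EReal) * elog (1 / ρ.trace.re * sandwichedTrace α ρ σ)

/-- `H_α(A|B)_{ρ|σ} = -D_α(ρ_AB ‖ id_A ⊗ σ_B)`. -/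
def condEntropyRel {a b : Type*} [Fintype a] [DecidableEq a] [Fintype b] [DecidableEq b]
    (α : ℝ) (ρ : Matrix (a × b) (a × b) ℂ) (σ : Matrix b b ℂ) : EReal :=
  -divergence α ρ ((1 : Matrix a a ℂ) ⊗ₖ σ)

/-- `H_α(A|B)_ρ = -inf_ω D_α(ρ_AB ‖ id_A ⊗ ω_B)`, over all density operators `ω_B`. -/
def condEntropy {a b : Type*} [Fintype a] [DecidableEq a] [Fintype b] [DecidableEq b]
    (α : ℝ) (ρ : Matrix (a × b) (a × b) ℂ) : EReal :=
  -⨅ (ω : Matrix b b ℂ) (_ : IsDensity ω), divergence α ρ ((1 : Matrix a a ℂ) ⊗ₖ ω)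

/-- A tripartite operator on `A ⊗ (B ⊗ C)` viewed as an operator on `(A ⊗ B) ⊗ C`. -/
def regroup {a b c : Type*} (ρ : Matrix (a × b × c) (a × b × c) ℂ) :
    Matrix ((a × b) × c) ((a × b) × c) ℂ :=
  ρ.submatrix (Equiv.prodAssoc a b c) (Equiv.prodAssoc a b c)

/-- The partial trace over the first tensor factor: `ρ_AB ↦ ρ_B`. -/
def traceFst {a b : Type*} [Fintype a] (ρ : Matrix (a × b) (a × b) ℂ) : Matrix b b ℂ :=
  Matrix.of fun j j' => ∑ i, ρ (i, j) (i, j')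

end RenyiChain

end

/-!
# Chain rules for sandwiched conditional Rényi entropies

Write `s = (α - 1) / α`, so that the hypothesis on the parameters reads `1 / r = 1 / s + 1 / t` for
the numbers `r`, `s`, `t` belonging to `α`, `β`, `γ`. The proof purifies the state and replaces each
entropy by the logarithm of a bilinear quantity that can be interpolated.

**Entropies as minimax values.** Let `ρ` be the marginal on `e`, `n` of a pure state of `e`, `n`,
`d`, seen as a family `X` of matrices from `d` to `n` indexed by `e`. For a fixed operator `S` on
`n`, `sandwichedTrace` is a power of the norm `condNorm s X S`, and that norm is the supremum
(`s > 0`) or infimum (`s < 0`) of the pairing `∑ i, tr (X iᴴ S ^ (-s) X i τ ^ s)` over densities `τ`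
on `d` (`pairing_le_condNorm`, `condNorm_le` and their negative versions), by Hölder's inequality.
Optimizing over `S` too gives a minimax problem which is bilinear in `S ^ (-s)` and `τ ^ s`; after
the sets of such powers are replaced by the convex sets `powerBall` and `inversePowerSet`, Sion's
theorem provides its value (`exists_isMinimaxValue`). For `α > 1` one has
`condEntropy α ρ = -(1 / s) log v` with `v` the value of `X`, and for `α < 1` one has
`condEntropy α ρ = (1 / u) log v` with `u = -s` and `v` the value of the adjoint family
(`condEntropy_of_one_lt`, `condEntropy_of_lt_one`).

**Interpolation.** For a pure state on `a`, `b`, `c`, `d` the three entropies belong to three ways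
`familyAB`, `familyA`, `familyB` of cutting the same tensor into matrices. For `α > 1` the possible
signs of `(s, t)` are `(+, +)`, `(+, -)` and `(-, +)`, and for each of them the chain rule is one
inequality between pairings: `interpolation_sup_sup`, `interpolation_inf_inf` and
`interpolation_sup_inf`. They follow from the three lines theorem applied to `tr (Gᴴ F(z))`, where
`F` is a product of complex powers of positive matrices and `G` is its value at the intermediate
point. Since optimal densities are invariant under the imaginary powers only up to rotation, an
extra density dominating `G Gᴴ` or `Gᴴ G` is inserted in `F`; it makes the boundary values
comparable with the pairings at arbitrary rotated densities.

**Remaining cases.** For `α < 1`, the conjugate tensor with `a`, `b` and `c`, `d` exchanged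
(`dualState`) has the adjoint families, so the same three inequalities apply with all signs
reversed and `β`, `γ` exchanged. For a fixed singular `σ`, the supports of the states on `a`, `b`, `c`
and on `b`, `c` satisfy the support condition together. If it fails, the entropy of order `α > 1` is
`-∞`, and so is that of order `γ` in the only case where this is needed, `γ > 1`. If it holds, `σ`
may be made positive definite by changing it on its kernel (`fillKer`) without affecting the norms.
-/

noncomputable section

namespace RenyiChain

open Matrix

set_option linter.unusedSectionVars false

/-! ### Functional calculus of Hermitian matrices -/

section FunctionalCalculus

variable {n m e : Type*} [Fintype n] [DecidableEq n] [Fintype m] [DecidableEq m]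
  [Fintype e] [DecidableEq e]

/-- The functional calculus of a Hermitian matrix for complex-valued functions on the real line,
through a diagonalization; its value is `0` on matrices that are not Hermitian. No continuity is
asked of `f`, as the spectrum is finite. -/
def cfun (f : ℝ → ℂ) (A : Matrix n n ℂ) : Matrix n n ℂ :=
  open scoped Classical in
  if hA : A.IsHermitian then
    (hA.eigenvectorUnitary : Matrix n n ℂ) * diagonal (fun i => f (hA.eigenvalues i)) *
      (hA.eigenvectorUnitary : Matrix n n ℂ)ᴴ
  else 0

lemma cfun_def {A : Matrix n n ℂ} (hA : A.IsHermitian) (f : ℝ → ℂ) :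
    cfun f A = (hA.eigenvectorUnitary : Matrix n n ℂ) *
      diagonal (fun i => f (hA.eigenvalues i)) * (hA.eigenvectorUnitary : Matrix n n ℂ)ᴴ := by
  simp [cfun, hA]

lemma eigenvectorUnitary_mul_conjTranspose {A : Matrix n n ℂ} (hA : A.IsHermitian) :
    (hA.eigenvectorUnitary : Matrix n n ℂ) * (hA.eigenvectorUnitary : Matrix n n ℂ)ᴴ = 1 :=
  Unitary.coe_mul_star_self hA.eigenvectorUnitary

lemma conjTranspose_mul_eigenvectorUnitary {A : Matrix n n ℂ} (hA : A.IsHermitian) :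
    (hA.eigenvectorUnitary : Matrix n n ℂ)ᴴ * (hA.eigenvectorUnitary : Matrix n n ℂ) = 1 :=
  Unitary.coe_star_mul_self hA.eigenvectorUnitary

lemma cfun_ofReal {A : Matrix n n ℂ} (hA : A.IsHermitian) : cfun (fun x => (x : ℂ)) A = A := by
  rw [cfun_def hA]
  conv_rhs => rw [hA.spectral_theorem, Unitary.conjStarAlgAut_apply]
  rfl

lemma cfc_eq_cfun {A : Matrix n n ℂ} (hA : A.IsHermitian) (f : ℝ → ℝ) :
    cfc f A = cfun (fun x => (f x : ℂ)) A := by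
  rw [hA.cfc_eq, IsHermitian.cfc, Unitary.conjStarAlgAut_apply, cfun_def hA]
  rfl

lemma cfun_congr {A : Matrix n n ℂ} (hA : A.IsHermitian) {f g : ℝ → ℂ}
    (h : ∀ i, f (hA.eigenvalues i) = g (hA.eigenvalues i)) : cfun f A = cfun g A := by
  rw [cfun_def hA, cfun_def hA]
  simp_rw [h]

lemma cfun_mul_cfun {A : Matrix n n ℂ} (hA : A.IsHermitian) (f g : ℝ → ℂ) :
    cfun f A * cfun g A = cfun (fun x => f x * g x) A := by
  simp only [cfun_def hA]
  calc _ = (hA.eigenvectorUnitary : Matrix n n ℂ) * diagonal (fun i => f (hA.eigenvalues i)) *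
        ((hA.eigenvectorUnitary : Matrix n n ℂ)ᴴ * (hA.eigenvectorUnitary : Matrix n n ℂ)) *
        diagonal (fun i => g (hA.eigenvalues i)) * (hA.eigenvectorUnitary : Matrix n n ℂ)ᴴ := by
        simp only [Matrix.mul_assoc]
    _ = _ := by
        rw [conjTranspose_mul_eigenvectorUnitary, Matrix.mul_one]
        simp only [Matrix.mul_assoc, ← diagonal_mul_diagonal]

lemma cfun_add_cfun {A : Matrix n n ℂ} (hA : A.IsHermitian) (f g : ℝ → ℂ) :
    cfun f A + cfun g A = cfun (fun x => f x + g x) A := by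
  simp only [cfun_def hA, ← Matrix.add_mul, ← Matrix.mul_add, diagonal_add]

lemma smul_cfun {A : Matrix n n ℂ} (hA : A.IsHermitian) (c : ℂ) (f : ℝ → ℂ) :
    c • cfun f A = cfun (fun x => c * f x) A := by
  simp only [cfun_def hA]
  rw [← Matrix.smul_mul, ← Matrix.mul_smul, ← diagonal_smul]
  rfl

lemma cfun_one {A : Matrix n n ℂ} (hA : A.IsHermitian) : cfun (fun _ => 1) A = 1 := by
  rw [cfun_def hA, diagonal_one, Matrix.mul_one, eigenvectorUnitary_mul_conjTranspose]

lemma conjTranspose_cfun {A : Matrix n n ℂ} (f : ℝ → ℂ) :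
    (cfun f A)ᴴ = cfun (fun x => star (f x)) A := by
  by_cases hA : A.IsHermitian
  · simp only [cfun_def hA, conjTranspose_mul, diagonal_conjTranspose, conjTranspose_conjTranspose,
      Matrix.mul_assoc]
    rfl
  · simp [cfun, hA]

lemma trace_cfun {A : Matrix n n ℂ} (hA : A.IsHermitian) (f : ℝ → ℂ) :
    (cfun f A).trace = ∑ i, f (hA.eigenvalues i) := by
  rw [cfun_def hA, trace_mul_cycle, conjTranspose_mul_eigenvectorUnitary, Matrix.one_mul,
    trace_diagonal]

lemma cfun_posSemidef {A : Matrix n n ℂ} (hA : A.IsHermitian) {f : ℝ → ℂ}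
    (h : ∀ i, 0 ≤ f (hA.eigenvalues i)) : (cfun f A).PosSemidef := by
  rw [cfun_def hA]
  exact (PosSemidef.diagonal h).mul_mul_conjTranspose_same _

lemma cfun_posDef {A : Matrix n n ℂ} (hA : A.IsHermitian) {f : ℝ → ℂ}
    (h : ∀ i, 0 < f (hA.eigenvalues i)) : (cfun f A).PosDef := by
  rw [cfun_def hA]
  refine (PosDef.diagonal h).mul_mul_conjTranspose_same ?_
  exact Matrix.vecMul_injective_of_isUnit
    (IsUnit.of_mul_eq_one _ (eigenvectorUnitary_mul_conjTranspose hA))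

/-- The functional calculus can be computed along any partial diagonalization of the matrix. -/
lemma cfun_mul_of_mul_diagonal {A : Matrix n n ℂ} (hA : A.IsHermitian) (f : ℝ → ℂ)
    {Y : Matrix n m ℂ} {μ : m → ℝ} (h : A * Y = Y * diagonal (fun i => (μ i : ℂ))) :
    cfun f A * Y = Y * diagonal (fun i => f (μ i)) := by
  set U := (hA.eigenvectorUnitary : Matrix n n ℂ) with hU
  have h1 : diagonal (fun i => (hA.eigenvalues i : ℂ)) * (Uᴴ * Y) =
      (Uᴴ * Y) * diagonal (fun i => (μ i : ℂ)) := by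
    rw [Matrix.mul_assoc, ← h]
    conv_rhs => rw [← cfun_ofReal hA, cfun_def hA]
    simp only [← Matrix.mul_assoc]
    rw [conjTranspose_mul_eigenvectorUnitary, Matrix.one_mul]
  have h2 : diagonal (fun i => f (hA.eigenvalues i)) * (Uᴴ * Y) =
      (Uᴴ * Y) * diagonal (fun i => f (μ i)) := by
    ext i j
    have := congrFun (congrFun h1 i) j
    rw [diagonal_mul, mul_diagonal] at this ⊢
    by_cases hz : (Uᴴ * Y) i j = 0
    · simp [hz]
    · rw [mul_comm] at this
      have := mul_left_cancel₀ hz this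
      rw [Complex.ofReal_inj] at this
      rw [this, mul_comm]
  rw [cfun_def hA, ← hU, Matrix.mul_assoc, Matrix.mul_assoc, h2, ← Matrix.mul_assoc,
    ← Matrix.mul_assoc, eigenvectorUnitary_mul_conjTranspose, Matrix.one_mul]

lemma mul_eigenvectorUnitary {A : Matrix n n ℂ} (hA : A.IsHermitian) (f : ℝ → ℂ) :
    cfun f A * (hA.eigenvectorUnitary : Matrix n n ℂ) =
      (hA.eigenvectorUnitary : Matrix n n ℂ) * diagonal (fun i => f (hA.eigenvalues i)) := by
  rw [cfun_def hA, Matrix.mul_assoc, conjTranspose_mul_eigenvectorUnitary, Matrix.mul_one]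

/-- A matrix intertwining two Hermitian matrices intertwines every function of them. -/
lemma cfun_mul_of_intertwine {A : Matrix n n ℂ} {B : Matrix m m ℂ} (hA : A.IsHermitian)
    (hB : B.IsHermitian) (f : ℝ → ℂ) {Y : Matrix n m ℂ} (h : A * Y = Y * B) :
    cfun f A * Y = Y * cfun f B := by
  set V := (hB.eigenvectorUnitary : Matrix m m ℂ) with hV
  have h1 : A * (Y * V) = (Y * V) * diagonal (fun i => (hB.eigenvalues i : ℂ)) := by
    rw [← Matrix.mul_assoc, h, Matrix.mul_assoc, Matrix.mul_assoc,
      ← mul_eigenvectorUnitary hB (fun x => (x : ℂ)), cfun_ofReal hB]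
  have h2 := cfun_mul_of_mul_diagonal hA f h1
  rw [cfun_def hB, ← Matrix.mul_assoc, ← Matrix.mul_assoc, ← h2, ← Matrix.mul_assoc,
    Matrix.mul_assoc _ V, hV, eigenvectorUnitary_mul_conjTranspose, Matrix.mul_one]

lemma cfun_eq_of_mul_diagonal {A : Matrix n n ℂ} (hA : A.IsHermitian) (f : ℝ → ℂ)
    {Y : Matrix n m ℂ} {Z : Matrix m n ℂ} (hYZ : Y * Z = 1) {μ : m → ℝ}
    (h : A * Y = Y * diagonal (fun i => (μ i : ℂ))) :
    cfun f A = Y * diagonal (fun i => f (μ i)) * Z := by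
  rw [← cfun_mul_of_mul_diagonal hA f h, Matrix.mul_assoc, hYZ, Matrix.mul_one]

lemma cfun_isHermitian (A : Matrix n n ℂ) (f : ℝ → ℝ) :
    (cfun (fun x => (f x : ℂ)) A).IsHermitian := by
  rw [IsHermitian, conjTranspose_cfun]
  simp

lemma cfun_cfun {A : Matrix n n ℂ} (hA : A.IsHermitian) (f : ℝ → ℝ) (g : ℝ → ℂ) :
    cfun g (cfun (fun x => (f x : ℂ)) A) = cfun (fun x => g (f x)) A := by
  rw [cfun_eq_of_mul_diagonal (cfun_isHermitian A f) g (eigenvectorUnitary_mul_conjTranspose hA)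
    (mul_eigenvectorUnitary hA _), cfun_def hA]

lemma isHermitian_one_kronecker {A : Matrix n n ℂ} (hA : A.IsHermitian) :
    ((1 : Matrix e e ℂ) ⊗ₖ A).IsHermitian := by
  rw [IsHermitian, conjTranspose_kronecker, conjTranspose_one, hA]

lemma cfun_one_kronecker {A : Matrix n n ℂ} (hA : A.IsHermitian) (f : ℝ → ℂ) :
    cfun f ((1 : Matrix e e ℂ) ⊗ₖ A) = (1 : Matrix e e ℂ) ⊗ₖ cfun f A := by
  have key : ∀ g : n → ℂ, diagonal (fun p : e × n => g p.2) =
      (1 : Matrix e e ℂ) ⊗ₖ diagonal g := by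
    intro g
    rw [← diagonal_one, diagonal_kronecker_diagonal]
    simp
  rw [cfun_eq_of_mul_diagonal (isHermitian_one_kronecker hA) f
    (Y := (1 : Matrix e e ℂ) ⊗ₖ (hA.eigenvectorUnitary : Matrix n n ℂ))
    (Z := (1 : Matrix e e ℂ) ⊗ₖ (hA.eigenvectorUnitary : Matrix n n ℂ)ᴴ)
    (μ := fun p => hA.eigenvalues p.2), key (fun i => f (hA.eigenvalues i)), cfun_def hA,
    ← mul_kronecker_mul, ← mul_kronecker_mul, Matrix.one_mul, Matrix.one_mul]
  · rw [← mul_kronecker_mul, eigenvectorUnitary_mul_conjTranspose, Matrix.one_mul,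
      one_kronecker_one]
  · rw [key (fun i => (hA.eigenvalues i : ℂ)), ← mul_kronecker_mul, ← mul_kronecker_mul,
      ← mul_eigenvectorUnitary hA (fun x => (x : ℂ)), cfun_ofReal hA, Matrix.one_mul]

/-- The traces `tr (f(A) g(B))` are averages of `f(aᵢ) g(bⱼ)` over the eigenvalues, with doubly
stochastic weights `|⟨uᵢ, vⱼ⟩|²` that do not depend on `f` and `g`. -/
lemma exists_weights {A B : Matrix n n ℂ} (hA : A.IsHermitian) (hB : B.IsHermitian) :
    ∃ P : n → n → ℝ, (∀ i j, 0 ≤ P i j) ∧ (∀ i, ∑ j, P i j = 1) ∧ (∀ j, ∑ i, P i j = 1) ∧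
      ∀ f g : ℝ → ℂ, (cfun f A * cfun g B).trace =
        ∑ i, ∑ j, (P i j : ℂ) * (f (hA.eigenvalues i) * g (hB.eigenvalues j)) := by
  set U := (hA.eigenvectorUnitary : Matrix n n ℂ) with hU
  set V := (hB.eigenvectorUnitary : Matrix n n ℂ) with hV
  have hcs : ∀ z : ℂ, ((Complex.normSq z : ℝ) : ℂ) = z * star z := fun z => by
    rw [← Complex.mul_conj]; rfl
  have h1 : (Uᴴ * V) * (Uᴴ * V)ᴴ = 1 := by
    rw [conjTranspose_mul, conjTranspose_conjTranspose, Matrix.mul_assoc, ← Matrix.mul_assoc V,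
      hV, eigenvectorUnitary_mul_conjTranspose, Matrix.one_mul, hU,
      conjTranspose_mul_eigenvectorUnitary]
  have h2 : (Uᴴ * V)ᴴ * (Uᴴ * V) = 1 := by
    rw [conjTranspose_mul, conjTranspose_conjTranspose, Matrix.mul_assoc, ← Matrix.mul_assoc U,
      hU, eigenvectorUnitary_mul_conjTranspose, Matrix.one_mul, hV,
      conjTranspose_mul_eigenvectorUnitary]
  refine ⟨fun i j => Complex.normSq ((Uᴴ * V) i j), fun i j => Complex.normSq_nonneg _,
    fun i => ?_, fun j => ?_, fun f g => ?_⟩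
  · have := congrFun (congrFun h1 i) i
    rw [mul_apply, one_apply_eq] at this
    apply Complex.ofReal_injective
    push_cast
    rw [← this]
    exact Finset.sum_congr rfl fun j _ => by rw [hcs, conjTranspose_apply]
  · have := congrFun (congrFun h2 j) j
    rw [mul_apply, one_apply_eq] at this
    apply Complex.ofReal_injective
    push_cast
    rw [← this]
    exact Finset.sum_congr rfl fun j _ => by rw [hcs, conjTranspose_apply, mul_comm]
  · rw [cfun_def hA, cfun_def hB]
    have : (U * diagonal (fun i => f (hA.eigenvalues i)) * Uᴴ *
        (V * diagonal (fun i => g (hB.eigenvalues i)) * Vᴴ)).trace =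
        (diagonal (fun i => f (hA.eigenvalues i)) * ((Uᴴ * V) *
          diagonal (fun i => g (hB.eigenvalues i)) * (Uᴴ * V)ᴴ)).trace := by
      rw [conjTranspose_mul, conjTranspose_conjTranspose]
      simp only [Matrix.mul_assoc]
      rw [trace_mul_comm]
      simp only [Matrix.mul_assoc]
    rw [this]
    simp only [Matrix.trace, diag_apply, diagonal_mul]
    refine Finset.sum_congr rfl fun i _ => ?_
    rw [mul_apply, Finset.mul_sum]
    refine Finset.sum_congr rfl fun j _ => ?_
    rw [mul_diagonal, hcs, conjTranspose_apply]
    ring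

end FunctionalCalculus

/-! ### Powers of matrices -/

section Powers

variable {n m e : Type*} [Fintype n] [DecidableEq n] [Fintype m] [DecidableEq m]
  [Fintype e] [DecidableEq e]

lemma mpow_eq_cfun {A : Matrix n n ℂ} (hA : A.IsHermitian) (s : ℝ) :
    mpow A s = cfun (fun x => ((x ^ s : ℝ) : ℂ)) A :=
  cfc_eq_cfun hA _

lemma mpow_posSemidef {A : Matrix n n ℂ} (hA : A.PosSemidef) (s : ℝ) : (mpow A s).PosSemidef := by
  rw [mpow_eq_cfun hA.1]
  refine cfun_posSemidef hA.1 fun i => ?_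
  have := Real.rpow_nonneg (hA.eigenvalues_nonneg i) s
  exact_mod_cast this

lemma mpow_posDef {A : Matrix n n ℂ} (hA : A.PosDef) (s : ℝ) : (mpow A s).PosDef := by
  rw [mpow_eq_cfun hA.1]
  refine cfun_posDef hA.1 fun i => ?_
  have := Real.rpow_pos_of_pos (hA.eigenvalues_pos i) s
  exact_mod_cast this

lemma mpow_mul_mpow {A : Matrix n n ℂ} (hA : A.PosDef) (s t : ℝ) :
    mpow A s * mpow A t = mpow A (s + t) := by
  rw [mpow_eq_cfun hA.1, mpow_eq_cfun hA.1, mpow_eq_cfun hA.1, cfun_mul_cfun hA.1]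
  refine cfun_congr hA.1 fun i => ?_
  rw [Real.rpow_add (hA.eigenvalues_pos i)]
  push_cast
  rfl

/-- The semidefinite case needs `s + t ≠ 0`, as otherwise the left side is the projection onto the
support while the right side is `1`. -/
lemma mpow_mul_mpow_of_posSemidef {A : Matrix n n ℂ} (hA : A.PosSemidef) {s t : ℝ}
    (h : s + t ≠ 0) : mpow A s * mpow A t = mpow A (s + t) := by
  rw [mpow_eq_cfun hA.1, mpow_eq_cfun hA.1, mpow_eq_cfun hA.1, cfun_mul_cfun hA.1]
  refine cfun_congr hA.1 fun i => ?_
  rw [Real.rpow_add' (hA.eigenvalues_nonneg i) h]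
  push_cast
  rfl

lemma mpow_zero {A : Matrix n n ℂ} (hA : A.IsHermitian) : mpow A 0 = 1 := by
  rw [mpow_eq_cfun hA, ← cfun_one hA]
  exact cfun_congr hA fun i => by simp

lemma mpow_one {A : Matrix n n ℂ} (hA : A.IsHermitian) : mpow A 1 = A := by
  rw [mpow_eq_cfun hA]
  conv_rhs => rw [← cfun_ofReal hA]
  exact cfun_congr hA fun i => by simp

lemma mpow_mpow {A : Matrix n n ℂ} (hA : A.PosSemidef) (s t : ℝ) :
    mpow (mpow A s) t = mpow A (s * t) := by
  rw [mpow_eq_cfun (mpow_posSemidef hA s).1, mpow_eq_cfun hA.1, mpow_eq_cfun hA.1,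
    cfun_cfun hA.1 (fun x => x ^ s)]
  refine cfun_congr hA.1 fun i => ?_
  rw [Real.rpow_mul (hA.eigenvalues_nonneg i)]

lemma mpow_smul {A : Matrix n n ℂ} (hA : A.PosSemidef) {c : ℝ} (hc : 0 ≤ c) (s : ℝ) :
    mpow ((c : ℂ) • A) s = ((c ^ s : ℝ) : ℂ) • mpow A s := by
  have h1 : (c : ℂ) • A = cfun (fun x => ((c * x : ℝ) : ℂ)) A := by
    conv_lhs => rw [← cfun_ofReal hA.1, smul_cfun hA.1]
    simp
  have h2 : ((c : ℂ) • A).IsHermitian := by rw [h1]; exact cfun_isHermitian _ _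
  rw [mpow_eq_cfun h2, h1, cfun_cfun hA.1 (fun x => c * x), mpow_eq_cfun hA.1, smul_cfun hA.1]
  refine cfun_congr hA.1 fun i => ?_
  rw [Real.mul_rpow hc (hA.eigenvalues_nonneg i)]
  push_cast
  rfl

lemma mpow_one_kronecker {A : Matrix n n ℂ} (hA : A.IsHermitian) (s : ℝ) :
    mpow ((1 : Matrix e e ℂ) ⊗ₖ A) s = (1 : Matrix e e ℂ) ⊗ₖ mpow A s := by
  rw [mpow_eq_cfun (isHermitian_one_kronecker hA), mpow_eq_cfun hA, cfun_one_kronecker hA]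

lemma trace_mpow {A : Matrix n n ℂ} (hA : A.IsHermitian) (s : ℝ) :
    (mpow A s).trace = ((∑ i, hA.eigenvalues i ^ s : ℝ) : ℂ) := by
  rw [mpow_eq_cfun hA, trace_cfun hA]
  push_cast
  rfl

lemma mpow_mul_of_intertwine {A : Matrix n n ℂ} {B : Matrix m m ℂ} (hA : A.IsHermitian)
    (hB : B.IsHermitian) (s : ℝ) {Y : Matrix n m ℂ} (h : A * Y = Y * B) :
    mpow A s * Y = Y * mpow B s := by
  rw [mpow_eq_cfun hA, mpow_eq_cfun hB, cfun_mul_of_intertwine hA hB _ h]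

/-- Complex powers `A ^ z = exp (z log A)` of a positive definite matrix. -/
def mcpow (A : Matrix n n ℂ) (z : ℂ) : Matrix n n ℂ :=
  cfun (fun x => Complex.exp (z * Real.log x)) A

lemma mcpow_ofReal {A : Matrix n n ℂ} (hA : A.PosDef) (s : ℝ) : mcpow A s = mpow A s := by
  rw [mcpow, mpow_eq_cfun hA.1]
  refine cfun_congr hA.1 fun i => ?_
  rw [Real.rpow_def_of_pos (hA.eigenvalues_pos i)]
  push_cast
  rw [mul_comm]

lemma mcpow_mul_mcpow {A : Matrix n n ℂ} (hA : A.IsHermitian) (z w : ℂ) :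
    mcpow A z * mcpow A w = mcpow A (z + w) := by
  rw [mcpow, mcpow, cfun_mul_cfun hA, mcpow]
  simp_rw [add_mul, Complex.exp_add]

lemma mcpow_zero {A : Matrix n n ℂ} (hA : A.IsHermitian) : mcpow A 0 = 1 := by
  rw [mcpow, ← cfun_one hA]
  simp

lemma conjTranspose_mcpow {A : Matrix n n ℂ} (z : ℂ) :
    (mcpow A z)ᴴ = mcpow A (star z) := by
  rw [mcpow, conjTranspose_cfun, mcpow]
  congr 1
  ext x
  rw [Complex.star_def, ← Complex.exp_conj, map_mul, Complex.conj_ofReal]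

lemma mcpow_one_kronecker {A : Matrix n n ℂ} (hA : A.IsHermitian) (z : ℂ) :
    mcpow ((1 : Matrix e e ℂ) ⊗ₖ A) z = (1 : Matrix e e ℂ) ⊗ₖ mcpow A z := by
  rw [mcpow, mcpow, cfun_one_kronecker hA]

/-- Imaginary powers are unitary. -/
lemma mcpow_mul_conjTranspose_self {A : Matrix n n ℂ} (hA : A.IsHermitian) {z : ℂ}
    (hz : z.re = 0) : mcpow A z * (mcpow A z)ᴴ = 1 := by
  rw [conjTranspose_mcpow, mcpow_mul_mcpow hA, ← mcpow_zero hA]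
  congr 1
  apply Complex.ext <;> simp [hz]

lemma conjTranspose_mul_mcpow_self {A : Matrix n n ℂ} (hA : A.IsHermitian) {z : ℂ}
    (hz : z.re = 0) : (mcpow A z)ᴴ * mcpow A z = 1 := by
  rw [conjTranspose_mcpow, mcpow_mul_mcpow hA, ← mcpow_zero hA]
  congr 1
  apply Complex.ext <;> simp [hz]

/-- Conjugation by a unitary commutes with powers. -/
lemma mpow_conj {A : Matrix n n ℂ} (hA : A.IsHermitian) {U : Matrix n n ℂ} (hU : Uᴴ * U = 1)
    (s : ℝ) : mpow (U * A * Uᴴ) s = U * mpow A s * Uᴴ := by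
  have hU' : U * Uᴴ = 1 := mul_eq_one_comm.mp hU
  have h1 : (U * A * Uᴴ).IsHermitian := by
    rw [IsHermitian, conjTranspose_mul, conjTranspose_mul, conjTranspose_conjTranspose, hA,
      Matrix.mul_assoc]
  have h2 : mpow (U * A * Uᴴ) s * U = U * mpow A s := by
    refine mpow_mul_of_intertwine h1 hA s ?_
    rw [Matrix.mul_assoc, hU, Matrix.mul_one]
  rw [← h2, Matrix.mul_assoc _ U, hU', Matrix.mul_one]

/-- `Y Yᴴ` and `Yᴴ Y` have the same nonzero eigenvalues; for `p = 0` the dimensions interfere. -/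
lemma trace_mpow_mul_conjTranspose (Y : Matrix n m ℂ) {p : ℝ} (hp : p ≠ 0) :
    (mpow (Y * Yᴴ) p).trace = (mpow (Yᴴ * Y) p).trace := by
  have h1 := posSemidef_self_mul_conjTranspose Y
  have h2 := posSemidef_conjTranspose_mul_self Y
  have e1 : mpow (Y * Yᴴ) p = mpow (Y * Yᴴ) (p - 1) * (Y * Yᴴ) := by
    conv_rhs => rw [← mpow_one h1.1, mpow_mpow h1, one_mul]
    rw [mpow_mul_mpow_of_posSemidef h1 (by simpa using hp), sub_add_cancel]
  have e2 : mpow (Yᴴ * Y) p = (Yᴴ * Y) * mpow (Yᴴ * Y) (p - 1) := by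
    conv_rhs => rw [← mpow_one h2.1, mpow_mpow h2, one_mul]
    rw [mpow_mul_mpow_of_posSemidef h2 (by simpa using hp), add_sub_cancel]
  rw [e1, e2, ← Matrix.mul_assoc, mpow_mul_of_intertwine h1.1 h2.1 (p - 1)
    (Matrix.mul_assoc Y Yᴴ Y), trace_mul_comm, ← Matrix.mul_assoc]

end Powers

/-! ### Densities and variational formulas for traces of powers -/

section TraceHolder

variable {n m e : Type*} [Fintype n] [DecidableEq n] [Fintype m] [DecidableEq m]
  [Fintype e] [DecidableEq e]

/-- Hölder's inequality for weighted sums. -/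
lemma sum_mul_rpow_le {ι : Type*} (t : Finset ι) {w x y : ι → ℝ} (hw : ∀ i ∈ t, 0 ≤ w i)
    (hx : ∀ i ∈ t, 0 ≤ x i) (hy : ∀ i ∈ t, 0 ≤ y i) {p : ℝ} (hp0 : 0 < p) (hp1 : p < 1) :
    ∑ i ∈ t, w i * (x i ^ p * y i ^ (1 - p)) ≤
      (∑ i ∈ t, w i * x i) ^ p * (∑ i ∈ t, w i * y i) ^ (1 - p) := by
  have hq0 : 0 < 1 - p := by linarith
  have hpq : (1 / p).HolderConjugate (1 / (1 - p)) := by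
    rw [Real.holderConjugate_iff]
    refine ⟨by rw [lt_div_iff₀ hp0]; linarith, by simp⟩
  have h := Real.inner_le_Lp_mul_Lq_of_nonneg t (f := fun i => (w i * x i) ^ p)
    (g := fun i => (w i * y i) ^ (1 - p)) hpq
    (fun i hi => Real.rpow_nonneg (mul_nonneg (hw i hi) (hx i hi)) _)
    (fun i hi => Real.rpow_nonneg (mul_nonneg (hw i hi) (hy i hi)) _)
  have e1 : ∑ i ∈ t, ((w i * x i) ^ p) ^ (1 / p) = ∑ i ∈ t, w i * x i :=
    Finset.sum_congr rfl fun i hi => by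
      rw [← Real.rpow_mul (mul_nonneg (hw i hi) (hx i hi)), mul_one_div_cancel hp0.ne',
        Real.rpow_one]
  have e2 : ∑ i ∈ t, ((w i * y i) ^ (1 - p)) ^ (1 / (1 - p)) = ∑ i ∈ t, w i * y i :=
    Finset.sum_congr rfl fun i hi => by
      rw [← Real.rpow_mul (mul_nonneg (hw i hi) (hy i hi)), mul_one_div_cancel hq0.ne',
        Real.rpow_one]
  have e3 : ∑ i ∈ t, (w i * x i) ^ p * (w i * y i) ^ (1 - p) =
      ∑ i ∈ t, w i * (x i ^ p * y i ^ (1 - p)) :=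
    Finset.sum_congr rfl fun i hi => by
      rw [Real.mul_rpow (hw i hi) (hx i hi), Real.mul_rpow (hw i hi) (hy i hi)]
      have : w i ^ p * w i ^ (1 - p) = w i := by
        rw [← Real.rpow_add' (hw i hi) (by simp), add_sub_cancel, Real.rpow_one]
      calc _ = (w i ^ p * w i ^ (1 - p)) * (x i ^ p * y i ^ (1 - p)) := by ring
        _ = _ := by rw [this]
  rw [e1, e2, e3, one_div_one_div, one_div_one_div] at h
  exact h

/-- Hölder's inequality for traces of the form `tr (f(A) g(B))`. -/
lemma trace_holder {A B : Matrix n n ℂ} (hA : A.IsHermitian) (hB : B.IsHermitian)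
    {f₁ g₁ f₂ g₂ f₃ g₃ : ℝ → ℝ} {p : ℝ} (hp0 : 0 < p) (hp1 : p < 1)
    (h2 : ∀ i j, 0 ≤ f₂ (hA.eigenvalues i) * g₂ (hB.eigenvalues j))
    (h3 : ∀ i j, 0 ≤ f₃ (hA.eigenvalues i) * g₃ (hB.eigenvalues j))
    (h : ∀ i j, f₁ (hA.eigenvalues i) * g₁ (hB.eigenvalues j) ≤
      (f₂ (hA.eigenvalues i) * g₂ (hB.eigenvalues j)) ^ p *
        (f₃ (hA.eigenvalues i) * g₃ (hB.eigenvalues j)) ^ (1 - p)) :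
    (cfun (fun x => (f₁ x : ℂ)) A * cfun (fun x => (g₁ x : ℂ)) B).trace.re ≤
      (cfun (fun x => (f₂ x : ℂ)) A * cfun (fun x => (g₂ x : ℂ)) B).trace.re ^ p *
        (cfun (fun x => (f₃ x : ℂ)) A * cfun (fun x => (g₃ x : ℂ)) B).trace.re ^ (1 - p) := by
  obtain ⟨P, hP, -, -, hPt⟩ := exists_weights hA hB
  have key : ∀ f g : ℝ → ℝ,
      (cfun (fun x => (f x : ℂ)) A * cfun (fun x => (g x : ℂ)) B).trace.re =
        ∑ ij : n × n, P ij.1 ij.2 * (f (hA.eigenvalues ij.1) * g (hB.eigenvalues ij.2)) := by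
    intro f g
    rw [hPt, Fintype.sum_prod_type, ← Complex.ofReal_re (∑ i, ∑ j, _)]
    push_cast
    rfl
  rw [key, key, key]
  refine le_trans (Finset.sum_le_sum fun ij _ => mul_le_mul_of_nonneg_left (h ij.1 ij.2)
    (hP _ _)) ?_
  exact sum_mul_rpow_le _ (fun ij _ => hP _ _) (fun ij _ => h2 _ _) (fun ij _ => h3 _ _) hp0 hp1

/-- Positive definite matrices of unit trace. -/
def IsPosDensity (ω : Matrix n n ℂ) : Prop := ω.PosDef ∧ ω.trace = 1

lemma IsPosDensity.isDensity {ω : Matrix n n ℂ} (h : IsPosDensity ω) : IsDensity ω :=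
  ⟨h.1.posSemidef, h.2⟩

lemma trace_mul_nonneg {A B : Matrix n n ℂ} (hA : A.PosSemidef) (hB : B.PosSemidef) :
    0 ≤ (A * B).trace.re := by
  have h1 : B = (mpow B (1 / 2)) * (mpow B (1 / 2)) := by
    rw [mpow_mul_mpow_of_posSemidef hB (by norm_num)]
    norm_num [mpow_one hB.1]
  have h2 : (mpow B (1 / 2))ᴴ = mpow B (1 / 2) := (mpow_posSemidef hB _).1
  have h3 := hA.conjTranspose_mul_mul_same (mpow B (1 / 2))
  rw [h1, ← Matrix.mul_assoc, trace_mul_comm, ← Matrix.mul_assoc]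
  rw [h2] at h3
  exact (Complex.le_def.mp h3.trace_nonneg).1

lemma trace_mul_mono {A B N : Matrix n n ℂ} (hN : N.PosSemidef) (h : (B - A).PosSemidef) :
    (N * A).trace.re ≤ (N * B).trace.re := by
  have := trace_mul_nonneg hN h
  rw [Matrix.mul_sub, trace_sub, Complex.sub_re] at this
  linarith

lemma trace_mpow_nonneg {A : Matrix n n ℂ} (hA : A.PosSemidef) (s : ℝ) :
    0 ≤ (mpow A s).trace.re :=
  (Complex.le_def.mp (mpow_posSemidef hA s).trace_nonneg).1

/-- `tr (N τ ^ s) ≤ ‖N‖_p` for a density `τ`, where `1 / p = 1 - s`. -/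
lemma trace_mul_mpow_le {N τ : Matrix n n ℂ} (hN : N.PosSemidef) (hτ : IsDensity τ) {s : ℝ}
    (hs0 : 0 < s) (hs1 : s < 1) :
    (N * mpow τ s).trace.re ≤ (mpow N (1 / (1 - s))).trace.re ^ (1 - s) := by
  have hq : 0 < 1 - s := by linarith
  have h := trace_holder hN.1 hτ.1.1 (f₁ := fun x => x) (g₁ := fun x => x ^ s)
    (f₂ := fun x => x ^ (1 / (1 - s))) (g₂ := fun _ => 1) (f₃ := fun _ => 1) (g₃ := fun x => x)
    hq (by linarith)
    (fun i j => by have := Real.rpow_nonneg (hN.eigenvalues_nonneg i) (1 / (1 - s)); simpa)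
    (fun i j => by have := hτ.1.eigenvalues_nonneg j; simpa) (fun i j => by
      rw [mul_one, ← Real.rpow_mul (hN.eigenvalues_nonneg i), one_div_mul_cancel hq.ne',
        Real.rpow_one, one_mul, sub_sub_cancel])
  simp only [Complex.ofReal_one] at h
  rw [cfun_ofReal hN.1, ← mpow_eq_cfun hτ.1.1, ← mpow_eq_cfun hN.1, cfun_one hN.1,
    cfun_one hτ.1.1, cfun_ofReal hτ.1.1, Matrix.mul_one, Matrix.one_mul, hτ.2, Complex.one_re,
    Real.one_rpow, mul_one] at h
  exact h

/-- `‖N‖_q ≤ tr (N τ ^ (-u))` for a positive density `τ`, where `1 / q = 1 + u`. -/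
lemma le_trace_mul_mpow_neg {N τ : Matrix n n ℂ} (hN : N.PosSemidef) (hτ : IsPosDensity τ)
    {u : ℝ} (hu : 0 < u) :
    (mpow N (1 / (1 + u))).trace.re ^ (1 + u) ≤ (N * mpow τ (-u)).trace.re := by
  have hq : 0 < 1 + u := by linarith
  have hq1 : 1 / (1 + u) < 1 := by rw [div_lt_one hq]; linarith
  have h := trace_holder hN.1 hτ.1.1 (f₁ := fun x => x ^ (1 / (1 + u))) (g₁ := fun x => 1)
    (f₂ := fun x => x) (g₂ := fun x => x ^ (-u)) (f₃ := fun _ => 1) (g₃ := fun x => x)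
    (by positivity : 0 < 1 / (1 + u)) hq1
    (fun i j => mul_nonneg (hN.eigenvalues_nonneg i)
      (Real.rpow_nonneg (hτ.1.eigenvalues_pos j).le _))
    (fun i j => by have := (hτ.1.eigenvalues_pos j).le; simpa) (fun i j => by
      have hb := hτ.1.eigenvalues_pos j
      have e : -u * (1 / (1 + u)) + (1 - 1 / (1 + u)) = 0 := by field_simp; ring
      rw [mul_one, one_mul, Real.mul_rpow (hN.eigenvalues_nonneg i) (Real.rpow_nonneg hb.le _),
        ← Real.rpow_mul hb.le, mul_assoc, ← Real.rpow_add hb, e, Real.rpow_zero, mul_one])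
  simp only [Complex.ofReal_one] at h
  rw [cfun_ofReal hN.1, ← mpow_eq_cfun hτ.1.1, ← mpow_eq_cfun hN.1, cfun_one hN.1,
    cfun_one hτ.1.1, cfun_ofReal hτ.1.1, Matrix.mul_one, Matrix.one_mul, hτ.2, Complex.one_re,
    Real.one_rpow, mul_one] at h
  have h0 := trace_mul_nonneg hN (mpow_posSemidef hτ.1.posSemidef (-u))
  calc _ ≤ ((N * mpow τ (-u)).trace.re ^ (1 / (1 + u))) ^ (1 + u) :=
        Real.rpow_le_rpow (trace_mpow_nonneg hN _) h hq.le
    _ = _ := by rw [← Real.rpow_mul h0, one_div_mul_cancel hq.ne', Real.rpow_one]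

/-- Hölder's inequality for the dual exponents of inverse powers: it puts `ω ^ (-s)` into the convex
set used in the minimax argument. -/
lemma one_le_trace_mpow_neg_mul {ω τ : Matrix n n ℂ} (hω : IsPosDensity ω) (hτ : IsPosDensity τ)
    {s : ℝ} (hs : 0 < s) : 1 ≤ (mpow ω (-s) * mpow τ (1 + s)).trace.re := by
  have hq : 0 < 1 + s := by linarith
  have hq1 : 1 / (1 + s) < 1 := by rw [div_lt_one hq]; linarith
  have h := trace_holder hω.1.1 hτ.1.1 (f₁ := fun _ => 1) (g₁ := fun x => x)
    (f₂ := fun x => x ^ (-s)) (g₂ := fun x => x ^ (1 + s)) (f₃ := fun x => x) (g₃ := fun _ => 1)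
    (by positivity : 0 < 1 / (1 + s)) hq1
    (fun i j => mul_nonneg (Real.rpow_nonneg (hω.1.eigenvalues_pos i).le _)
      (Real.rpow_nonneg (hτ.1.eigenvalues_pos j).le _))
    (fun i j => by have := (hω.1.eigenvalues_pos i).le; simpa) (fun i j => by
      have ha := hω.1.eigenvalues_pos i
      have hb := hτ.1.eigenvalues_pos j
      have e : -s * (1 / (1 + s)) + (1 - 1 / (1 + s)) = 0 := by field_simp; ring
      rw [mul_one, one_mul, Real.mul_rpow (Real.rpow_nonneg ha.le _) (Real.rpow_nonneg hb.le _),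
        ← Real.rpow_mul ha.le, ← Real.rpow_mul hb.le, mul_one_div_cancel hq.ne', Real.rpow_one,
        mul_right_comm, ← Real.rpow_add ha, e, Real.rpow_zero, one_mul])
  simp only [Complex.ofReal_one] at h
  rw [cfun_one hω.1.1, cfun_ofReal hτ.1.1, ← mpow_eq_cfun hω.1.1, ← mpow_eq_cfun hτ.1.1,
    cfun_ofReal hω.1.1, cfun_one hτ.1.1, Matrix.mul_one, Matrix.one_mul, hτ.2, hω.2,
    Complex.one_re, Real.one_rpow, mul_one] at h
  by_contra! hlt
  have h0 := trace_mul_nonneg (mpow_posSemidef hω.1.posSemidef (-s))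
    (mpow_posSemidef hτ.1.posSemidef (1 + s))
  have := Real.rpow_lt_one h0 hlt (by positivity : 0 < 1 / (1 + s))
  linarith

lemma add_smul_one_eq_cfun {M : Matrix n n ℂ} (hM : M.IsHermitian) (δ : ℝ) :
    M + (δ : ℂ) • (1 : Matrix n n ℂ) = cfun (fun x => ((x + δ : ℝ) : ℂ)) M := by
  push_cast
  rw [← cfun_add_cfun hM, cfun_ofReal hM]
  congr 1
  rw [← cfun_one hM, smul_cfun hM]
  simp

lemma mpow_add_smul_one {M : Matrix n n ℂ} (hM : M.IsHermitian) (δ s : ℝ) :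
    mpow (M + (δ : ℂ) • (1 : Matrix n n ℂ)) s =
      cfun (fun x => (((x + δ) ^ s : ℝ) : ℂ)) M := by
  rw [add_smul_one_eq_cfun hM, mpow_eq_cfun (cfun_isHermitian _ _),
    cfun_cfun hM (fun x => x + δ)]

lemma posDef_add_smul_one {M : Matrix n n ℂ} (hM : M.PosSemidef) {δ : ℝ} (hδ : 0 < δ) :
    (M + (δ : ℂ) • (1 : Matrix n n ℂ)).PosDef := by
  rw [add_smul_one_eq_cfun hM.1]
  refine cfun_posDef hM.1 fun i => ?_
  have : 0 < hM.1.eigenvalues i + δ := add_pos_of_nonneg_of_pos (hM.eigenvalues_nonneg i) hδ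
  exact_mod_cast this

lemma mpow_add_smul_one_sub {M : Matrix n n ℂ} (hM : M.PosSemidef) {δ s : ℝ} (hδ : 0 ≤ δ)
    (hs : 0 ≤ s) : (mpow (M + (δ : ℂ) • (1 : Matrix n n ℂ)) s - mpow M s).PosSemidef := by
  have : mpow (M + (δ : ℂ) • (1 : Matrix n n ℂ)) s - mpow M s =
      cfun (fun x => (((x + δ) ^ s - x ^ s : ℝ) : ℂ)) M := by
    rw [sub_eq_iff_eq_add, mpow_add_smul_one hM.1, mpow_eq_cfun hM.1, cfun_add_cfun hM.1]
    congr 1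
    ext x
    push_cast
    ring
  rw [this]
  refine cfun_posSemidef hM.1 fun i => ?_
  have := Real.rpow_le_rpow (hM.eigenvalues_nonneg i)
    (by linarith : hM.1.eigenvalues i ≤ hM.1.eigenvalues i + δ) hs
  exact_mod_cast sub_nonneg.mpr this

lemma trace_pos_of_posDef [Nonempty n] {M : Matrix n n ℂ} (hM : M.PosDef) : 0 < M.trace.re :=
  (Complex.lt_def.mp hM.trace_pos).1

lemma trace_eq_re {M : Matrix n n ℂ} (hM : M.IsHermitian) : M.trace = (M.trace.re : ℂ) := by
  apply Complex.ext
  · simp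
  · have : star M.trace = M.trace := by rw [← trace_conjTranspose, hM]
    have := congrArg Complex.im this
    simp only [Complex.star_def, Complex.conj_im, Complex.ofReal_im] at this ⊢
    linarith

lemma isPosDensity_normalize [Nonempty n] {M : Matrix n n ℂ} (hM : M.PosDef) :
    IsPosDensity (((M.trace.re)⁻¹ : ℂ) • M) := by
  have h := trace_pos_of_posDef hM
  constructor
  · exact hM.smul (by rw [← Complex.ofReal_inv]; exact_mod_cast inv_pos.mpr h)
  · rw [trace_smul, smul_eq_mul]
    nth_rewrite 2 [trace_eq_re hM.1]
    rw [inv_mul_cancel₀]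
    exact_mod_cast h.ne'

lemma trace_add_smul_one {M : Matrix n n ℂ} (δ : ℝ) :
    (M + (δ : ℂ) • (1 : Matrix n n ℂ)).trace.re = M.trace.re + δ * Fintype.card n := by
  simp [trace_add, trace_smul, trace_one]

/-- The bound `trace_mul_mpow_le` is sharp. -/
lemma rpow_trace_mpow_le_of_forall [Nonempty n] {N : Matrix n n ℂ} (hN : N.PosSemidef) {s K : ℝ}
    (hs0 : 0 < s) (hs1 : s < 1) (h : ∀ τ, IsPosDensity τ → (N * mpow τ s).trace.re ≤ K) :
    (mpow N (1 / (1 - s))).trace.re ^ (1 - s) ≤ K := by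
  have hq : 0 < 1 - s := by linarith
  set p := 1 / (1 - s) with hp
  have hp0 : 0 < p := by positivity
  have hps : 1 + p * s = p := by rw [hp]; field_simp; ring
  have hK : 0 ≤ K := (trace_mul_nonneg hN (mpow_posSemidef
    (isPosDensity_normalize PosDef.one).1.posSemidef s)).trans (h _ (isPosDensity_normalize PosDef.one))
  set T := (mpow N p).trace.re with hT
  have hT0 : 0 ≤ T := trace_mpow_nonneg hN p
  have hMp := mpow_posSemidef hN p
  -- the optimal `τ` is proportional to `N ^ p`, which is made invertible by adding `δ`
  have key : ∀ δ : ℝ, 0 < δ → T ≤ K * (T + δ * Fintype.card n) ^ s := by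
    intro δ hδ
    have hM := posDef_add_smul_one hMp hδ
    set M := mpow N p + (δ : ℂ) • (1 : Matrix n n ℂ) with hMdef
    have htr : M.trace.re = T + δ * Fintype.card n := trace_add_smul_one δ
    have hc := trace_pos_of_posDef hM
    rw [← htr]
    have h1 := h _ (isPosDensity_normalize hM)
    rw [← Complex.ofReal_inv, mpow_smul hM.posSemidef (inv_pos.mpr hc).le, Matrix.mul_smul,
      trace_smul, smul_eq_mul, Complex.re_ofReal_mul, Real.inv_rpow hc.le,
      inv_mul_le_iff₀ (Real.rpow_pos_of_pos hc s)] at h1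
    have h2 := trace_mul_mono hN (mpow_add_smul_one_sub hMp hδ.le hs0.le)
    have h3 : N * mpow (mpow N p) s = mpow N p := by
      rw [mpow_mpow hN]
      conv_lhs => rw [← mpow_one hN.1, mpow_mpow hN, one_mul]
      rw [mpow_mul_mpow_of_posSemidef hN (by rw [hps]; exact hp0.ne'), hps]
    rw [h3] at h2
    linarith [mul_comm K (M.trace.re ^ s)]
  have lim : Filter.Tendsto (fun δ : ℝ => K * (T + δ * Fintype.card n) ^ s)
      (nhdsWithin 0 (Set.Ioi 0)) (nhds (K * T ^ s)) := by
    have : ContinuousAt (fun δ : ℝ => K * (T + δ * Fintype.card n) ^ s) 0 :=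
      continuousAt_const.mul (ContinuousAt.rpow_const (by fun_prop) (Or.inr hs0.le))
    have h2 := this.tendsto
    simp only [zero_mul, add_zero] at h2
    exact h2.mono_left nhdsWithin_le_nhds
  have hfin : T ≤ K * T ^ s := ge_of_tendsto lim
    (Filter.eventually_of_mem self_mem_nhdsWithin fun δ hδ => key δ hδ)
  rcases hT0.eq_or_lt with h0 | h0
  · rw [← h0, Real.zero_rpow hq.ne']
    exact hK
  · rw [Real.rpow_sub h0, Real.rpow_one, div_le_iff₀ (Real.rpow_pos_of_pos h0 s)]
    exact hfin

lemma tendsto_trace_mpow_add_smul_one {N : Matrix n n ℂ} (hN : N.PosSemidef) {q r : ℝ}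
    (hr : 0 ≤ r) (hq : 0 ≤ q) :
    Filter.Tendsto (fun δ : ℝ => (mpow (N + (δ : ℂ) • (1 : Matrix n n ℂ)) q).trace.re ^ r)
      (nhdsWithin 0 (Set.Ioi 0)) (nhds ((mpow N q).trace.re ^ r)) := by
  have htr : ∀ δ : ℝ, (mpow (N + (δ : ℂ) • (1 : Matrix n n ℂ)) q).trace.re =
      ∑ i, (hN.1.eigenvalues i + δ) ^ q := fun δ => by
    rw [mpow_add_smul_one hN.1, trace_cfun hN.1, ← Complex.ofReal_sum, Complex.ofReal_re]
  simp_rw [htr]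
  rw [trace_mpow hN.1, Complex.ofReal_re]
  have : ContinuousAt (fun δ : ℝ => (∑ i, (hN.1.eigenvalues i + δ) ^ q) ^ r) 0 := by
    refine ContinuousAt.rpow_const ?_ (Or.inr hr)
    refine tendsto_finsetSum _ fun i _ => ?_
    exact ContinuousAt.rpow_const (by fun_prop) (Or.inr hq)
  have h2 := this.tendsto
  simp only [add_zero] at h2
  exact h2.mono_left nhdsWithin_le_nhds

/-- The bound `le_trace_mul_mpow_neg` is sharp. -/
lemma le_rpow_trace_mpow_of_forall [Nonempty n] {N : Matrix n n ℂ} (hN : N.PosSemidef) {u K : ℝ}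
    (hu : 0 < u) (h : ∀ τ, IsPosDensity τ → K ≤ (N * mpow τ (-u)).trace.re) :
    K ≤ (mpow N (1 / (1 + u))).trace.re ^ (1 + u) := by
  -- the optimal `τ` is proportional to `N ^ q`, after `N` is made invertible by adding `δ`
  set q := 1 / (1 + u) with hqdef
  have hq0 : 0 < q := by positivity
  have hqu : q * -u + 1 = q := by rw [hqdef]; field_simp; ring
  have key : ∀ δ : ℝ, 0 < δ →
      K ≤ (mpow (N + (δ : ℂ) • (1 : Matrix n n ℂ)) q).trace.re ^ (1 + u) := by
    intro δ hδ
    have hM := posDef_add_smul_one hN hδ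
    set M := N + (δ : ℂ) • (1 : Matrix n n ℂ) with hMdef
    have hMq := mpow_posDef hM q
    have hc := trace_pos_of_posDef hMq
    have h1 := h _ (isPosDensity_normalize hMq)
    rw [← Complex.ofReal_inv, mpow_smul hMq.posSemidef (inv_pos.mpr hc).le, Matrix.mul_smul,
      trace_smul, smul_eq_mul, Complex.re_ofReal_mul, Real.inv_rpow hc.le, Real.rpow_neg hc.le,
      inv_inv, mpow_mpow hM.posSemidef] at h1
    have h2 : (N * mpow M (q * -u)).trace.re ≤ (mpow M q).trace.re := by
      have : (M - N).PosSemidef := by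
        rw [hMdef, add_sub_cancel_left]
        exact PosSemidef.one.smul (by exact_mod_cast hδ.le)
      have h3 := trace_mul_mono (mpow_posSemidef hM.posSemidef (q * -u)) this
      rw [trace_mul_comm N]
      refine h3.trans_eq ?_
      conv_lhs => rw [← mpow_one hM.1, mpow_mpow hM.posSemidef, one_mul, mpow_mul_mpow hM, hqu]
    rw [add_comm, Real.rpow_add hc, Real.rpow_one]
    exact h1.trans (mul_le_mul_of_nonneg_left h2 (Real.rpow_nonneg hc.le _))
  exact ge_of_tendsto (tendsto_trace_mpow_add_smul_one hN (by linarith) hq0.le)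
    (Filter.eventually_of_mem self_mem_nhdsWithin fun δ hδ => key δ hδ)

end TraceHolder

/-! ### The three lines theorem and Hilbert-Schmidt norms -/

section ThreeLines

variable {n m e : Type*} [Fintype n] [DecidableEq n] [Fintype m] [DecidableEq m]
  [Fintype e] [DecidableEq e]

/-- Entire functions that are bounded on the strip `0 ≤ Re z ≤ 1`. -/
def IsStripBounded (f : ℂ → ℂ) : Prop :=
  Differentiable ℂ f ∧ ∃ C, ∀ z : ℂ, 0 ≤ z.re → z.re ≤ 1 → ‖f z‖ ≤ C

lemma IsStripBounded.const (c : ℂ) : IsStripBounded fun _ => c :=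
  ⟨differentiable_const c, ‖c‖, fun _ _ _ => le_rfl⟩

lemma IsStripBounded.mul {f g : ℂ → ℂ} (hf : IsStripBounded f) (hg : IsStripBounded g) :
    IsStripBounded fun z => f z * g z := by
  obtain ⟨hf, C, hC⟩ := hf
  obtain ⟨hg, D, hD⟩ := hg
  refine ⟨hf.mul hg, C * D, fun z h0 h1 => ?_⟩
  rw [norm_mul]
  exact mul_le_mul (hC z h0 h1) (hD z h0 h1) (norm_nonneg _)
    ((norm_nonneg _).trans (hC z h0 h1))

lemma IsStripBounded.sum {ι : Type*} (s : Finset ι) {f : ι → ℂ → ℂ}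
    (hf : ∀ i ∈ s, IsStripBounded (f i)) : IsStripBounded fun z => ∑ i ∈ s, f i z := by
  choose! C hC using fun i hi => (hf i hi).2
  refine ⟨Differentiable.fun_sum fun i hi => (hf i hi).1, ∑ i ∈ s, C i, fun z h0 h1 => ?_⟩
  exact (norm_sum_le _ _).trans (Finset.sum_le_sum fun i hi => hC i hi z h0 h1)

lemma IsStripBounded.exp (p q r : ℝ) :
    IsStripBounded fun z => Complex.exp ((p + q * z) * r) := by
  refine ⟨by fun_prop, Real.exp (|p * r| + |q * r|), fun z h0 h1 => ?_⟩
  rw [Complex.norm_exp]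
  apply Real.exp_le_exp.mpr
  have : ((p + q * z) * (r : ℂ)).re = p * r + q * r * z.re := by
    simp [add_mul, mul_right_comm]
  rw [this]
  refine add_le_add (le_abs_self _) ?_
  calc q * r * z.re ≤ |q * r| * z.re := mul_le_mul_of_nonneg_right (le_abs_self _) h0
    _ ≤ |q * r| := mul_le_of_le_one_right (abs_nonneg _) h1

/-- Matrix-valued functions whose entries are entire and bounded on the strip `0 ≤ Re z ≤ 1`. -/
def IsStripBoundedMatrix (F : ℂ → Matrix n m ℂ) : Prop :=
  ∀ i j, IsStripBounded fun z => F z i j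

lemma IsStripBoundedMatrix.const (A : Matrix n m ℂ) : IsStripBoundedMatrix fun _ => A :=
  fun i j => .const (A i j)

lemma IsStripBoundedMatrix.mul {F : ℂ → Matrix n m ℂ} {G : ℂ → Matrix m e ℂ}
    (hF : IsStripBoundedMatrix F) (hG : IsStripBoundedMatrix G) :
    IsStripBoundedMatrix fun z => F z * G z := by
  intro i j
  simp only [mul_apply]
  exact .sum _ fun k _ => (hF i k).mul (hG k j)

lemma IsStripBoundedMatrix.trace {F : ℂ → Matrix n n ℂ} (hF : IsStripBoundedMatrix F) :
    IsStripBounded fun z => (F z).trace :=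
  .sum _ fun i _ => hF i i

lemma isStripBoundedMatrix_mcpow {A : Matrix n n ℂ} (hA : A.IsHermitian) (p q : ℝ) :
    IsStripBoundedMatrix fun z => mcpow A (p + q * z) := by
  have : (fun z => mcpow A (p + q * z)) = fun z => (hA.eigenvectorUnitary : Matrix n n ℂ) *
      diagonal (fun i => Complex.exp ((p + q * z) * (Real.log (hA.eigenvalues i) : ℝ))) *
        (hA.eigenvectorUnitary : Matrix n n ℂ)ᴴ := by
    ext1 z
    rw [mcpow, cfun_def hA]
  rw [this]
  refine ((IsStripBoundedMatrix.const _).mul fun i j => ?_).mul (.const _)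
  by_cases h : i = j
  · subst h
    simp only [diagonal_apply_eq]
    exact .exp p q _
  · simp only [diagonal_apply_ne _ h]
    exact .const 0

/-- Hadamard's three lines theorem. -/
lemma IsStripBounded.norm_le {f : ℂ → ℂ} (hf : IsStripBounded f) {θ M₀ M₁ : ℝ} (h0 : 0 ≤ θ)
    (h1 : θ ≤ 1) (hM₀ : ∀ z : ℂ, z.re = 0 → ‖f z‖ ≤ M₀) (hM₁ : ∀ z : ℂ, z.re = 1 → ‖f z‖ ≤ M₁) :
    ‖f θ‖ ≤ M₀ ^ (1 - θ) * M₁ ^ θ := by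
  obtain ⟨hd, C, hC⟩ := hf
  have := Complex.HadamardThreeLines.norm_le_interp_of_mem_verticalClosedStrip₀₁' f (z := θ)
    (a := M₀) (b := M₁) (by simpa [Complex.HadamardThreeLines.verticalClosedStrip] using ⟨h0, h1⟩)
    hd.diffContOnCl ⟨C, by
      rintro _ ⟨z, hz, rfl⟩
      exact hC z hz.1 hz.2⟩ (fun z hz => hM₀ z hz) (fun z hz => hM₁ z hz)
  simpa using this

/-- The square of the Hilbert-Schmidt norm. -/
def hsq (A : Matrix n m ℂ) : ℝ := (Aᴴ * A).trace.re

lemma hsq_eq_sum (A : Matrix n m ℂ) : hsq A = ∑ j, ∑ i, ‖A i j‖ ^ 2 := by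
  rw [hsq, Matrix.trace, Complex.re_sum]
  refine Finset.sum_congr rfl fun j _ => ?_
  rw [diag_apply, mul_apply, Complex.re_sum]
  refine Finset.sum_congr rfl fun i _ => ?_
  rw [conjTranspose_apply, ← Complex.normSq_eq_norm_sq, Complex.star_def,
    ← Complex.normSq_eq_conj_mul_self, Complex.ofReal_re]

lemma hsq_nonneg (A : Matrix n m ℂ) : 0 ≤ hsq A := by
  rw [hsq_eq_sum]
  positivity

lemma hsq_conjTranspose (A : Matrix n m ℂ) : hsq Aᴴ = hsq A := by
  rw [hsq, hsq, conjTranspose_conjTranspose, trace_mul_comm]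

lemma hsq_mul_left {U : Matrix n n ℂ} (hU : Uᴴ * U = 1) (A : Matrix n m ℂ) :
    hsq (U * A) = hsq A := by
  rw [hsq, conjTranspose_mul, Matrix.mul_assoc, ← Matrix.mul_assoc Uᴴ, hU, Matrix.one_mul, hsq]

lemma hsq_mul_right {U : Matrix m m ℂ} (hU : U * Uᴴ = 1) (A : Matrix n m ℂ) :
    hsq (A * U) = hsq A := by
  rw [← hsq_conjTranspose, conjTranspose_mul, hsq_mul_left, hsq_conjTranspose]
  rw [conjTranspose_conjTranspose, hU]

lemma norm_trace_conjTranspose_mul_self (A : Matrix n m ℂ) : ‖(Aᴴ * A).trace‖ = hsq A := by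
  rw [trace_eq_re (posSemidef_conjTranspose_mul_self A).1, Complex.norm_real]
  exact Real.norm_of_nonneg (hsq_nonneg A)

/-- The Cauchy–Schwarz inequality for the Hilbert-Schmidt inner product. -/
lemma norm_trace_conjTranspose_mul_le (A B : Matrix n m ℂ) :
    ‖(Aᴴ * B).trace‖ ≤ √(hsq A) * √(hsq B) := by
  have key : ∀ A : Matrix n m ℂ, √(hsq A) =
      ‖(WithLp.toLp 2 fun p : m × n => A p.2 p.1 : EuclideanSpace ℂ (m × n))‖ := fun A => by
    rw [EuclideanSpace.norm_eq, hsq_eq_sum, Fintype.sum_prod_type]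
  have h := norm_inner_le_norm (𝕜 := ℂ)
    (WithLp.toLp 2 fun p : m × n => A p.2 p.1 : EuclideanSpace ℂ (m × n))
    (WithLp.toLp 2 fun p : m × n => B p.2 p.1 : EuclideanSpace ℂ (m × n))
  rw [← key, ← key] at h
  refine le_of_eq_of_le (congrArg _ ?_) h
  rw [PiLp.inner_apply, Fintype.sum_prod_type, Matrix.trace]
  refine Finset.sum_congr rfl fun j _ => ?_
  rw [diag_apply, mul_apply]
  refine Finset.sum_congr rfl fun i _ => ?_
  rw [conjTranspose_apply, RCLike.inner_apply, mul_comm]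
  rfl

/-- A positive density that dominates `M`, up to a factor barely larger than `tr M`. -/
lemma exists_dominating [Nonempty n] {M : Matrix n n ℂ} (hM : M.PosSemidef) {δ : ℝ}
    (hδ : 0 < δ) : ∃ η : Matrix n n ℂ, IsPosDensity η ∧
      (((M.trace.re + δ * Fintype.card n : ℝ) : ℂ) • η - M).PosSemidef := by
  have h := posDef_add_smul_one hM hδ
  refine ⟨_, isPosDensity_normalize h, ?_⟩
  have hc := trace_pos_of_posDef h
  rw [trace_add_smul_one] at hc ⊢
  rw [smul_smul, mul_inv_cancel₀ (by exact_mod_cast hc.ne'), one_smul, add_sub_cancel_left]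
  exact PosSemidef.one.smul (by exact_mod_cast hδ.le)

/-- A positive density `ω` with `M ≤ c ω ^ (1 + b)`, where `c` is barely larger than the `q`-norm
of `M` for `1 / q = 1 + b`. -/
lemma exists_dominating_mpow [Nonempty n] {M : Matrix n n ℂ} (hM : M.PosSemidef) {δ b : ℝ}
    (hδ : 0 < δ) (hb : 0 < b) : ∃ ω : Matrix n n ℂ, IsPosDensity ω ∧
      ((((mpow (M + (δ : ℂ) • (1 : Matrix n n ℂ)) (1 / (1 + b))).trace.re ^ (1 + b) : ℝ) : ℂ) • ω -
        mpow ω (-b / 2) * M * mpow ω (-b / 2)).PosSemidef := by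
  have h := posDef_add_smul_one hM hδ
  set P := M + (δ : ℂ) • (1 : Matrix n n ℂ) with hP
  have hPr := mpow_posDef h (1 / (1 + b))
  have hc := trace_pos_of_posDef hPr
  set c := (mpow P (1 / (1 + b))).trace.re with hcdef
  have hω := isPosDensity_normalize hPr
  rw [← hcdef] at hω
  set ω := ((c : ℂ)⁻¹) • mpow P (1 / (1 + b)) with hωdef
  refine ⟨ω, hω, ?_⟩
  have h1 : (((c ^ (1 + b) : ℝ) : ℂ)) • mpow ω (1 + b) = P := by
    rw [hωdef, ← Complex.ofReal_inv, mpow_smul hPr.posSemidef (inv_pos.mpr hc).le, smul_smul,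
      ← Complex.ofReal_mul, ← Real.mul_rpow hc.le (inv_pos.mpr hc).le, mul_inv_cancel₀ hc.ne',
      Real.one_rpow, Complex.ofReal_one, one_smul, mpow_mpow h.posSemidef,
      one_div_mul_cancel (by positivity), mpow_one h.1]
  have h2 : mpow ω (-b / 2) * (mpow ω (1 + b) * mpow ω (-b / 2)) = ω := by
    have e : -b / 2 + (1 + b + -b / 2) = 1 := by ring
    rw [mpow_mul_mpow hω.1, mpow_mul_mpow hω.1, e, mpow_one hω.1.1]
  have h3 : (((c ^ (1 + b) : ℝ) : ℂ)) • ω - mpow ω (-b / 2) * M * mpow ω (-b / 2) =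
      mpow ω (-b / 2) * ((δ : ℂ) • (1 : Matrix n n ℂ)) * mpow ω (-b / 2) := by
    have : (δ : ℂ) • (1 : Matrix n n ℂ) = (((c ^ (1 + b) : ℝ) : ℂ)) • mpow ω (1 + b) - M := by
      rw [h1, hP, add_sub_cancel_left]
    rw [this, Matrix.mul_sub, Matrix.sub_mul, Matrix.mul_smul, Matrix.smul_mul,
      Matrix.mul_assoc _ (mpow ω (1 + b)), h2]
  rw [h3]
  have h4 := (PosSemidef.one (n := n) (R := ℂ)).smul (a := (δ : ℂ)) (by exact_mod_cast hδ.le)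
  have h5 := h4.conjTranspose_mul_mul_same (mpow ω (-b / 2))
  rwa [(mpow_posDef hω.1 _).1] at h5

lemma trace_mpow_mul_mpow_le_one {ω η : Matrix n n ℂ} (hω : IsDensity ω) (hη : IsPosDensity η)
    {b : ℝ} (hb0 : 0 < b) (hb1 : b < 1) : (mpow ω b * mpow η (1 - b)).trace.re ≤ 1 := by
  have h := trace_mul_mpow_le (mpow_posSemidef hη.1.posSemidef (1 - b)) hω hb0 hb1
  have hq : 1 - b ≠ 0 := by linarith
  rw [mpow_mpow hη.1.posSemidef, mul_one_div_cancel hq, mpow_one hη.1.1, hη.2, Complex.one_re,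
    Real.one_rpow] at h
  rwa [trace_mul_comm]

lemma IsPosDensity.conj {ω U : Matrix n n ℂ} (hω : IsPosDensity ω) (hU : Uᴴ * U = 1) :
    IsPosDensity (U * ω * Uᴴ) := by
  have hU' : U * Uᴴ = 1 := mul_eq_one_comm.mp hU
  refine ⟨hω.1.mul_mul_conjTranspose_same
    (Matrix.vecMul_injective_of_isUnit (IsUnit.of_mul_eq_one _ hU')), ?_⟩
  rw [trace_mul_cycle, hU, Matrix.one_mul, hω.2]

lemma mpow_half_mul_half {A : Matrix n n ℂ} (hA : A.PosDef) (s : ℝ) :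
    mpow A (s / 2) * mpow A (s / 2) = mpow A s := by
  rw [mpow_mul_mpow hA, add_halves]

lemma conjTranspose_mpow {A : Matrix n n ℂ} (hA : A.PosDef) (s : ℝ) :
    (mpow A s)ᴴ = mpow A s :=
  (mpow_posDef hA s).1

lemma mpow_neg_mul_mpow {A : Matrix n n ℂ} (hA : A.PosDef) (s : ℝ) :
    mpow A s * mpow A (-s) = 1 := by
  rw [mpow_mul_mpow hA, add_neg_cancel, mpow_zero hA.1]

lemma hsq_mpow_half_mul {A : Matrix n n ℂ} (hA : A.PosDef) (s : ℝ) (Y : Matrix n m ℂ) :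
    hsq (mpow A (s / 2) * Y) = (Yᴴ * mpow A s * Y).trace.re := by
  rw [hsq, conjTranspose_mul, conjTranspose_mpow hA, ← mpow_half_mul_half hA s]
  simp only [Matrix.mul_assoc]

lemma hsq_mpow_half_mul_mul {A : Matrix n n ℂ} {T : Matrix m m ℂ} (hA : A.PosDef) (hT : T.PosDef)
    (s t : ℝ) (Y : Matrix n m ℂ) :
    hsq (mpow A (s / 2) * Y * mpow T (t / 2)) = (Yᴴ * mpow A s * Y * mpow T t).trace.re := by
  rw [Matrix.mul_assoc, hsq_mpow_half_mul hA, conjTranspose_mul, conjTranspose_mpow hT,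
    ← mpow_half_mul_half hT t]
  simp only [Matrix.mul_assoc]
  rw [trace_mul_comm]
  simp only [Matrix.mul_assoc]

/-- Negative powers of a density `η` dominating `G Gᴴ` are harmless in pairings with `G`: for
every density `κ`, the operator `κ ^ (b / 2) η ^ (-b / 2) G` has Hilbert-Schmidt norm at most
`√c`. -/
lemma norm_trace_mul_mpow_neg_le {η κ U : Matrix n n ℂ} {G Y : Matrix n m ℂ}
    (hη : IsPosDensity η) (hκ : IsPosDensity κ) (hU : Uᴴ * U = 1) {c b : ℝ} (hc : 0 ≤ c)
    (hb0 : 0 < b) (hb1 : b < 1) (hG : ((c : ℂ) • η - G * Gᴴ).PosSemidef) :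
    ‖(Gᴴ * (mpow η (-b / 2) * U * Y)).trace‖ ≤ √c * √(hsq (mpow κ (-b / 2) * Y)) := by
  have hU' : U * Uᴴ = 1 := mul_eq_one_comm.mp hU
  have e1 : Gᴴ * (mpow η (-b / 2) * U * Y) =
      (mpow κ (b / 2) * (Uᴴ * (mpow η (-b / 2) * G)))ᴴ * (mpow κ (-b / 2) * Y) := by
    simp only [conjTranspose_mul, conjTranspose_mpow hη.1, conjTranspose_mpow hκ.1,
      conjTranspose_conjTranspose, Matrix.mul_assoc]
    rw [← Matrix.mul_assoc (mpow κ _) (mpow κ _) Y, neg_div, mpow_neg_mul_mpow hκ.1,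
      Matrix.one_mul]
  rw [e1]
  refine (norm_trace_conjTranspose_mul_le _ _).trans
    (mul_le_mul_of_nonneg_right (Real.sqrt_le_sqrt ?_) (Real.sqrt_nonneg _))
  have e2 : (Uᴴ * (mpow η (-b / 2) * G))ᴴ * mpow κ b * (Uᴴ * (mpow η (-b / 2) * G)) =
      (Gᴴ * (mpow η (-b / 2) * (mpow (U * κ * Uᴴ) b * mpow η (-b / 2)))) * G := by
    rw [mpow_conj hκ.1.1 hU]
    simp only [conjTranspose_mul, conjTranspose_mpow hη.1, conjTranspose_conjTranspose,
      Matrix.mul_assoc]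
  set W := mpow η (-b / 2) * (mpow (U * κ * Uᴴ) b * mpow η (-b / 2)) with hW
  have hWp : W.PosSemidef := by
    have := (mpow_posSemidef (hκ.conj hU).1.posSemidef b).conjTranspose_mul_mul_same
      (mpow η (-b / 2))
    rwa [conjTranspose_mpow hη.1, Matrix.mul_assoc] at this
  rw [hsq_mpow_half_mul hκ.1, e2, trace_mul_comm, ← Matrix.mul_assoc, trace_mul_comm]
  refine (trace_mul_mono hWp hG).trans ?_
  rw [Matrix.mul_smul, trace_smul, smul_eq_mul, Complex.re_ofReal_mul]
  refine mul_le_of_le_one_right hc ?_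
  refine le_trans (le_of_eq ?_)
    (trace_mpow_mul_mpow_le_one (hκ.conj hU).isDensity hη hb0 hb1)
  rw [hW, trace_mul_comm]
  nth_rewrite 1 [← mpow_one hη.1.1]
  rw [← Matrix.mul_assoc, mpow_mul_mpow hη.1,
    trace_mul_comm, Matrix.mul_assoc, mpow_mul_mpow hη.1,
    show -b / 2 + (1 + -b / 2) = 1 - b by ring]

end ThreeLines

/-! ### Interpolation inequalities -/

section Interpolation

variable {n m e : Type*} [Fintype n] [DecidableEq n] [Fintype m] [DecidableEq m]
  [Fintype e] [DecidableEq e]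

/-- On a vertical line, a complex power is a fixed real power up to a unitary. -/
lemma mcpow_affine {A : Matrix n n ℂ} (hA : A.PosDef) (p q : ℝ) (z : ℂ) :
    mcpow A (p + q * z) =
      mcpow A ((q * z.im : ℝ) * Complex.I) * mpow A (p + q * z.re) := by
  rw [← mcpow_ofReal hA, mcpow_mul_mcpow hA.1]
  congr 1
  apply Complex.ext <;> simp

lemma mcpow_affine' {A : Matrix n n ℂ} (hA : A.PosDef) (p q : ℝ) (z : ℂ) :
    mcpow A (p + q * z) =
      mpow A (p + q * z.re) * mcpow A ((q * z.im : ℝ) * Complex.I) := by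
  rw [← mcpow_ofReal hA, mcpow_mul_mcpow hA.1]
  congr 1
  apply Complex.ext <;> simp

lemma mcpow_I_unitary {A : Matrix n n ℂ} (hA : A.PosDef) (t : ℝ) :
    (mcpow A (t * Complex.I))ᴴ * mcpow A (t * Complex.I) = 1 :=
  conjTranspose_mul_mcpow_self hA.1 (by simp)

lemma mcpow_I_unitary' {A : Matrix n n ℂ} (hA : A.PosDef) (t : ℝ) :
    mcpow A (t * Complex.I) * (mcpow A (t * Complex.I))ᴴ = 1 :=
  mcpow_mul_conjTranspose_self hA.1 (by simp)

/-- Rotating the vector is the same as rotating the operator the other way. -/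
lemma hsq_mpow_mul_unitary {κ U : Matrix n n ℂ} (hκ : κ.PosDef) (hU : Uᴴ * U = 1) (s : ℝ)
    (Y : Matrix n m ℂ) : hsq (mpow κ s * (U * Y)) = hsq (mpow (Uᴴ * κ * U) s * Y) := by
  have hU' : U * Uᴴ = 1 := mul_eq_one_comm.mp hU
  have h := mpow_conj hκ.1 (U := Uᴴ) (by rwa [conjTranspose_conjTranspose]) s
  rw [conjTranspose_conjTranspose] at h
  rw [h, ← hsq_mul_left (U := U) hU (Uᴴ * mpow κ s * U * Y)]
  congr 1
  simp only [← Matrix.mul_assoc]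
  rw [hU', Matrix.one_mul]

lemma hsq_mpow_conj_mul {κ U : Matrix n n ℂ} (hκ : κ.PosDef) (hU : Uᴴ * U = 1) (s : ℝ)
    (Y : Matrix n m ℂ) : hsq (mpow (U * κ * Uᴴ) s * (U * Y)) = hsq (mpow κ s * Y) := by
  have e : U * mpow κ s * Uᴴ * (U * Y) = U * (mpow κ s * ((Uᴴ * U) * Y)) := by
    simp only [Matrix.mul_assoc]
  rw [mpow_conj hκ.1 hU, e, hU, Matrix.one_mul, hsq_mul_left hU]

lemma IsPosDensity.conj' {ω U : Matrix n n ℂ} (hω : IsPosDensity ω) (hU : Uᴴ * U = 1) :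
    IsPosDensity (Uᴴ * ω * U) := by
  have := hω.conj (U := Uᴴ) (by rwa [conjTranspose_conjTranspose, mul_eq_one_comm])
  rwa [conjTranspose_conjTranspose] at this

lemma sqrt_interp {q₀ q₁ c K₀ K₁ θ : ℝ} (hq₀ : q₀ ≤ c) (hq₁ : q₁ ≤ c) (hK₀ : 0 ≤ K₀)
    (hK₁ : 0 ≤ K₁) (h0 : 0 < θ) (h1 : θ < 1) :
    (√q₀ * √K₀) ^ (1 - θ) * (√q₁ * √K₁) ^ θ ≤ √c * √(K₀ ^ (1 - θ) * K₁ ^ θ) := by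
  have hq' : 0 < 1 - θ := by linarith
  have hs : √c ^ (1 - θ) * √c ^ θ = √c := by
    rw [← Real.rpow_add' (Real.sqrt_nonneg _) (by simp), sub_add_cancel, Real.rpow_one]
  have hs' : ∀ K : ℝ, 0 ≤ K → ∀ r : ℝ, √(K ^ r) = √K ^ r := fun K hK r => by
    rw [Real.sqrt_eq_rpow, Real.sqrt_eq_rpow, ← Real.rpow_mul hK, ← Real.rpow_mul hK, mul_comm]
  calc (√q₀ * √K₀) ^ (1 - θ) * (√q₁ * √K₁) ^ θ
      ≤ (√c * √K₀) ^ (1 - θ) * (√c * √K₁) ^ θ := by gcongr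
    _ = (√c ^ (1 - θ) * √c ^ θ) * (√K₀ ^ (1 - θ) * √K₁ ^ θ) := by
        rw [Real.mul_rpow (Real.sqrt_nonneg _) (Real.sqrt_nonneg _),
          Real.mul_rpow (Real.sqrt_nonneg _) (Real.sqrt_nonneg _)]
        ring
    _ = _ := by
        rw [hs, Real.sqrt_mul (Real.rpow_nonneg hK₀ _), hs' _ hK₀, hs' _ hK₁]

/-- The form in which the interpolation bounds arrive: their left side is the Hilbert-Schmidt norm
squared `q` of `G`, and `√q` is cancelled in the limit. -/
lemma le_of_le_sqrt_mul_sqrt {c : ℝ → ℝ} {q K : ℝ} (hq : 0 ≤ q) (hK : 0 ≤ K)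
    (hc : Filter.Tendsto c (nhdsWithin 0 (Set.Ioi 0)) (nhds q))
    (h : ∀ δ, 0 < δ → q ≤ √(c δ) * √K) : q ≤ K := by
  have hlim := ((Real.continuous_sqrt.tendsto q).comp hc).mul_const (√K)
  have h1 : q ≤ √q * √K := ge_of_tendsto hlim
    (Filter.eventually_of_mem self_mem_nhdsWithin fun δ hδ => h δ hδ)
  rcases hq.eq_or_lt with h0 | h0
  · rwa [← h0]
  · have h2 : √q ≤ √K := by
      nth_rewrite 1 [← Real.mul_self_sqrt hq] at h1
      exact le_of_mul_le_mul_left h1 (Real.sqrt_pos.mpr h0)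
    exact (Real.sqrt_le_sqrt_iff hK).mp h2

lemma tendsto_add_mul (q N : ℝ) :
    Filter.Tendsto (fun δ : ℝ => q + δ * N) (nhdsWithin 0 (Set.Ioi 0)) (nhds q) := by
  have : ContinuousAt (fun δ : ℝ => q + δ * N) 0 := by fun_prop
  have h := this.tendsto
  simp only [zero_mul, add_zero] at h
  exact h.mono_left nhdsWithin_le_nhds

lemma isStripBounded_trace {A S : Matrix n n ℂ} {T : Matrix m m ℂ} (hA : A.IsHermitian)
    (hS : S.IsHermitian) (hT : T.IsHermitian) (G X : Matrix n m ℂ) (p₁ q₁ p₂ q₂ p₃ q₃ : ℝ) :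
    IsStripBounded fun z => (Gᴴ * (mcpow A (p₁ + q₁ * z) * mcpow S (p₂ + q₂ * z) * X *
      mcpow T (p₃ + q₃ * z))).trace :=
  ((IsStripBoundedMatrix.const Gᴴ).mul
    ((((isStripBoundedMatrix_mcpow hA p₁ q₁).mul (isStripBoundedMatrix_mcpow hS p₂ q₂)).mul
      (.const X)).mul (isStripBoundedMatrix_mcpow hT p₃ q₃))).trace

/-- Interpolation on the family `η ^ ((g (1 - z) - b z) / 2) S ^ (-g (1 - z) / 2) X T ^ (b z / 2)`,
paired with its value `G` at `z = a / b`, where `η` is a density dominating `G Gᴴ`. On `Re z = 0`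
only `K` is needed, at `η` rotated by imaginary powers of `S`; on `Re z = 1` the negative power of
`η` is absorbed by `G`. -/
theorem interpolation_sup_sup [Nonempty n] {S ω : Matrix n n ℂ} {T : Matrix m m ℂ}
    {X : Matrix n m ℂ} (hS : S.PosDef) (hT : T.PosDef) (hω : IsPosDensity ω) {a b g K : ℝ}
    (ha : 0 < a) (hb0 : 0 < b) (hb1 : b < 1) (hg0 : 0 < g) (h : 1 / a = 1 / b + 1 / g)
    (hK : ∀ η : Matrix n n ℂ, IsPosDensity η → hsq (mpow η (g / 2) * (mpow S (-g / 2) * X)) ≤ K) :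
    hsq (mpow S (-a / 2) * X * mpow T (a / 2)) ≤
      K ^ (a / g) * hsq (mpow ω (-b / 2) * (X * mpow T (b / 2))) ^ (a / b) := by
  have hθ : a / g = 1 - a / b := by
    field_simp at h ⊢
    linarith
  have hθ0 : 0 < a / b := by positivity
  have hθ1 : a / b < 1 := by
    have : 0 < a / g := by positivity
    linarith
  have hgθ : g * (1 - a / b) = a := by rw [← hθ]; field_simp
  set θ := a / b with hθdef
  have hbθ : b * θ = a := by rw [hθdef]; field_simp
  set G := mpow S (-a / 2) * X * mpow T (a / 2) with hG
  have hK0 : 0 ≤ K := (hsq_nonneg _).trans (hK ω hω)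
  rw [hθ]
  refine le_of_le_sqrt_mul_sqrt (hsq_nonneg G)
    (mul_nonneg (Real.rpow_nonneg hK0 _) (Real.rpow_nonneg (hsq_nonneg _) _))
    (tendsto_add_mul (hsq G) (Fintype.card n)) fun δ hδ => ?_
  obtain ⟨η, hη, hGη⟩ := exists_dominating (posSemidef_self_mul_conjTranspose G) hδ
  have htr : (G * Gᴴ).trace.re = hsq G := by rw [trace_mul_comm, hsq]
  rw [htr] at hGη
  have hc : 0 ≤ hsq G + δ * Fintype.card n := add_nonneg (hsq_nonneg _) (by positivity)
  have hf := isStripBounded_trace hη.1.1 hS.1 hT.1 G X (g / 2) (-(g + b) / 2) (-g / 2) (g / 2)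
    0 (b / 2)
  have key := hf.norm_le hθ0.le hθ1.le (M₀ := √(hsq G) * √K)
    (M₁ := √(hsq G + δ * Fintype.card n) * √(hsq (mpow ω (-b / 2) * (X * mpow T (b / 2)))))
    (fun z hz => ?_) (fun z hz => ?_)
  · refine le_trans (le_of_eq ?_) (key.trans (sqrt_interp (le_add_of_nonneg_right
      (by positivity)) le_rfl hK0 (hsq_nonneg _) hθ0 hθ1))
    have e1 : ((g / 2 : ℝ) + (-(g + b) / 2 : ℝ) * (θ : ℂ)) = ((0 : ℝ) : ℂ) := by
      have : g / 2 + -(g + b) / 2 * θ = 0 := by linarith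
      exact_mod_cast this
    have e2 : ((-g / 2 : ℝ) + (g / 2 : ℝ) * (θ : ℂ)) = ((-a / 2 : ℝ) : ℂ) := by
      have : -g / 2 + g / 2 * θ = -a / 2 := by linarith
      exact_mod_cast this
    have e3 : ((0 : ℝ) + (b / 2 : ℝ) * (θ : ℂ)) = ((a / 2 : ℝ) : ℂ) := by
      have : 0 + b / 2 * θ = a / 2 := by linarith
      exact_mod_cast this
    rw [e1, e2, e3, mcpow_ofReal hη.1, mpow_zero hη.1.1, Matrix.one_mul, mcpow_ofReal hS,
      mcpow_ofReal hT, ← hG, norm_trace_conjTranspose_mul_self]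
  · refine (norm_trace_conjTranspose_mul_le _ _).trans
      (mul_le_mul_of_nonneg_left (Real.sqrt_le_sqrt ?_) (Real.sqrt_nonneg _))
    rw [mcpow_affine hη.1, mcpow_affine hS, mcpow_affine' hT, hz]
    simp only [mul_zero, add_zero]
    rw [mpow_zero hT.1, Matrix.one_mul, hsq_mul_right (mcpow_I_unitary' hT _)]
    simp only [Matrix.mul_assoc]
    rw [hsq_mul_left (mcpow_I_unitary hη.1 _), hsq_mpow_mul_unitary hη.1 (mcpow_I_unitary hS _)]
    exact hK _ (hη.conj' (mcpow_I_unitary hS _))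
  · rw [mcpow_affine' hη.1, mcpow_affine hS, mcpow_affine' hT, hz]
    rw [show -g / 2 + g / 2 * 1 = 0 by ring, mpow_zero hS.1, Matrix.mul_one,
      show g / 2 + -(g + b) / 2 * 1 = -b / 2 by ring, show 0 + b / 2 * 1 = b / 2 by ring]
    simp only [Matrix.mul_assoc]
    have hV := mcpow_I_unitary hS (g / 2 * z.im)
    set V := mcpow S ((g / 2 * z.im : ℝ) * Complex.I)
    have hκ := hω.conj hV
    have hκs := hsq_mpow_conj_mul hω.1 hV (-b / 2) (m := m)
    set κ := V * ω * Vᴴ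
    have := norm_trace_mul_mpow_neg_le (Y := V * (X * (mpow T (b / 2) *
      mcpow T ((b / 2 * z.im : ℝ) * Complex.I)))) hη hκ (mcpow_I_unitary hη.1
      (-(g + b) / 2 * z.im)) hc hb0 hb1 hGη
    simp only [Matrix.mul_assoc] at this
    refine this.trans (le_of_eq ?_)
    rw [hκs]
    simp only [← Matrix.mul_assoc]
    rw [hsq_mul_right (mcpow_I_unitary' hT _)]

/-- Interpolation on the family
`ω ^ (-g (1 - z) / 2) S ^ ((g (1 - z) - a z) / 2) X T ^ (a z / 2)`, paired with its value `G` at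
`z = b / a`. The density `ω` is nearly optimal in the bound on `v`, so that it nearly dominates
`G Gᴴ` up to the factor `hsq G`. -/
theorem interpolation_inf_inf [Nonempty n] {S κ : Matrix n n ℂ} {T : Matrix m m ℂ}
    {X : Matrix n m ℂ} (hS : S.PosDef) (hT : T.PosDef) (hκ : IsPosDensity κ) {a b g v : ℝ}
    (ha : 0 < a) (hb : 0 < b) (hg0 : 0 < g) (hg1 : g < 1) (h : 1 / b = 1 / a + 1 / g)
    (hv : ∀ ω : Matrix n n ℂ, IsPosDensity ω → v ≤ hsq (mpow ω (-b / 2) * (X * mpow T (b / 2)))) :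
    v ≤ hsq (mpow κ (-g / 2) * (mpow S (g / 2) * X)) ^ (b / g) *
      hsq (mpow S (-a / 2) * X * mpow T (a / 2)) ^ (b / a) := by
  have hθ : b / g = 1 - b / a := by
    field_simp at h ⊢
    linarith
  have hθ0 : 0 < b / a := by positivity
  have hθ1 : b / a < 1 := by
    have : 0 < b / g := by positivity
    linarith
  have hgθ : g * (1 - b / a) = b := by rw [← hθ]; field_simp
  set θ := b / a with hθdef
  have haθ : a * θ = b := by rw [hθdef]; field_simp
  set Z := X * mpow T (b / 2) with hZ
  have hM := posSemidef_self_mul_conjTranspose Z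
  have hMtr : ∀ ω, IsPosDensity ω →
      (Z * Zᴴ * mpow ω (-b)).trace.re = hsq (mpow ω (-b / 2) * Z) := fun ω hω => by
    rw [hsq_mpow_half_mul hω.1, trace_mul_comm, ← Matrix.mul_assoc, trace_mul_comm,
      ← Matrix.mul_assoc]
  have hvC := le_rpow_trace_mpow_of_forall hM hb (K := v) fun ω hω => by
    rw [hMtr ω hω]
    exact hv ω hω
  refine hvC.trans ?_
  rw [hθ]
  refine le_of_le_sqrt_mul_sqrt (Real.rpow_nonneg (trace_mpow_nonneg hM _) _)
    (mul_nonneg (Real.rpow_nonneg (hsq_nonneg _) _) (Real.rpow_nonneg (hsq_nonneg _) _))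
    (tendsto_trace_mpow_add_smul_one hM (by linarith) (by positivity)) fun δ hδ => ?_
  obtain ⟨ω, hω, hGω⟩ := exists_dominating_mpow hM hδ hb
  have hCq := le_trace_mul_mpow_neg hM hω hb
  rw [hMtr ω hω] at hCq
  refine hCq.trans ?_
  have hc : 0 ≤ (mpow (Z * Zᴴ + (δ : ℂ) • (1 : Matrix n n ℂ)) (1 / (1 + b))).trace.re ^ (1 + b) :=
    Real.rpow_nonneg (trace_mpow_nonneg (posDef_add_smul_one hM hδ).posSemidef _) _
  set c := (mpow (Z * Zᴴ + (δ : ℂ) • (1 : Matrix n n ℂ)) (1 / (1 + b))).trace.re ^ (1 + b)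
  set G := mpow ω (-b / 2) * Z with hG
  have hGG : mpow ω (-b / 2) * (Z * Zᴴ) * mpow ω (-b / 2) = G * Gᴴ := by
    rw [hG, conjTranspose_mul (mpow ω _) Z, conjTranspose_mpow hω.1]
    simp only [Matrix.mul_assoc]
  rw [hGG] at hGω
  have hqc : hsq G ≤ c := by
    have := (Complex.le_def.mp hGω.trace_nonneg).1
    rw [trace_sub, trace_smul, hω.2, trace_mul_comm] at this
    simpa [hsq] using this
  have hf := isStripBounded_trace hω.1.1 hS.1 hT.1 G X (-g / 2) (g / 2) (g / 2) (-(g + a) / 2)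
    0 (a / 2)
  have key := hf.norm_le hθ0.le hθ1.le
    (M₀ := √c * √(hsq (mpow κ (-g / 2) * (mpow S (g / 2) * X))))
    (M₁ := √(hsq G) * √(hsq (mpow S (-a / 2) * X * mpow T (a / 2))))
    (fun z hz => ?_) (fun z hz => ?_)
  · refine le_trans (le_of_eq ?_) (key.trans (sqrt_interp le_rfl hqc (hsq_nonneg _)
      (hsq_nonneg _) hθ0 hθ1))
    have e1 : ((-g / 2 : ℝ) + (g / 2 : ℝ) * (θ : ℂ)) = ((-b / 2 : ℝ) : ℂ) := by
      have : -g / 2 + g / 2 * θ = -b / 2 := by linarith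
      exact_mod_cast this
    have e2 : ((g / 2 : ℝ) + (-(g + a) / 2 : ℝ) * (θ : ℂ)) = ((0 : ℝ) : ℂ) := by
      have : g / 2 + -(g + a) / 2 * θ = 0 := by linarith
      exact_mod_cast this
    have e3 : ((0 : ℝ) + (a / 2 : ℝ) * (θ : ℂ)) = ((b / 2 : ℝ) : ℂ) := by
      have : 0 + a / 2 * θ = b / 2 := by linarith
      exact_mod_cast this
    rw [e1, e2, e3, mcpow_ofReal hω.1, mcpow_ofReal hS, mpow_zero hS.1, Matrix.mul_one,
      mcpow_ofReal hT, Matrix.mul_assoc (mpow ω _), ← hZ, ← hG,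
      norm_trace_conjTranspose_mul_self]
  · rw [mcpow_affine' hω.1, mcpow_affine hS, mcpow_affine' hT, hz]
    simp only [mul_zero, add_zero]
    rw [mpow_zero hT.1, Matrix.one_mul]
    simp only [Matrix.mul_assoc]
    have hV := mcpow_I_unitary hS (-(g + a) / 2 * z.im)
    set V := mcpow S ((-(g + a) / 2 * z.im : ℝ) * Complex.I)
    have hκ' := hκ.conj hV
    have hκs := hsq_mpow_conj_mul hκ.1 hV (-g / 2) (m := m)
    set κ' := V * κ * Vᴴ
    have := norm_trace_mul_mpow_neg_le (Y := V * (mpow S (g / 2) * (X *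
      mcpow T ((a / 2 * z.im : ℝ) * Complex.I)))) hω hκ' (mcpow_I_unitary hω.1
      (g / 2 * z.im)) hc hg0 hg1 hGω
    simp only [Matrix.mul_assoc] at this
    refine this.trans (le_of_eq ?_)
    rw [hκs]
    simp only [← Matrix.mul_assoc]
    rw [hsq_mul_right (mcpow_I_unitary' hT _)]
  · refine (norm_trace_conjTranspose_mul_le _ _).trans
      (mul_le_mul_of_nonneg_left (Real.sqrt_le_sqrt (le_of_eq ?_)) (Real.sqrt_nonneg _))
    rw [mcpow_affine hω.1, mcpow_affine hS, mcpow_affine' hT, hz,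
      show -g / 2 + g / 2 * 1 = 0 by ring, mpow_zero hω.1.1, Matrix.mul_one,
      show g / 2 + -(g + a) / 2 * 1 = -a / 2 by ring, show 0 + a / 2 * 1 = a / 2 by ring]
    simp only [Matrix.mul_assoc]
    rw [hsq_mul_left (mcpow_I_unitary hω.1 _), hsq_mul_left (mcpow_I_unitary hS _)]
    simp only [← Matrix.mul_assoc]
    rw [hsq_mul_right (mcpow_I_unitary' hT _)]

/-- Interpolation on the family
`Ω ^ (b (1 - z) / 2) S ^ (-a z / 2) X η ^ ((a z - b (1 - z)) / 2)`, paired with its value `G` at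
`z = g / a`, where `η` is a density dominating `Gᴴ G`. -/
theorem interpolation_sup_inf [Nonempty m] {S Ω : Matrix n n ℂ} {τ : Matrix m m ℂ}
    {X : Matrix n m ℂ} (hS : S.PosDef) (hΩ : Ω.PosDef) (hτ : IsPosDensity τ) {a b g Ka Kb : ℝ}
    (ha : 0 < a) (hb0 : 0 < b) (hb1 : b < 1) (hg : 0 < g) (h : 1 / g = 1 / a + 1 / b)
    (hKa : ∀ η : Matrix m m ℂ, IsPosDensity η → hsq (mpow S (-a / 2) * (X * mpow η (a / 2))) ≤ Ka)
    (hKb : ∀ t : ℝ, hsq (mpow Ω (b / 2) * (mcpow S (t * Complex.I) * (X * mpow τ (-b / 2)))) ≤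
      Kb) :
    hsq (mpow Ω (g / 2) * (mpow S (-g / 2) * X)) ≤ Kb ^ (g / b) * Ka ^ (g / a) := by
  have hθ : g / b = 1 - g / a := by
    field_simp at h ⊢
    linarith
  have hθ0 : 0 < g / a := by positivity
  have hθ1 : g / a < 1 := by
    have : 0 < g / b := by positivity
    linarith
  have hbθ : b * (1 - g / a) = g := by rw [← hθ]; field_simp
  set θ := g / a with hθdef
  have haθ : a * θ = g := by rw [hθdef]; field_simp
  set G := mpow Ω (g / 2) * (mpow S (-g / 2) * X) with hG
  have hKa0 : 0 ≤ Ka := (hsq_nonneg _).trans (hKa τ hτ)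
  have hKb0 : 0 ≤ Kb := (hsq_nonneg _).trans (hKb 0)
  rw [hθ]
  refine le_of_le_sqrt_mul_sqrt (hsq_nonneg G)
    (mul_nonneg (Real.rpow_nonneg hKb0 _) (Real.rpow_nonneg hKa0 _))
    (tendsto_add_mul (hsq G) (Fintype.card m)) fun δ hδ => ?_
  obtain ⟨η, hη, hGη⟩ := exists_dominating (posSemidef_conjTranspose_mul_self G) hδ
  rw [← hsq] at hGη
  have hc : 0 ≤ hsq G + δ * Fintype.card m := add_nonneg (hsq_nonneg _) (by positivity)
  have hf := isStripBounded_trace hΩ.1 hS.1 hη.1.1 G X (b / 2) (-b / 2) 0 (-a / 2)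
    (-b / 2) ((a + b) / 2)
  have key := hf.norm_le hθ0.le hθ1.le (M₀ := √(hsq G + δ * Fintype.card m) * √Kb)
    (M₁ := √(hsq G) * √Ka) (fun z hz => ?_) (fun z hz => ?_)
  · refine le_trans (le_of_eq ?_) (key.trans (sqrt_interp le_rfl (le_add_of_nonneg_right
      (by positivity)) hKb0 hKa0 hθ0 hθ1))
    have e1 : ((b / 2 : ℝ) + (-b / 2 : ℝ) * (θ : ℂ)) = ((g / 2 : ℝ) : ℂ) := by
      have : b / 2 + -b / 2 * θ = g / 2 := by linarith
      exact_mod_cast this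
    have e2 : ((0 : ℝ) + (-a / 2 : ℝ) * (θ : ℂ)) = ((-g / 2 : ℝ) : ℂ) := by
      have : 0 + -a / 2 * θ = -g / 2 := by linarith
      exact_mod_cast this
    have e3 : ((-b / 2 : ℝ) + ((a + b) / 2 : ℝ) * (θ : ℂ)) = ((0 : ℝ) : ℂ) := by
      have : -b / 2 + (a + b) / 2 * θ = 0 := by linarith
      exact_mod_cast this
    rw [e1, e2, e3, mcpow_ofReal hΩ, mcpow_ofReal hS, mcpow_ofReal hη.1, mpow_zero hη.1.1,
      Matrix.mul_one, Matrix.mul_assoc (mpow Ω _), ← hG,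
      norm_trace_conjTranspose_mul_self]
  · rw [mcpow_affine hΩ, mcpow_affine hS, mcpow_affine hη.1, hz]
    simp only [mul_zero, add_zero]
    rw [mpow_zero hS.1, Matrix.mul_one]
    set W := mcpow Ω ((-b / 2 * z.im : ℝ) * Complex.I) * mpow Ω (b / 2) *
      mcpow S ((-a / 2 * z.im : ℝ) * Complex.I) * X with hW
    set V := mcpow η (((a + b) / 2 * z.im : ℝ) * Complex.I) with hV
    have hVu : Vᴴᴴ * Vᴴ = 1 := by
      rw [conjTranspose_conjTranspose]
      exact mcpow_I_unitary' hη.1 _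
    -- the negative power of `η` stands on the right, so the adjoint is estimated instead
    have e : (Gᴴ * (W * (V * mpow η (-b / 2)))).trace =
        star ((Gᴴᴴ * (mpow η (-b / 2) * Vᴴ * Wᴴ)).trace) := by
      rw [← trace_conjTranspose]
      simp only [conjTranspose_mul, conjTranspose_conjTranspose, conjTranspose_mpow hη.1]
      rw [← Matrix.mul_assoc, Matrix.mul_assoc, trace_mul_comm]
    rw [e, norm_star]
    refine (norm_trace_mul_mpow_neg_le hη hτ hVu hc hb0 hb1
      (by rwa [conjTranspose_conjTranspose])).trans ?_
    refine mul_le_mul_of_nonneg_left (Real.sqrt_le_sqrt ?_) (Real.sqrt_nonneg _)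
    rw [← hsq_conjTranspose, conjTranspose_mul, conjTranspose_conjTranspose,
      conjTranspose_mpow hτ.1, hW]
    simp only [Matrix.mul_assoc]
    rw [hsq_mul_left (mcpow_I_unitary hΩ _)]
    exact hKb _
  · refine (norm_trace_conjTranspose_mul_le _ _).trans
      (mul_le_mul_of_nonneg_left (Real.sqrt_le_sqrt ?_) (Real.sqrt_nonneg _))
    rw [mcpow_affine hΩ, mcpow_affine hS, mcpow_affine' hη.1, hz,
      show b / 2 + -b / 2 * 1 = 0 by ring, mpow_zero hΩ.1, Matrix.mul_one,
      show 0 + -a / 2 * 1 = -a / 2 by ring, show -b / 2 + (a + b) / 2 * 1 = a / 2 by ring]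
    simp only [Matrix.mul_assoc]
    rw [hsq_mul_left (mcpow_I_unitary hΩ _), hsq_mul_left (mcpow_I_unitary hS _)]
    simp only [← Matrix.mul_assoc]
    rw [hsq_mul_right (mcpow_I_unitary' hη.1 _), Matrix.mul_assoc]
    exact hKa η hη

end Interpolation

/-! ### The minimax value of a pairing -/

section Minimax

/-- Sion's minimax theorem for a nonnegative bilinear form, one of the two convex sets being
compact. -/
lemma exists_minimax {E F : Type*} [TopologicalSpace E] [AddCommGroup E] [Module ℝ E]
    [IsTopologicalAddGroup E] [ContinuousSMul ℝ E] [TopologicalSpace F] [AddCommGroup F]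
    [Module ℝ F] [IsTopologicalAddGroup F] [ContinuousSMul ℝ F] {A : Set E} {B : Set F}
    (hA : A.Nonempty) (hAk : IsCompact A) (hAc : Convex ℝ A) (hB : B.Nonempty)
    (hBc : Convex ℝ B) {f : E → F → ℝ} (h1 : ∀ y, IsLinearMap ℝ fun x => f x y)
    (h2 : ∀ x, IsLinearMap ℝ (f x)) (c1 : ∀ y, Continuous fun x => f x y)
    (c2 : ∀ x, Continuous (f x)) (h0 : ∀ x ∈ A, ∀ y ∈ B, 0 ≤ f x y) :
    ∃ v, (∀ v', v < v' → ∃ y ∈ B, ∀ x ∈ A, f x y ≤ v') ∧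
      (∀ v', v' < v → ∃ x ∈ A, ∀ y ∈ B, v' ≤ f x y) := by
  obtain ⟨x₀, hx₀⟩ := hA
  obtain ⟨y₀, hy₀⟩ := hB
  set S : E → Set ℝ := fun x => {r | ∃ y ∈ B, -f x y = r} with hS
  set R : F → Set ℝ := fun y => {r | ∃ x ∈ A, -f x y = r} with hR
  have hSb : ∀ x ∈ A, BddAbove (S x) := fun x hx => ⟨0, by
    rintro _ ⟨y, hy, rfl⟩
    exact neg_nonpos.mpr (h0 x hx y hy)⟩
  have hRb : ∀ y ∈ B, BddBelow (R y) := fun y hy => by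
    obtain ⟨C, hC⟩ := (hAk.image (c1 y)).bddAbove
    refine ⟨-C, ?_⟩
    rintro _ ⟨x, hx, rfl⟩
    exact neg_le_neg (hC ⟨x, hx, rfl⟩)
  have hSl : ∀ x ∈ A, IsLUB (S x) (sSup (S x)) := fun x hx =>
    isLUB_csSup ⟨_, y₀, hy₀, rfl⟩ (hSb x hx)
  have hRg : ∀ y ∈ B, IsGLB (R y) (sInf (R y)) := fun y hy =>
    isGLB_csInf ⟨_, x₀, hx₀, rfl⟩ (hRb y hy)
  have hSg : IsGLB {r | ∃ x ∈ A, sSup (S x) = r} (sInf {r | ∃ x ∈ A, sSup (S x) = r}) := by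
    refine isGLB_csInf ⟨_, x₀, hx₀, rfl⟩ ⟨sInf (R y₀), ?_⟩
    rintro _ ⟨x, hx, rfl⟩
    exact ((hRg y₀ hy₀).1 ⟨x, hx, rfl⟩).trans ((hSl x hx).1 ⟨y₀, hy₀, rfl⟩)
  have hRl : IsLUB {r | ∃ y ∈ B, sInf (R y) = r} (sSup {r | ∃ y ∈ B, sInf (R y) = r}) := by
    refine isLUB_csSup ⟨_, y₀, hy₀, rfl⟩ ⟨sSup (S x₀), ?_⟩
    rintro _ ⟨y, hy, rfl⟩
    exact ((hRg y hy).1 ⟨x₀, hx₀, rfl⟩).trans ((hSl x₀ hx₀).1 ⟨y, hy, rfl⟩)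
  have n1 : ∀ y, IsLinearMap ℝ fun x => -f x y := fun y =>
    ⟨fun a b => by rw [(h1 y).map_add]; ring, fun c a => by
      rw [(h1 y).map_smul, smul_eq_mul, smul_eq_mul]; ring⟩
  have n2 : ∀ x, IsLinearMap ℝ fun y => -f x y := fun x =>
    ⟨fun a b => by rw [(h2 x).map_add]; ring, fun c a => by
      rw [(h2 x).map_smul, smul_eq_mul, smul_eq_mul]; ring⟩
  have key := Sion.minimax (f := fun x y => -f x y) ⟨x₀, hx₀⟩ hAk
    (fun y _ => ((c1 y).neg.lowerSemicontinuous).lowerSemicontinuousOn _)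
    (fun y _ => (((n1 y).mk' _).convexOn hAc).quasiconvexOn) hBc
    (fun x _ => ((c2 x).neg.upperSemicontinuous).upperSemicontinuousOn _)
    (fun x _ => (((n2 x).mk' _).concaveOn hBc).quasiconcaveOn) hAc _ hSl _ hSg _ hRg _ hRl
  refine ⟨-sInf {r | ∃ x ∈ A, sSup (S x) = r}, fun v' hv' => ?_, fun v' hv' => ?_⟩
  · rw [key] at hv'
    obtain ⟨_, ⟨y, hy, rfl⟩, hlt⟩ := (lt_isLUB_iff hRl).mp (neg_lt.mp hv')
    refine ⟨y, hy, fun x hx => ?_⟩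
    have := (hRg y hy).1 ⟨x, hx, rfl⟩
    linarith
  · obtain ⟨_, ⟨x, hx, rfl⟩, hlt⟩ := (isGLB_lt_iff hSg).mp (lt_neg.mp hv')
    refine ⟨x, hx, fun y hy => ?_⟩
    have := (hSl x hx).1 ⟨y, hy, rfl⟩
    linarith

variable {n d e : Type*} [Fintype n] [DecidableEq n] [Fintype d] [DecidableEq d]
  [Fintype e] [DecidableEq e]

/-- For a pure state of three systems `e`, `n`, `d` with amplitudes `X i j k`, the expectation of
`1 ⊗ W ⊗ Tᵀ`. -/
def pairing (X : e → Matrix n d ℂ) (W : Matrix n n ℂ) (T : Matrix d d ℂ) : ℝ :=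
  ∑ i, ((X i)ᴴ * W * X i * T).trace.re

lemma pairing_conjTranspose (X : e → Matrix n d ℂ) (W : Matrix n n ℂ) (T : Matrix d d ℂ) :
    pairing (fun i => (X i)ᴴ) T W = pairing X W T := by
  refine Finset.sum_congr rfl fun i _ => ?_
  rw [conjTranspose_conjTranspose, Matrix.mul_assoc (X i * T), trace_mul_comm]
  simp only [Matrix.mul_assoc]

lemma pairing_isLinear_left (X : e → Matrix n d ℂ) (T : Matrix d d ℂ) :
    IsLinearMap ℝ fun W => pairing X W T := by
  constructor
  · intro W W'
    simp only [pairing, Matrix.mul_add, Matrix.add_mul, trace_add, Complex.add_re,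
      Finset.sum_add_distrib]
  · intro c W
    simp only [pairing, Matrix.mul_smul, Matrix.smul_mul, trace_smul, Complex.smul_re,
      Finset.smul_sum]

lemma pairing_isLinear_right (X : e → Matrix n d ℂ) (W : Matrix n n ℂ) :
    IsLinearMap ℝ (pairing X W) := by
  constructor
  · intro T T'
    simp only [pairing, Matrix.mul_add, trace_add, Complex.add_re, Finset.sum_add_distrib]
  · intro c T
    simp only [pairing, Matrix.mul_smul, trace_smul, Complex.smul_re, Finset.smul_sum]

lemma continuous_pairing_left (X : e → Matrix n d ℂ) (T : Matrix d d ℂ) :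
    Continuous fun W => pairing X W T := by
  unfold pairing
  fun_prop

lemma continuous_pairing_right (X : e → Matrix n d ℂ) (W : Matrix n n ℂ) :
    Continuous (pairing X W) := by
  unfold pairing
  fun_prop

lemma pairing_nonneg (X : e → Matrix n d ℂ) {W : Matrix n n ℂ} {T : Matrix d d ℂ}
    (hW : W.PosSemidef) (hT : T.PosSemidef) : 0 ≤ pairing X W T :=
  Finset.sum_nonneg fun _ _ => trace_mul_nonneg (hW.conjTranspose_mul_mul_same _) hT

lemma pairing_mono_left (X : e → Matrix n d ℂ) {W W' : Matrix n n ℂ} {T : Matrix d d ℂ}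
    (h : (W' - W).PosSemidef) (hT : T.PosSemidef) : pairing X W T ≤ pairing X W' T := by
  have := pairing_nonneg X h hT
  rw [(pairing_isLinear_left X T).map_sub] at this
  linarith

lemma pairing_mono_right (X : e → Matrix n d ℂ) {W : Matrix n n ℂ} {T T' : Matrix d d ℂ}
    (hW : W.PosSemidef) (h : (T' - T).PosSemidef) : pairing X W T ≤ pairing X W T' := by
  have := pairing_nonneg X hW h
  rw [(pairing_isLinear_right X W).map_sub] at this
  linarith

lemma pairing_smul_right (X : e → Matrix n d ℂ) (W : Matrix n n ℂ) (c : ℝ) (T : Matrix d d ℂ) :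
    pairing X W ((c : ℂ) • T) = c * pairing X W T := by
  have := (pairing_isLinear_right X W).map_smul c T
  rwa [smul_eq_mul] at this

lemma isClosed_posSemidef : IsClosed {T : Matrix d d ℂ | T.PosSemidef} := by
  have : {T : Matrix d d ℂ | T.PosSemidef} =
      {T | Tᴴ = T} ∩ ⋂ x : d → ℂ, {T | 0 ≤ star x ⬝ᵥ (T *ᵥ x)} := by
    ext T
    simp only [Set.mem_ofPred_eq, Set.mem_inter_iff, Set.mem_iInter]
    exact posSemidef_iff_dotProduct_mulVec
  rw [this]
  refine (isClosed_eq (by fun_prop) continuous_id).inter (isClosed_iInter fun x => ?_)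
  exact isClosed_le continuous_const (by fun_prop)

lemma norm_apply_le_trace {T : Matrix d d ℂ} (hT : T.PosSemidef) (i j : d) :
    ‖T i j‖ ≤ T.trace.re := by
  have h0 : 0 ≤ T.trace.re := (Complex.le_def.mp hT.trace_nonneg).1
  have h1 : ‖T i j‖ ^ 2 ≤ hsq T := by
    rw [hsq_eq_sum]
    refine le_trans ?_ (Finset.single_le_sum (f := fun j => ∑ i, ‖T i j‖ ^ 2)
      (fun _ _ => by positivity) (Finset.mem_univ j))
    exact Finset.single_le_sum (f := fun i => ‖T i j‖ ^ 2) (fun _ _ => by positivity)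
      (Finset.mem_univ i)
  have htr : T.trace.re = ∑ i, hT.1.eigenvalues i := by
    have := congrArg Complex.re (trace_mpow hT.1 1)
    rw [mpow_one hT.1, Complex.ofReal_re] at this
    simpa using this
  have h2 : hsq T = ∑ i, hT.1.eigenvalues i ^ 2 := by
    rw [hsq, hT.1]
    nth_rewrite 1 2 [← mpow_one hT.1]
    rw [mpow_mul_mpow_of_posSemidef hT (by norm_num), trace_mpow hT.1, Complex.ofReal_re]
    norm_num
  have h3 : hsq T ≤ T.trace.re ^ 2 := by
    rw [h2, htr, sq (∑ i, _), Finset.sum_mul]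
    refine Finset.sum_le_sum fun i _ => ?_
    rw [sq]
    exact mul_le_mul_of_nonneg_left (Finset.single_le_sum
      (fun j _ => hT.eigenvalues_nonneg j) (Finset.mem_univ i)) (hT.eigenvalues_nonneg i)
  exact (sq_le_sq₀ (norm_nonneg _) h0).mp (h1.trans h3)

/-- The powers `τ ^ s` of densities, and the operators below them: a Schatten ball of positive
operators, described by duality. -/
def powerBall (d : Type*) [Fintype d] [DecidableEq d] (s : ℝ) : Set (Matrix d d ℂ) :=
  {T | T.PosSemidef ∧ ∀ κ, IsPosDensity κ → (T * mpow κ (1 - s)).trace.re ≤ 1}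

/-- The powers `ω ^ (-s)` of positive densities, and the operators above them, described by
duality. -/
def inversePowerSet (n : Type*) [Fintype n] [DecidableEq n] (s : ℝ) : Set (Matrix n n ℂ) :=
  {W | W.PosDef ∧ ∀ κ, IsPosDensity κ → 1 ≤ (W * mpow κ (1 + s)).trace.re}

lemma isLinear_trace_mul_re (N : Matrix d d ℂ) :
    IsLinearMap ℝ fun T : Matrix d d ℂ => (T * N).trace.re := by
  constructor
  · intro T T'
    simp only [Matrix.add_mul, trace_add, Complex.add_re]
  · intro c T
    simp only [Matrix.smul_mul, trace_smul, Complex.smul_re]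

lemma posSemidef_real_smul {T : Matrix d d ℂ} (hT : T.PosSemidef) {c : ℝ} (hc : 0 ≤ c) :
    (c • T).PosSemidef := by
  have := hT.smul (a := (c : ℂ)) (by exact_mod_cast hc)
  exact this

lemma convex_powerBall (s : ℝ) : Convex ℝ (powerBall d s) := by
  intro T hT T' hT' a b ha hb hab
  refine ⟨(posSemidef_real_smul hT.1 ha).add (posSemidef_real_smul hT'.1 hb), fun κ hκ => ?_⟩
  have hl := isLinear_trace_mul_re (mpow κ (1 - s))
  rw [hl.map_add, hl.map_smul, hl.map_smul, smul_eq_mul, smul_eq_mul]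
  nlinarith [hT.2 κ hκ, hT'.2 κ hκ]

lemma convex_inversePowerSet (s : ℝ) : Convex ℝ (inversePowerSet n s) := by
  intro W hW W' hW' a b ha hb hab
  constructor
  · rcases ha.eq_or_lt with h | h
    · have hb1 : b = 1 := by linarith
      rw [← h, hb1, zero_smul, one_smul, zero_add]
      exact hW'.1
    · have h1 : (a • W).PosDef := hW.1.smul (a := (a : ℂ)) (by exact_mod_cast h)
      exact h1.add_posSemidef (posSemidef_real_smul hW'.1.posSemidef hb)
  · intro κ hκ
    have hl := isLinear_trace_mul_re (mpow κ (1 + s))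
    rw [hl.map_add, hl.map_smul, hl.map_smul, smul_eq_mul, smul_eq_mul]
    nlinarith [hW.2 κ hκ, hW'.2 κ hκ]

lemma isPosDensity_maximallyMixed (d : Type*) [Fintype d] [DecidableEq d] [Nonempty d] :
    IsPosDensity (((Fintype.card d : ℝ)⁻¹ : ℝ) • (1 : Matrix d d ℂ)) := by
  have h := isPosDensity_normalize (PosDef.one (n := d) (R := ℂ))
  rw [trace_one, Complex.natCast_re, ← Complex.ofReal_inv] at h
  exact h

lemma mpow_maximallyMixed (d : Type*) [Fintype d] [DecidableEq d] (s : ℝ) :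
    mpow (((Fintype.card d : ℝ)⁻¹ : ℝ) • (1 : Matrix d d ℂ)) s =
      ((((Fintype.card d : ℝ)⁻¹) ^ s : ℝ) : ℂ) • 1 := by
  have h := mpow_smul (PosSemidef.one (n := d) (R := ℂ)) (c := (Fintype.card d : ℝ)⁻¹)
    (by positivity) s
  have h1 : mpow (1 : Matrix d d ℂ) s = 1 := by
    rw [mpow_eq_cfun isHermitian_one]
    conv_rhs => rw [← cfun_one isHermitian_one]
    refine cfun_congr isHermitian_one fun i => ?_
    have : (isHermitian_one : (1 : Matrix d d ℂ).IsHermitian).eigenvalues i = 1 := by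
      have h2 := isHermitian_one.eigenvalues_mem_spectrum_real (A := (1 : Matrix d d ℂ)) i
      have : Nonempty d := ⟨i⟩
      rw [spectrum.one_eq] at h2
      exact h2
    rw [this]
    simp
  rw [h1] at h
  exact h

/-- Testing against the maximally mixed state bounds the trace, hence all entries. -/
lemma isCompact_powerBall [Nonempty d] (s : ℝ) : IsCompact (powerBall d s) := by
  obtain ⟨C, hC⟩ : ∃ C : ℝ, ∀ T ∈ powerBall d s, T.trace.re ≤ C := by
    set c : ℝ := ((Fintype.card d : ℝ)⁻¹) ^ (1 - s) with hc
    have hc0 : 0 < c := Real.rpow_pos_of_pos (inv_pos.mpr (by exact_mod_cast Fintype.card_pos)) _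
    refine ⟨c⁻¹, fun T hT => ?_⟩
    have h := hT.2 _ (isPosDensity_maximallyMixed d)
    rw [mpow_maximallyMixed, ← hc, Matrix.mul_smul, Matrix.mul_one, trace_smul, smul_eq_mul,
      Complex.re_ofReal_mul] at h
    rw [← one_div, le_div_iff₀ hc0]
    linarith
  have hcl : IsClosed (powerBall d s) := by
    have : powerBall d s = {T | T.PosSemidef} ∩ ⋂ κ : {κ : Matrix d d ℂ // IsPosDensity κ},
        {T | (T * mpow κ.1 (1 - s)).trace.re ≤ 1} := by
      ext T
      simp [powerBall]
    rw [this]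
    refine isClosed_posSemidef.inter (isClosed_iInter fun κ => ?_)
    exact isClosed_le (by fun_prop) continuous_const
  refine IsCompact.of_isClosed_subset (isCompact_univ_pi fun i : d =>
    isCompact_univ_pi fun j : d => isCompact_closedBall (0 : ℂ) C) hcl fun T hT => ?_
  exact fun i _ j _ => mem_closedBall_zero_iff.mpr
    ((norm_apply_le_trace hT.1 i j).trans (hC T hT))

lemma mpow_mem_powerBall {τ : Matrix d d ℂ} (hτ : IsPosDensity τ) {s : ℝ} (h0 : 0 < s)
    (h1 : s < 1) : mpow τ s ∈ powerBall d s :=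
  ⟨mpow_posSemidef hτ.1.posSemidef s,
    fun _ hκ => trace_mpow_mul_mpow_le_one hτ.isDensity hκ h0 h1⟩

lemma mpow_mem_inversePowerSet {ω : Matrix n n ℂ} (hω : IsPosDensity ω) {s : ℝ} (h0 : 0 < s) :
    mpow ω (-s) ∈ inversePowerSet n s :=
  ⟨mpow_posDef hω.1 _, fun _ hκ => one_le_trace_mpow_neg_mul hω hκ h0⟩

lemma exists_density_of_mem_powerBall [Nonempty d] {T : Matrix d d ℂ} {s : ℝ} (h0 : 0 < s)
    (h1 : s < 1) (hT : T ∈ powerBall d s) {ε : ℝ} (hε : 0 < ε) :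
    ∃ τ : Matrix d d ℂ, IsPosDensity τ ∧ (((1 + ε : ℝ) : ℂ) • mpow τ s - T).PosSemidef := by
  have hcard : (0 : ℝ) < Fintype.card d := by exact_mod_cast Fintype.card_pos
  have htr := rpow_trace_mpow_le_of_forall hT.1 (s := 1 - s) (by linarith) (by linarith) hT.2
  rw [sub_sub_cancel] at htr
  have hTs := mpow_posSemidef hT.1 (1 / s)
  have htr1 : (mpow T (1 / s)).trace.re ≤ 1 := by
    by_contra! hlt
    have := Real.one_lt_rpow hlt h0
    linarith
  set δ := ε / Fintype.card d with hδ
  have hδ0 : 0 < δ := by positivity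
  have hP := posDef_add_smul_one hTs hδ0
  set P := mpow T (1 / s) + (δ : ℂ) • (1 : Matrix d d ℂ) with hPdef
  have hc := trace_pos_of_posDef hP
  have hc1 : P.trace.re ≤ 1 + ε := by
    rw [hPdef, trace_add_smul_one, hδ, div_mul_cancel₀ _ hcard.ne']
    linarith
  refine ⟨_, isPosDensity_normalize hP, ?_⟩
  set c := P.trace.re with hcdef
  have h2 : (mpow P s - T).PosSemidef := by
    have := mpow_add_smul_one_sub hTs hδ0.le h0.le
    rwa [mpow_mpow hT.1, one_div_mul_cancel h0.ne', mpow_one hT.1.1] at this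
  have h3 : ((1 + ε : ℝ) : ℂ) • mpow ((c : ℂ)⁻¹ • P) s - T =
      (mpow P s - T) + (((1 + ε) * c⁻¹ ^ s - 1 : ℝ) : ℂ) • mpow P s := by
    rw [← Complex.ofReal_inv, mpow_smul hP.posSemidef (inv_pos.mpr hc).le, smul_smul,
      ← Complex.ofReal_mul, Complex.ofReal_sub, sub_smul, Complex.ofReal_one, one_smul]
    abel
  rw [h3]
  refine h2.add ((mpow_posSemidef hP.posSemidef s).smul ?_)
  have h4 : c ^ s ≤ 1 + ε := by
    rcases le_total c 1 with h | h
    · have := Real.rpow_le_one hc.le h h0.le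
      linarith
    · have := Real.rpow_le_rpow_of_exponent_le h h1.le
      rw [Real.rpow_one] at this
      linarith
  have h5 : 0 ≤ (1 + ε) * c⁻¹ ^ s - 1 := by
    rw [Real.inv_rpow hc.le, sub_nonneg, ← div_eq_mul_inv, le_div_iff₀ (Real.rpow_pos_of_pos hc s)]
    linarith
  exact_mod_cast h5

lemma exists_density_of_mem_inversePowerSet [Nonempty n] {W : Matrix n n ℂ} {s : ℝ} (h0 : 0 < s)
    (hW : W ∈ inversePowerSet n s) :
    ∃ ω : Matrix n n ℂ, IsPosDensity ω ∧ (W - mpow ω (-s)).PosSemidef := by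
  have hP := mpow_posDef hW.1 (-(1 / s))
  have ht := trace_pos_of_posDef hP
  have hω := isPosDensity_normalize hP
  refine ⟨_, hω, ?_⟩
  have h1 := hW.2 _ hω
  set t := (mpow W (-(1 / s))).trace.re with htdef
  have e1 : -(1 / s) * (1 + s) = -(1 / s) - 1 := by field_simp; ring
  have e2 : -(1 / s) * -s = 1 := by field_simp
  rw [← Complex.ofReal_inv, mpow_smul hP.posSemidef (inv_pos.mpr ht).le,
    mpow_mpow hW.1.posSemidef, e1, Matrix.mul_smul] at h1
  nth_rewrite 1 [← mpow_one hW.1.1] at h1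
  rw [mpow_mul_mpow hW.1, add_sub_cancel, trace_smul, smul_eq_mul, Complex.re_ofReal_mul,
    ← htdef, Real.inv_rpow ht.le, Real.rpow_add ht, Real.rpow_one, mul_inv, mul_right_comm,
    inv_mul_cancel₀ ht.ne', one_mul] at h1
  have h2 : t ^ s ≤ 1 := (one_le_inv₀ (Real.rpow_pos_of_pos ht s)).mp h1
  rw [← Complex.ofReal_inv, mpow_smul hP.posSemidef (inv_pos.mpr ht).le,
    mpow_mpow hW.1.posSemidef, e2, mpow_one hW.1.1, Real.inv_rpow ht.le, Real.rpow_neg ht.le,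
    inv_inv]
  have h3 : W - ((t ^ s : ℝ) : ℂ) • W = ((1 - t ^ s : ℝ) : ℂ) • W := by
    rw [Complex.ofReal_sub, sub_smul, Complex.ofReal_one, one_smul]
  rw [h3]
  exact hW.1.posSemidef.smul (by exact_mod_cast sub_nonneg.mpr h2)

/-- `v` is the common value `inf_ω sup_τ = sup_τ inf_ω` of `⟨ω ^ (-s) ⊗ τ ^ s⟩` over positive
densities. -/
structure IsMinimaxValue (s : ℝ) (X : e → Matrix n d ℂ) (v : ℝ) : Prop where
  pos : 0 < v
  exists_le : ∀ v', v < v' → ∃ ω, IsPosDensity ω ∧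
    ∀ τ, IsPosDensity τ → pairing X (mpow ω (-s)) (mpow τ s) ≤ v'
  exists_ge : ∀ v', v' < v → ∃ τ, IsPosDensity τ ∧
    ∀ ω, IsPosDensity ω → v' ≤ pairing X (mpow ω (-s)) (mpow τ s)

lemma mpow_neg_sub_one_posSemidef {ω : Matrix n n ℂ} (hω : IsPosDensity ω) {s : ℝ} (hs : 0 < s) :
    (mpow ω (-s) - 1).PosSemidef := by
  have h : mpow ω (-s) - 1 = cfun (fun x => ((x ^ (-s) - 1 : ℝ) : ℂ)) ω := by
    rw [sub_eq_iff_eq_add, mpow_eq_cfun hω.1.1]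
    conv_rhs => rw [← cfun_one hω.1.1, cfun_add_cfun hω.1.1]
    congr 1
    ext x
    push_cast
    ring
  rw [h]
  refine cfun_posSemidef hω.1.1 fun i => ?_
  have h1 : hω.1.1.eigenvalues i ≤ 1 := by
    have := congrArg Complex.re (trace_mpow hω.1.1 1)
    rw [mpow_one hω.1.1, Complex.ofReal_re] at this
    have htr : ω.trace.re = 1 := by rw [hω.2, Complex.one_re]
    rw [← htr, this]
    refine le_trans (le_of_eq (Real.rpow_one _).symm) (Finset.single_le_sum
      (f := fun i => hω.1.1.eigenvalues i ^ (1 : ℝ)) (fun j _ => ?_) (Finset.mem_univ i))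
    exact Real.rpow_nonneg (hω.1.eigenvalues_pos j).le _
  have := Real.one_le_rpow_of_pos_of_le_one_of_nonpos (hω.1.eigenvalues_pos i) h1
    (neg_nonpos.mpr hs.le)
  exact_mod_cast sub_nonneg.mpr this

/-- Sion's theorem on `powerBall` and `inversePowerSet`. The elements of these sets lie below
`τ ^ s`, up to a factor close to `1`, and above `ω ^ (-s)`, so that by monotonicity of the pairing
the optimizers can be taken among powers of densities. -/
theorem exists_isMinimaxValue [Nonempty n] [Nonempty d] {s : ℝ} (h0 : 0 < s) (h1 : s < 1)
    {X : e → Matrix n d ℂ} (hX : X ≠ 0) : ∃ v, IsMinimaxValue s X v := by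
  have hmd := isPosDensity_maximallyMixed d
  have hmn := isPosDensity_maximallyMixed n
  obtain ⟨v, hv1, hv2⟩ := exists_minimax (A := powerBall d s) (B := inversePowerSet n s)
    ⟨_, mpow_mem_powerBall hmd h0 h1⟩ (isCompact_powerBall s) (convex_powerBall s)
    ⟨_, mpow_mem_inversePowerSet hmn h0⟩ (convex_inversePowerSet s)
    (f := fun T W => pairing X W T) (pairing_isLinear_right X) (pairing_isLinear_left X)
    (continuous_pairing_right X) (continuous_pairing_left X)
    (fun T hT W hW => pairing_nonneg X hW.1.posSemidef hT.1)
  have hle : ∀ v', v < v' → ∃ ω, IsPosDensity ω ∧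
      ∀ τ, IsPosDensity τ → pairing X (mpow ω (-s)) (mpow τ s) ≤ v' := by
    intro v' hv'
    obtain ⟨W, hW, hWv⟩ := hv1 v' hv'
    obtain ⟨ω, hω, hWω⟩ := exists_density_of_mem_inversePowerSet h0 hW
    exact ⟨ω, hω, fun τ hτ => (pairing_mono_left X hWω (mpow_posSemidef hτ.1.posSemidef s)).trans
      (hWv _ (mpow_mem_powerBall hτ h0 h1))⟩
  refine ⟨v, ?_, hle, ?_⟩
  -- the maximally mixed `τ` and the bound `1 ≤ ω ^ (-s)` show that the value is positive
  · set c : ℝ := ((Fintype.card d : ℝ)⁻¹) ^ s with hc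
    have hc0 : 0 < c := Real.rpow_pos_of_pos (inv_pos.mpr (by exact_mod_cast Fintype.card_pos)) _
    have hpos : 0 < c * ∑ i, hsq (X i) := by
      obtain ⟨i, hi⟩ := Function.ne_iff.mp hX
      refine mul_pos hc0 (Finset.sum_pos' (fun i _ => hsq_nonneg _) ⟨i, Finset.mem_univ i, ?_⟩)
      refine (hsq_nonneg _).lt_of_ne fun h => hi ?_
      rw [hsq] at h
      have := trace_eq_re (posSemidef_conjTranspose_mul_self (X i)).1
      rw [← h, Complex.ofReal_zero, trace_conjTranspose_mul_self_eq_zero_iff] at this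
      exact this
    refine lt_of_lt_of_le hpos (le_of_forall_gt_imp_ge_of_dense fun v' hv' => ?_)
    obtain ⟨ω, hω, hωv⟩ := hle v' hv'
    refine le_trans ?_ (hωv _ hmd)
    have h2 := pairing_mono_left X (mpow_neg_sub_one_posSemidef hω h0)
      (mpow_posSemidef hmd.1.posSemidef s)
    refine le_trans (le_of_eq ?_) h2
    rw [mpow_maximallyMixed, pairing_smul_right, ← hc]
    congr 1
    refine Finset.sum_congr rfl fun i _ => ?_
    rw [Matrix.mul_one, Matrix.mul_one, hsq]
  · intro v' hv'
    rcases le_or_gt v' 0 with hneg | hpos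
    · exact ⟨_, hmd, fun ω hω => hneg.trans (pairing_nonneg X
        (mpow_posSemidef hω.1.posSemidef _) (mpow_posSemidef hmd.1.posSemidef s))⟩
    · obtain ⟨v'', h3, h4⟩ := exists_between hv'
      obtain ⟨T, hT, hTv⟩ := hv2 v'' h4
      have hε : 0 < v'' / v' - 1 := by
        rw [sub_pos, lt_div_iff₀ hpos]
        linarith
      obtain ⟨τ, hτ, hTτ⟩ := exists_density_of_mem_powerBall h0 h1 hT hε
      refine ⟨τ, hτ, fun ω hω => ?_⟩
      have h5 := hTv _ (mpow_mem_inversePowerSet hω h0)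
      have h6 := pairing_mono_right X (mpow_posSemidef hω.1.posSemidef (-s)) hTτ
      rw [pairing_smul_right, add_sub_cancel] at h6
      have h7 : v'' ≤ v'' / v' * pairing X (mpow ω (-s)) (mpow τ s) := h5.trans h6
      have hv''0 : 0 < v'' := hpos.trans h3
      rw [div_mul_eq_mul_div, le_div_iff₀ hpos] at h7
      exact le_of_mul_le_mul_left h7 hv''0

end Minimax

/-! ### Norms of families and their chain inequalities -/

section Families

variable {n d e f : Type*} [Fintype n] [DecidableEq n] [Fintype d] [DecidableEq d]
  [Fintype e] [DecidableEq e] [Fintype f] [DecidableEq f]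

/-- A family of matrices stacked vertically: the family index joins the row index. -/
def stackRows (X : e → Matrix n d ℂ) : Matrix (e × n) d ℂ :=
  Matrix.of fun p k => X p.1 p.2 k

/-- A family of matrices put side by side: the family index joins the column index. -/
def stackCols (X : e → Matrix n d ℂ) : Matrix n (e × d) ℂ :=
  Matrix.of fun j p => X p.1 j p.2

lemma kronecker_mul_stackRows (A : Matrix n n ℂ) (X : e → Matrix n d ℂ) :
    ((1 : Matrix e e ℂ) ⊗ₖ A) * stackRows X = stackRows fun i => A * X i := by
  ext ⟨i, j⟩ k
  simp [stackRows, mul_apply, Fintype.sum_prod_type, one_apply]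

lemma stackRows_mul (X : e → Matrix n d ℂ) (T : Matrix d d ℂ) :
    stackRows X * T = stackRows fun i => X i * T := by
  ext ⟨i, j⟩ k
  simp [stackRows, mul_apply]

lemma mul_stackCols (A : Matrix n n ℂ) (X : e → Matrix n d ℂ) :
    A * stackCols X = stackCols fun i => A * X i := by
  ext j ⟨i, k⟩
  simp [stackCols, mul_apply]

lemma stackCols_mul_kronecker (X : e → Matrix n d ℂ) (T : Matrix d d ℂ) :
    stackCols X * ((1 : Matrix e e ℂ) ⊗ₖ T) = stackCols fun i => X i * T := by
  ext j ⟨i, k⟩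
  simp [stackCols, mul_apply, Fintype.sum_prod_type, one_apply]

lemma hsq_stackRows (X : e → Matrix n d ℂ) : hsq (stackRows X) = ∑ i, hsq (X i) := by
  simp only [hsq_eq_sum, stackRows, Matrix.of_apply, Fintype.sum_prod_type]
  rw [Finset.sum_comm]

lemma hsq_stackCols (X : e → Matrix n d ℂ) : hsq (stackCols X) = ∑ i, hsq (X i) := by
  simp only [hsq_eq_sum, stackCols, Matrix.of_apply, Fintype.sum_prod_type]

lemma hsq_stackRows_eq_pairing (X : e → Matrix n d ℂ) {A : Matrix n n ℂ} {T : Matrix d d ℂ}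
    (hA : A.PosDef) (hT : T.PosDef) (s t : ℝ) :
    hsq (mpow ((1 : Matrix e e ℂ) ⊗ₖ A) (s / 2) * (stackRows X * mpow T (t / 2))) =
      pairing X (mpow A s) (mpow T t) := by
  rw [mpow_one_kronecker hA.1, stackRows_mul, kronecker_mul_stackRows, hsq_stackRows]
  refine Finset.sum_congr rfl fun i _ => ?_
  rw [← Matrix.mul_assoc, hsq_mpow_half_mul_mul hA hT]

lemma hsq_stackCols_eq_pairing (X : e → Matrix n d ℂ) {A : Matrix n n ℂ} {T : Matrix d d ℂ}
    (hA : A.PosDef) (hT : T.PosDef) (s t : ℝ) :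
    hsq (mpow A (s / 2) * (stackCols X * mpow ((1 : Matrix e e ℂ) ⊗ₖ T) (t / 2))) =
      pairing X (mpow A s) (mpow T t) := by
  rw [mpow_one_kronecker hT.1, stackCols_mul_kronecker, mul_stackCols, hsq_stackCols]
  refine Finset.sum_congr rfl fun i _ => ?_
  rw [← Matrix.mul_assoc, hsq_mpow_half_mul_mul hA hT]

/-- The operator on the purifying system obtained by contracting with `1 ⊗ W`. -/
def contract (X : e → Matrix n d ℂ) (W : Matrix n n ℂ) : Matrix d d ℂ :=
  ∑ i, (X i)ᴴ * W * X i

lemma contract_posSemidef (X : e → Matrix n d ℂ) {W : Matrix n n ℂ} (hW : W.PosSemidef) :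
    (contract X W).PosSemidef :=
  posSemidef_sum _ fun _ _ => hW.conjTranspose_mul_mul_same _

lemma trace_contract_mul (X : e → Matrix n d ℂ) (W : Matrix n n ℂ) (T : Matrix d d ℂ) :
    (contract X W * T).trace.re = pairing X W T := by
  rw [contract, Finset.sum_mul, trace_sum, Complex.re_sum, pairing]

lemma conjTranspose_stackRows_mul (X : e → Matrix n d ℂ) (W : Matrix n n ℂ) :
    (stackRows X)ᴴ * ((1 : Matrix e e ℂ) ⊗ₖ W) * stackRows X = contract X W := by
  rw [Matrix.mul_assoc, kronecker_mul_stackRows]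
  ext k l
  simp only [contract, stackRows, Matrix.sum_apply, Matrix.mul_assoc]
  rw [mul_apply, Fintype.sum_prod_type]
  refine Finset.sum_congr rfl fun i _ => ?_
  rw [mul_apply]
  rfl

/-- `‖S ^ (-s / 2) ρ S ^ (-s / 2)‖_α` for `s = (α - 1) / α`, where `ρ` is the marginal on `e`, `n`
of the pure state with amplitudes `X i j k`. -/
def condNorm (s : ℝ) (X : e → Matrix n d ℂ) (S : Matrix n n ℂ) : ℝ :=
  (mpow (contract X (mpow S (-s))) (1 / (1 - s))).trace.re ^ (1 - s)

lemma condNorm_nonneg (s : ℝ) (X : e → Matrix n d ℂ) {S : Matrix n n ℂ} (hS : S.PosSemidef) :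
    0 ≤ condNorm s X S :=
  Real.rpow_nonneg (trace_mpow_nonneg (contract_posSemidef X (mpow_posSemidef hS _)) _) _

lemma pairing_le_condNorm (X : e → Matrix n d ℂ) {S : Matrix n n ℂ} (hS : S.PosSemidef) {s : ℝ}
    (h0 : 0 < s) (h1 : s < 1) {τ : Matrix d d ℂ} (hτ : IsDensity τ) :
    pairing X (mpow S (-s)) (mpow τ s) ≤ condNorm s X S := by
  rw [← trace_contract_mul]
  exact trace_mul_mpow_le (contract_posSemidef X (mpow_posSemidef hS _)) hτ h0 h1

lemma condNorm_le [Nonempty d] (X : e → Matrix n d ℂ) {S : Matrix n n ℂ} (hS : S.PosSemidef)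
    {s K : ℝ} (h0 : 0 < s) (h1 : s < 1)
    (h : ∀ τ, IsPosDensity τ → pairing X (mpow S (-s)) (mpow τ s) ≤ K) : condNorm s X S ≤ K :=
  rpow_trace_mpow_le_of_forall (contract_posSemidef X (mpow_posSemidef hS _)) h0 h1 fun τ hτ => by
    rw [trace_contract_mul]
    exact h τ hτ

lemma condNorm_neg_le_pairing (X : e → Matrix n d ℂ) {S : Matrix n n ℂ} (hS : S.PosSemidef)
    {u : ℝ} (hu : 0 < u) {τ : Matrix d d ℂ} (hτ : IsPosDensity τ) :
    condNorm (-u) X S ≤ pairing X (mpow S u) (mpow τ (-u)) := by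
  rw [← trace_contract_mul, condNorm, neg_neg, sub_neg_eq_add]
  exact le_trace_mul_mpow_neg (contract_posSemidef X (mpow_posSemidef hS _)) hτ hu

lemma le_condNorm_neg [Nonempty d] (X : e → Matrix n d ℂ) {S : Matrix n n ℂ} (hS : S.PosSemidef)
    {u K : ℝ} (hu : 0 < u)
    (h : ∀ τ, IsPosDensity τ → K ≤ pairing X (mpow S u) (mpow τ (-u))) : K ≤ condNorm (-u) X S := by
  rw [condNorm, neg_neg, sub_neg_eq_add]
  refine le_rpow_trace_mpow_of_forall (contract_posSemidef X (mpow_posSemidef hS _)) hu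
    fun τ hτ => ?_
  rw [trace_contract_mul]
  exact h τ hτ

/-- The norm computed on the system `e`, `n` instead of the purifying system. -/
lemma condNorm_eq_stackRows (s : ℝ) (hs : s ≠ 1) (X : e → Matrix n d ℂ) {S : Matrix n n ℂ}
    (hS : S.PosDef) :
    condNorm s X S = (mpow ((mpow ((1 : Matrix e e ℂ) ⊗ₖ S) (-s / 2) * stackRows X) *
      (mpow ((1 : Matrix e e ℂ) ⊗ₖ S) (-s / 2) * stackRows X)ᴴ) (1 / (1 - s))).trace.re ^
        (1 - s) := by
  have hp : 1 / (1 - s) ≠ 0 := one_div_ne_zero (sub_ne_zero.mpr hs.symm)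
  rw [trace_mpow_mul_conjTranspose _ hp, condNorm, ← conjTranspose_stackRows_mul,
    conjTranspose_mul, mpow_one_kronecker hS.1, conjTranspose_kronecker, conjTranspose_one,
    conjTranspose_mpow hS, ← mpow_half_mul_half hS (-s)]
  have : ∀ A : Matrix n n ℂ, (1 : Matrix e e ℂ) ⊗ₖ (A * A) =
      ((1 : Matrix e e ℂ) ⊗ₖ A) * ((1 : Matrix e e ℂ) ⊗ₖ A) := fun A => by
    rw [← mul_kronecker_mul, Matrix.one_mul]
  rw [this]
  simp only [Matrix.mul_assoc]

lemma IsMinimaxValue.le_condNorm [Nonempty d] {s v : ℝ} {X : e → Matrix n d ℂ}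
    (hv : IsMinimaxValue s X v) (h0 : 0 < s) (h1 : s < 1) {ω : Matrix n n ℂ}
    (hω : IsPosDensity ω) : v ≤ condNorm s X ω := by
  refine le_of_forall_lt fun v' hv' => ?_
  obtain ⟨v'', h3, h4⟩ := exists_between hv'
  obtain ⟨τ, hτ, h⟩ := hv.exists_ge v'' h4
  exact h3.trans_le ((h ω hω).trans
    (pairing_le_condNorm X hω.1.posSemidef h0 h1 hτ.isDensity))

lemma IsMinimaxValue.exists_condNorm_le [Nonempty d] {s v : ℝ} {X : e → Matrix n d ℂ}
    (hv : IsMinimaxValue s X v) (h0 : 0 < s) (h1 : s < 1) {v' : ℝ} (h : v < v') :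
    ∃ ω, IsPosDensity ω ∧ condNorm s X ω ≤ v' := by
  obtain ⟨ω, hω, h⟩ := hv.exists_le v' h
  exact ⟨ω, hω, condNorm_le X hω.1.posSemidef h0 h1 h⟩

lemma IsMinimaxValue.condNorm_neg_le {u v : ℝ} {X : e → Matrix n d ℂ}
    (hv : IsMinimaxValue u (fun i => (X i)ᴴ) v) (h0 : 0 < u) {ω : Matrix n n ℂ}
    (hω : IsPosDensity ω) : condNorm (-u) X ω ≤ v := by
  refine le_of_forall_gt_imp_ge_of_dense fun v' hv' => ?_
  obtain ⟨κ, hκ, h⟩ := hv.exists_le v' hv'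
  have h2 := h ω hω
  rw [pairing_conjTranspose] at h2
  exact (condNorm_neg_le_pairing X hω.1.posSemidef h0 hκ).trans h2

lemma IsMinimaxValue.reindex {s v : ℝ} {X : e → Matrix n d ℂ} (hv : IsMinimaxValue s X v)
    (φ : f ≃ e) : IsMinimaxValue s (fun i => X (φ i)) v := by
  have h : ∀ W T, pairing (fun i => X (φ i)) W T = pairing X W T := fun W T =>
    Equiv.sum_comp φ fun i => ((X i)ᴴ * W * X i * T).trace.re
  refine ⟨hv.pos, ?_, ?_⟩
  · simp only [h]
    exact hv.exists_le
  · simp only [h]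
    exact hv.exists_ge

end Families

section Tensors

variable {a b c d : Type*} [Fintype a] [DecidableEq a] [Fintype b] [DecidableEq b]
  [Fintype c] [DecidableEq c] [Fintype d] [DecidableEq d]

/-- The amplitudes of a pure state on `a`, `b`, `c`, `d`, as matrices from `d` to `c`. They describe
its marginal on `a`, `b`, `c`, conditioned on `c`. -/
def familyAB (ψ : a → b → c → d → ℂ) : a × b → Matrix c d ℂ :=
  fun p => Matrix.of fun k l => ψ p.1 p.2 k l

/-- The amplitudes of a pure state on `a`, `b`, `c`, `d`, as matrices from `d` to `b × c`. They
describe its marginal on `a`, `b`, `c`, conditioned on `b`, `c`. -/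
def familyA (ψ : a → b → c → d → ℂ) : a → Matrix (b × c) d ℂ :=
  fun i => Matrix.of fun p l => ψ i p.1 p.2 l

/-- The amplitudes of a pure state on `a`, `b`, `c`, `d`, as matrices from `a × d` to `c`. They
describe its marginal on `b`, `c`, conditioned on `c` and purified by `a`, `d`. -/
def familyB (ψ : a → b → c → d → ℂ) : b → Matrix c (a × d) ℂ :=
  fun j => Matrix.of fun k p => ψ p.1 j k p.2

lemma stackRows_familyB (ψ : a → b → c → d → ℂ) : stackRows (familyB ψ) = stackCols (familyA ψ) :=
  rfl

lemma pairing_familyA (ψ : a → b → c → d → ℂ) (W : Matrix c c ℂ) (T : Matrix d d ℂ) :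
    pairing (familyA ψ) ((1 : Matrix b b ℂ) ⊗ₖ W) T = pairing (familyAB ψ) W T := by
  rw [pairing, pairing, Fintype.sum_prod_type]
  refine Finset.sum_congr rfl fun i _ => ?_
  have : familyA ψ i = stackRows fun j => familyAB ψ (i, j) := rfl
  rw [this, conjTranspose_stackRows_mul, trace_contract_mul, pairing]

lemma posDef_one_kronecker {S : Matrix c c ℂ} (hS : S.PosDef) :
    ((1 : Matrix b b ℂ) ⊗ₖ S).PosDef :=
  PosDef.one.kronecker hS

lemma hsq_familyA (ψ : a → b → c → d → ℂ) {S : Matrix c c ℂ} {T : Matrix d d ℂ} (hS : S.PosDef)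
    (hT : T.PosDef) (s t : ℝ) :
    hsq (mpow ((1 : Matrix b b ℂ) ⊗ₖ S) (s / 2) *
      (stackCols (familyA ψ) * mpow ((1 : Matrix a a ℂ) ⊗ₖ T) (t / 2))) =
      pairing (familyAB ψ) (mpow S s) (mpow T t) := by
  rw [hsq_stackCols_eq_pairing _ (posDef_one_kronecker hS) hT, mpow_one_kronecker hS.1,
    pairing_familyA]

lemma hsq_mul_mpow_half {n m : Type*} [Fintype n] [DecidableEq n] [Fintype m] [DecidableEq m]
    {A : Matrix n n ℂ} (hA : A.PosDef) (s : ℝ) (Y : Matrix n m ℂ) :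
    hsq (mpow A (s / 2) * Y) = (Y * Yᴴ * mpow A s).trace.re := by
  rw [hsq_mpow_half_mul hA, Matrix.mul_assoc, trace_mul_comm, trace_mul_comm (Y * Yᴴ),
    Matrix.mul_assoc]

lemma le_mul_rpow_of_forall_gt {A K v r : ℝ} (hr : 0 ≤ r)
    (h : ∀ v', v < v' → A ≤ K * v' ^ r) : A ≤ K * v ^ r := by
  have : ContinuousAt (fun x : ℝ => K * x ^ r) v :=
    continuousAt_const.mul (continuousAt_id.rpow_const (Or.inr hr))
  exact ge_of_tendsto (this.tendsto.mono_left nhdsWithin_le_nhds)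
    (Filter.eventually_of_mem self_mem_nhdsWithin fun v' hv' => h v' hv' :
      ∀ᶠ x in nhdsWithin v (Set.Ioi v), A ≤ K * x ^ r)

/-- The chain inequality when all parameters exceed `1`, for a fixed operator on `c`. -/
theorem condNorm_le_of_pos [Nonempty b] [Nonempty c] [Nonempty d] {ψ : a → b → c → d → ℂ}
    {S : Matrix c c ℂ} (hS : S.PosDef) {r s t v : ℝ} (hr0 : 0 < r) (hr1 : r < 1) (hs0 : 0 < s)
    (hs1 : s < 1) (ht0 : 0 < t) (ht1 : t < 1) (h : 1 / r = 1 / s + 1 / t)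
    (hv : IsMinimaxValue s (familyA ψ) v) :
    condNorm r (familyAB ψ) S ≤ condNorm t (familyB ψ) S ^ (r / t) * v ^ (r / s) := by
  refine le_mul_rpow_of_forall_gt (by positivity) fun v' hv' => ?_
  refine condNorm_le _ hS.posSemidef hr0 hr1 fun τ hτ => ?_
  obtain ⟨ω, hω, hωv⟩ := hv.exists_le v' hv'
  have hS' := posDef_one_kronecker (b := b) hS
  have key := interpolation_sup_sup (X := stackCols (familyA ψ)) hS'
    (posDef_one_kronecker (b := a) hτ.1) hω hr0 hs0 hs1 ht0 h
    (K := condNorm t (familyB ψ) S) (fun η hη => ?_)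
  · rw [Matrix.mul_assoc, hsq_familyA ψ hS hτ.1, hsq_stackCols_eq_pairing _ hω.1 hτ.1] at key
    refine key.trans (mul_le_mul_of_nonneg_left ?_
      (Real.rpow_nonneg (condNorm_nonneg _ _ hS.posSemidef) _))
    exact Real.rpow_le_rpow (pairing_nonneg _ (mpow_posSemidef hω.1.posSemidef _)
      (mpow_posSemidef hτ.1.posSemidef _)) (hωv τ hτ) (by positivity)
  · rw [hsq_mul_mpow_half hη.1, condNorm_eq_stackRows t ht1.ne _ hS, stackRows_familyB]
    exact trace_mul_mpow_le (posSemidef_self_mul_conjTranspose _) hη.isDensity ht0 ht1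

/-- The chain inequality when only the parameter of `B|C` is below `1`, for a fixed operator on
`c`. -/
theorem le_condNorm_neg_mul [Nonempty b] [Nonempty c] [Nonempty d] {ψ : a → b → c → d → ℂ}
    {S : Matrix c c ℂ} (hS : S.PosDef) {r s t v : ℝ} (hr0 : 0 < r) (hr1 : r < 1) (hs0 : 0 < s)
    (ht0 : 0 < t) (ht1 : t < 1) (h : 1 / s = 1 / r + 1 / t)
    (hv : IsMinimaxValue s (familyA ψ) v) :
    v ≤ condNorm (-t) (familyB ψ) S ^ (s / t) * condNorm r (familyAB ψ) S ^ (s / r) := by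
  have hN := condNorm_nonneg (-t) (familyB ψ) hS.posSemidef
  have hM := condNorm_nonneg r (familyAB ψ) hS.posSemidef
  set M := condNorm r (familyAB ψ) S ^ (s / r) with hMdef
  have hM0 : 0 ≤ M := Real.rpow_nonneg hM _
  refine le_of_forall_lt fun v'' hv'' => ?_
  obtain ⟨v', hlt, hv'⟩ := exists_between (max_lt hv'' hv.pos)
  refine ((le_max_left _ _).trans_lt hlt).trans_le ?_
  have hv'0 : 0 < v' := (le_max_right _ _).trans_lt hlt
  obtain ⟨τ, hτ, hτv⟩ := hv.exists_ge v' hv'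
  have hS' := posDef_one_kronecker (b := b) hS
  have key : ∀ κ : Matrix (b × c) (b × c) ℂ, IsPosDensity κ → v' ≤ hsq (mpow κ (-t / 2) *
      (mpow ((1 : Matrix b b ℂ) ⊗ₖ S) (t / 2) * stackCols (familyA ψ))) ^ (s / t) * M := by
    intro κ hκ
    have := interpolation_inf_inf (X := stackCols (familyA ψ)) (v := v') hS'
      (posDef_one_kronecker (b := a) hτ.1) hκ hr0 hs0 ht0 ht1 h (fun ω hω => by
        rw [hsq_stackCols_eq_pairing _ hω.1 hτ.1]
        exact hτv ω hω)
    rw [Matrix.mul_assoc, hsq_familyA ψ hS hτ.1] at this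
    refine this.trans (mul_le_mul_of_nonneg_left ?_ (Real.rpow_nonneg (hsq_nonneg _) _))
    exact Real.rpow_le_rpow (pairing_nonneg _ (mpow_posSemidef hS.posSemidef _)
      (mpow_posSemidef hτ.1.posSemidef _))
      (pairing_le_condNorm _ hS.posSemidef hr0 hr1 hτ.isDensity) (by positivity)
  have hMpos : 0 < M := by
    refine hM0.lt_of_ne fun h0 => ?_
    have := key _ (isPosDensity_maximallyMixed (b × c))
    rw [← h0, mul_zero] at this
    linarith
  have hst : 0 < s / t := by positivity
  -- `key` bounds the pairing of `familyB` from below at every density, hence its infimum `condNorm`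
  have hdual : (v' / M) ^ (t / s) ≤ condNorm (-t) (familyB ψ) S := by
    rw [condNorm_eq_stackRows (-t) (by linarith) _ hS, neg_neg, sub_neg_eq_add, stackRows_familyB]
    refine le_rpow_trace_mpow_of_forall (posSemidef_self_mul_conjTranspose _) ht0 fun κ hκ => ?_
    rw [← hsq_mul_mpow_half hκ.1]
    have h1 := (div_le_iff₀ hMpos).mpr (key κ hκ)
    refine (Real.rpow_le_rpow (by positivity) h1 (by positivity)).trans_eq ?_
    rw [← Real.rpow_mul (hsq_nonneg _), div_mul_div_cancel₀ ht0.ne', div_self hs0.ne',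
      Real.rpow_one]
  have h2 := Real.rpow_le_rpow (by positivity) hdual hst.le
  rw [← Real.rpow_mul (by positivity), div_mul_div_cancel₀ hs0.ne', div_self ht0.ne',
    Real.rpow_one, div_le_iff₀ hMpos] at h2
  exact h2

/-- The chain inequality when only the parameter of `A|BC` is below `1`, for a fixed operator on
`c`. -/
theorem condNorm_le_of_neg [Nonempty b] [Nonempty c] [Nonempty d] {ψ : a → b → c → d → ℂ}
    {S : Matrix c c ℂ} (hS : S.PosDef) {r s t v : ℝ} (hr0 : 0 < r) (hr1 : r < 1) (hs0 : 0 < s)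
    (hs1 : s < 1) (ht0 : 0 < t) (ht1 : t < 1) (h : 1 / t = 1 / r + 1 / s)
    (hv : IsMinimaxValue s (fun i => (familyA ψ i)ᴴ) v) :
    condNorm t (familyB ψ) S ≤ condNorm r (familyAB ψ) S ^ (t / r) * v ^ (t / s) := by
  refine le_mul_rpow_of_forall_gt (by positivity) fun v' hv' => ?_
  have hS' := posDef_one_kronecker (b := b) hS
  have hS'' := posDef_one_kronecker (b := a) hS'
  rw [condNorm_eq_stackRows t ht1.ne _ hS, stackRows_familyB]
  refine rpow_trace_mpow_le_of_forall (posSemidef_self_mul_conjTranspose _) ht0 ht1 fun ω hω => ?_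
  rw [← hsq_mul_mpow_half hω.1]
  obtain ⟨κ, hκ, hκv⟩ := hv.exists_le v' hv'
  have key := interpolation_sup_inf (X := stackRows (familyA ψ)) hS''
    (posDef_one_kronecker (b := a) hω.1) hκ hr0 hs0 hs1 ht0 h
    (Ka := condNorm r (familyAB ψ) S) (Kb := v') (fun η hη => ?_) (fun x => ?_)
  · refine le_trans (le_of_eq ?_) (key.trans_eq (mul_comm _ _))
    rw [mpow_one_kronecker hω.1.1, mpow_one_kronecker hS'.1, kronecker_mul_stackRows,
      kronecker_mul_stackRows, hsq_stackRows, mul_stackCols, mul_stackCols, hsq_stackCols]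
  · rw [hsq_stackRows_eq_pairing _ hS' hη.1, mpow_one_kronecker hS.1, pairing_familyA]
    exact pairing_le_condNorm _ hS.posSemidef hr0 hr1 hη.isDensity
  · have hV := mcpow_I_unitary hS' x
    rw [mcpow_one_kronecker hS'.1, mpow_one_kronecker hω.1.1, stackRows_mul,
      kronecker_mul_stackRows, kronecker_mul_stackRows, hsq_stackRows]
    simp_rw [hsq_mpow_mul_unitary hω.1 hV]
    rw [← hsq_stackRows, ← kronecker_mul_stackRows, ← mpow_one_kronecker (hω.conj' hV).1.1,
      ← stackRows_mul, hsq_stackRows_eq_pairing _ (hω.conj' hV).1 hκ.1]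
    have := hκv _ (hω.conj' hV)
    rwa [pairing_conjTranspose] at this

lemma log_le_of_le_rpow_mul_rpow {x y z p q r : ℝ} (hx : 0 < x) (hy : 0 < y) (hz : 0 < z)
    (hp : 0 < p) (h : x ≤ y ^ (p / q) * z ^ (p / r)) :
    1 / p * Real.logb 2 x ≤ 1 / q * Real.logb 2 y + 1 / r * Real.logb 2 z := by
  have h1 := Real.logb_le_logb_of_le (b := 2) (by norm_num) hx h
  rw [Real.logb_mul (Real.rpow_pos_of_pos hy _).ne' (Real.rpow_pos_of_pos hz _).ne',
    Real.logb_rpow_eq_mul_logb_of_pos hy, Real.logb_rpow_eq_mul_logb_of_pos hz] at h1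
  calc 1 / p * Real.logb 2 x
      ≤ 1 / p * (p / q * Real.logb 2 y + p / r * Real.logb 2 z) :=
        mul_le_mul_of_nonneg_left h1 (by positivity)
    _ = _ := by field_simp

/-- The chain inequality when all parameters exceed `1`, optimized over the operator on `c`. -/
theorem IsMinimaxValue.chain_pos [Nonempty a] [Nonempty b] [Nonempty c] [Nonempty d]
    {ψ : a → b → c → d → ℂ} {r s t x y z : ℝ} (hr0 : 0 < r) (hr1 : r < 1) (hs0 : 0 < s)
    (hs1 : s < 1) (ht0 : 0 < t) (ht1 : t < 1) (h : 1 / r = 1 / s + 1 / t)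
    (hx : IsMinimaxValue r (familyAB ψ) x) (hy : IsMinimaxValue s (familyA ψ) y)
    (hz : IsMinimaxValue t (familyB ψ) z) :
    1 / r * Real.logb 2 x ≤ 1 / s * Real.logb 2 y + 1 / t * Real.logb 2 z := by
  refine log_le_of_le_rpow_mul_rpow hx.pos hy.pos hz.pos hr0 ?_
  refine le_mul_rpow_of_forall_gt (by positivity) fun z' hz' => ?_
  obtain ⟨σ, hσ, hσz⟩ := hz.exists_condNorm_le ht0 ht1 hz'
  refine (hx.le_condNorm hr0 hr1 hσ).trans
    ((condNorm_le_of_pos hσ.1 hr0 hr1 hs0 hs1 ht0 ht1 h hy).trans ?_)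
  rw [mul_comm]
  exact mul_le_mul_of_nonneg_left (Real.rpow_le_rpow (condNorm_nonneg _ _ hσ.1.posSemidef) hσz
    (by positivity)) (Real.rpow_nonneg hy.pos.le _)

/-- The chain inequality when only the parameter of `B|C` is below `1`, optimized over the operator
on `c`. -/
theorem IsMinimaxValue.chain_right_neg [Nonempty a] [Nonempty b] [Nonempty c] [Nonempty d]
    {ψ : a → b → c → d → ℂ} {r s t x y z : ℝ} (hr0 : 0 < r) (hr1 : r < 1) (hs0 : 0 < s)
    (ht0 : 0 < t) (ht1 : t < 1) (h : 1 / s = 1 / r + 1 / t)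
    (hx : IsMinimaxValue r (familyAB ψ) x) (hy : IsMinimaxValue s (familyA ψ) y)
    (hz : IsMinimaxValue t (fun j => (familyB ψ j)ᴴ) z) :
    1 / s * Real.logb 2 y ≤ 1 / t * Real.logb 2 z + 1 / r * Real.logb 2 x := by
  refine log_le_of_le_rpow_mul_rpow hy.pos hz.pos hx.pos hs0 ?_
  refine le_mul_rpow_of_forall_gt (by positivity) fun x' hx' => ?_
  obtain ⟨σ, hσ, hσx⟩ := hx.exists_condNorm_le hr0 hr1 hx'
  refine (le_condNorm_neg_mul hσ.1 hr0 hr1 hs0 ht0 ht1 h hy).trans ?_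
  exact mul_le_mul (Real.rpow_le_rpow (condNorm_nonneg _ _ hσ.1.posSemidef)
    (hz.condNorm_neg_le ht0 hσ) (by positivity)) (Real.rpow_le_rpow
    (condNorm_nonneg _ _ hσ.1.posSemidef) hσx (by positivity))
    (Real.rpow_nonneg (condNorm_nonneg _ _ hσ.1.posSemidef) _) (Real.rpow_nonneg hz.pos.le _)

/-- The chain inequality when only the parameter of `A|BC` is below `1`, optimized over the operator
on `c`. -/
theorem IsMinimaxValue.chain_left_neg [Nonempty a] [Nonempty b] [Nonempty c] [Nonempty d]
    {ψ : a → b → c → d → ℂ} {r s t x y z : ℝ} (hr0 : 0 < r) (hr1 : r < 1) (hs0 : 0 < s)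
    (hs1 : s < 1) (ht0 : 0 < t) (ht1 : t < 1) (h : 1 / t = 1 / r + 1 / s)
    (hx : IsMinimaxValue r (familyAB ψ) x)
    (hy : IsMinimaxValue s (fun i => (familyA ψ i)ᴴ) y)
    (hz : IsMinimaxValue t (familyB ψ) z) :
    1 / t * Real.logb 2 z ≤ 1 / s * Real.logb 2 y + 1 / r * Real.logb 2 x := by
  refine log_le_of_le_rpow_mul_rpow hz.pos hy.pos hx.pos ht0 ?_
  refine le_mul_rpow_of_forall_gt (by positivity) fun x' hx' => ?_
  obtain ⟨σ, hσ, hσx⟩ := hx.exists_condNorm_le hr0 hr1 hx'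
  refine (hz.le_condNorm ht0 ht1 hσ).trans
    ((condNorm_le_of_neg hσ.1 hr0 hr1 hs0 hs1 ht0 ht1 h hy).trans ?_)
  rw [mul_comm]
  exact mul_le_mul_of_nonneg_left (Real.rpow_le_rpow (condNorm_nonneg _ _ hσ.1.posSemidef) hσx
    (by positivity)) (Real.rpow_nonneg hy.pos.le _)

end Tensors

/-! ### Entropies in terms of norms and minimax values -/

section Support

variable {n m d e : Type*} [Fintype n] [DecidableEq n] [Fintype m] [DecidableEq m]
  [Fintype d] [DecidableEq d] [Fintype e] [DecidableEq e]

/-- The orthogonal projection onto the kernel of a Hermitian matrix. -/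
def kerProj (A : Matrix n n ℂ) : Matrix n n ℂ :=
  cfun (fun x => if x = 0 then 1 else 0) A

lemma kerProj_mul_self {A : Matrix n n ℂ} (hA : A.IsHermitian) : kerProj A * A = 0 := by
  conv_lhs => rw [← cfun_ofReal hA]
  rw [cfun_ofReal hA, kerProj]
  conv_lhs => arg 2; rw [← cfun_ofReal hA]
  rw [cfun_mul_cfun hA]
  have : cfun (fun _ => (0 : ℂ)) A = 0 := by rw [cfun_def hA]; simp
  rw [← this]
  refine cfun_congr hA fun i => ?_
  by_cases h : hA.eigenvalues i = 0 <;> simp [h]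

lemma kerProj_posSemidef {A : Matrix n n ℂ} (hA : A.IsHermitian) : (kerProj A).PosSemidef := by
  refine cfun_posSemidef hA fun i => ?_
  split_ifs <;> simp

lemma kerProj_of_posDef {A : Matrix n n ℂ} (hA : A.PosDef) : kerProj A = 0 := by
  have : cfun (fun _ => (0 : ℂ)) A = 0 := by rw [cfun_def hA.1]; simp
  rw [kerProj, ← this]
  exact cfun_congr hA.1 fun i => by simp [(hA.eigenvalues_pos i).ne']

lemma exists_kerProj_add_mul {A : Matrix n n ℂ} (hA : A.IsHermitian) :
    ∃ B, kerProj A + A * B = 1 := by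
  refine ⟨cfun (fun x => (x : ℂ)⁻¹) A, ?_⟩
  conv_lhs => arg 2; arg 1; rw [← cfun_ofReal hA]
  rw [cfun_mul_cfun hA, kerProj, cfun_add_cfun hA, ← cfun_one hA]
  refine cfun_congr hA fun i => ?_
  by_cases h : hA.eigenvalues i = 0
  · simp [h]
  · simp [h]

lemma mem_supp_iff {A : Matrix n n ℂ} (hA : A.IsHermitian) (x : n → ℂ) :
    x ∈ supp A ↔ kerProj A *ᵥ x = 0 := by
  constructor
  · rintro ⟨y, rfl⟩
    rw [mulVecLin_apply, mulVec_mulVec, kerProj_mul_self hA, zero_mulVec]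
  · intro h
    obtain ⟨B, hB⟩ := exists_kerProj_add_mul hA
    refine ⟨B *ᵥ x, ?_⟩
    rw [mulVecLin_apply, mulVec_mulVec]
    conv_rhs => rw [← one_mulVec x, ← hB, add_mulVec, h, zero_add]

lemma supp_le_supp_iff {A M : Matrix n n ℂ} (hA : A.IsHermitian) :
    supp M ≤ supp A ↔ kerProj A * M = 0 := by
  constructor
  · intro h
    refine ext_of_mulVec_single fun i => ?_
    rw [← mulVec_mulVec, zero_mulVec]
    exact (mem_supp_iff hA _).mp (h ⟨_, rfl⟩)
  · rintro h _ ⟨y, rfl⟩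
    rw [mem_supp_iff hA, mulVecLin_apply, mulVec_mulVec, h, zero_mulVec]

lemma kerProj_one_kronecker {A : Matrix n n ℂ} (hA : A.IsHermitian) :
    kerProj ((1 : Matrix e e ℂ) ⊗ₖ A) = (1 : Matrix e e ℂ) ⊗ₖ kerProj A :=
  cfun_one_kronecker hA _

/-- The support condition of the divergence, read off the blocks of the purification. -/
lemma supp_stackRows_le_iff (X : e → Matrix n d ℂ) {σ : Matrix n n ℂ} (hσ : σ.IsHermitian) :
    supp (stackRows X * (stackRows X)ᴴ) ≤ supp ((1 : Matrix e e ℂ) ⊗ₖ σ) ↔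
      ∀ i, kerProj σ * X i = 0 := by
  rw [supp_le_supp_iff (isHermitian_one_kronecker hσ), mul_self_mul_conjTranspose_eq_zero,
    kerProj_one_kronecker hσ, kronecker_mul_stackRows]
  constructor
  · intro h i
    ext j k
    exact congrFun₂ h (i, j) k
  · intro h
    ext ⟨i, j⟩ k
    exact congrFun₂ (h i) j k

/-- The matrix `A` made positive definite by putting `δ` on its kernel. -/
def fillKer (A : Matrix n n ℂ) (δ : ℝ) : Matrix n n ℂ :=
  A + (δ : ℂ) • kerProj A

lemma fillKer_eq_cfun {A : Matrix n n ℂ} (hA : A.IsHermitian) (δ : ℝ) :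
    fillKer A δ = cfun (fun x => ((if x = 0 then δ else x : ℝ) : ℂ)) A := by
  rw [fillKer, kerProj, smul_cfun hA]
  conv_lhs => arg 1; rw [← cfun_ofReal hA]
  rw [cfun_add_cfun hA]
  refine cfun_congr hA fun i => ?_
  by_cases h : hA.eigenvalues i = 0 <;> simp [h]

lemma fillKer_posDef {A : Matrix n n ℂ} (hA : A.PosSemidef) {δ : ℝ} (hδ : 0 < δ) :
    (fillKer A δ).PosDef := by
  rw [fillKer_eq_cfun hA.1]
  refine cfun_posDef hA.1 fun i => ?_
  by_cases h : hA.1.eigenvalues i = 0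
  · simpa [h] using hδ
  · simpa [h] using (hA.eigenvalues_nonneg i).lt_of_ne' h

lemma mpow_fillKer {A : Matrix n n ℂ} (hA : A.PosSemidef) (δ : ℝ) {s : ℝ} (hs : s ≠ 0) :
    mpow (fillKer A δ) s = mpow A s + ((δ ^ s : ℝ) : ℂ) • kerProj A := by
  rw [mpow_eq_cfun (by rw [fillKer_eq_cfun hA.1]; exact cfun_isHermitian _ _),
    fillKer_eq_cfun hA.1, cfun_cfun hA.1 (fun x => if x = 0 then δ else x), mpow_eq_cfun hA.1,
    kerProj, smul_cfun hA.1, cfun_add_cfun hA.1]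
  refine cfun_congr hA.1 fun i => ?_
  by_cases h : hA.1.eigenvalues i = 0
  · simp [h, Real.zero_rpow hs]
  · simp [h]

lemma trace_fillKer {A : Matrix n n ℂ} (δ : ℝ) :
    (fillKer A δ).trace.re = A.trace.re + δ * (kerProj A).trace.re := by
  simp [fillKer, trace_add, trace_smul]

lemma contract_fillKer {X : e → Matrix n d ℂ} {σ : Matrix n n ℂ} (hσ : σ.PosSemidef)
    (h : ∀ i, kerProj σ * X i = 0) (δ : ℝ) {s : ℝ} (hs : s ≠ 0) :
    contract X (mpow (fillKer σ δ) s) = contract X (mpow σ s) := by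
  refine Finset.sum_congr rfl fun i _ => ?_
  rw [mpow_fillKer hσ δ hs, Matrix.mul_assoc, Matrix.add_mul, smul_mul, h, smul_zero, add_zero,
    Matrix.mul_assoc]

lemma condNorm_fillKer {X : e → Matrix n d ℂ} {σ : Matrix n n ℂ} (hσ : σ.PosSemidef)
    (h : ∀ i, kerProj σ * X i = 0) (δ : ℝ) {s : ℝ} (hs : s ≠ 0) :
    condNorm s X (fillKer σ δ) = condNorm s X σ := by
  rw [condNorm, contract_fillKer hσ h δ (neg_ne_zero.mpr hs), condNorm]

/-- For `α < 1` no support condition is needed: filling the kernel can only increase the norm. -/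
lemma condNorm_neg_le_fillKer [Nonempty d] (X : e → Matrix n d ℂ) {σ : Matrix n n ℂ}
    (hσ : σ.PosSemidef) {δ : ℝ} (hδ : 0 < δ) {u : ℝ} (hu : 0 < u) :
    condNorm (-u) X σ ≤ condNorm (-u) X (fillKer σ δ) := by
  refine le_condNorm_neg X (fillKer_posDef hσ hδ).posSemidef hu fun τ hτ => ?_
  refine (condNorm_neg_le_pairing X hσ hu hτ).trans
    (pairing_mono_left X ?_ (mpow_posSemidef hτ.1.posSemidef _))
  rw [mpow_fillKer hσ δ hu.ne', add_sub_cancel_left]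
  exact (kerProj_posSemidef hσ.1).smul (by exact_mod_cast Real.rpow_nonneg hδ.le u)

lemma condNorm_smul (X : e → Matrix n d ℂ) {S : Matrix n n ℂ} (hS : S.PosSemidef) {c : ℝ}
    (hc : 0 < c) {s : ℝ} (hs : s < 1) :
    condNorm s X ((c : ℂ) • S) = c ^ (-s) * condNorm s X S := by
  have h1 : contract X (mpow ((c : ℂ) • S) (-s)) =
      ((c ^ (-s) : ℝ) : ℂ) • contract X (mpow S (-s)) := by
    rw [mpow_smul hS hc.le, contract, contract, Finset.smul_sum]
    simp [Matrix.mul_smul, Matrix.smul_mul]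
  have hc' := Real.rpow_nonneg hc.le (-s)
  have hN := contract_posSemidef X (mpow_posSemidef hS (-s))
  rw [condNorm, h1, mpow_smul hN hc', trace_smul, smul_eq_mul, Complex.re_ofReal_mul,
    Real.mul_rpow (Real.rpow_nonneg hc' _) (trace_mpow_nonneg hN _), ← Real.rpow_mul hc',
    one_div_mul_cancel (sub_pos.mpr hs).ne', Real.rpow_one, condNorm]

lemma condNorm_pos {X : e → Matrix n d ℂ} (hX : X ≠ 0) {S : Matrix n n ℂ} (hS : S.PosDef)
    (s : ℝ) : 0 < condNorm s X S := by
  have hN := contract_posSemidef X (mpow_posSemidef hS.posSemidef (-s))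
  refine Real.rpow_pos_of_pos ((trace_mpow_nonneg hN _).lt_of_ne' fun h0 => hX ?_) _
  rw [trace_mpow hN.1, Complex.ofReal_re, Finset.sum_eq_zero_iff_of_nonneg
    fun i _ => Real.rpow_nonneg (hN.eigenvalues_nonneg i) _] at h0
  have h1 : contract X (mpow S (-s)) = 0 := hN.1.eigenvalues_eq_zero_iff.mp <| funext fun i =>
    ((Real.rpow_eq_zero_iff_of_nonneg (hN.eigenvalues_nonneg i)).mp (h0 i (Finset.mem_univ i))).1
  have h2 : (mpow S (-s / 2))ᴴ = mpow S (-s / 2) := (mpow_posDef hS _).1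
  have h3 : (stackRows fun i => mpow S (-s / 2) * X i) = 0 := by
    rw [← conjTranspose_mul_self_eq_zero, ← kronecker_mul_stackRows, conjTranspose_mul,
      conjTranspose_kronecker, conjTranspose_one, h2, Matrix.mul_assoc,
      ← Matrix.mul_assoc _ _ (stackRows X), ← mul_kronecker_mul, Matrix.one_mul,
      mpow_half_mul_half hS, ← Matrix.mul_assoc, conjTranspose_stackRows_mul, h1]
  funext i
  have h4 : mpow S (-s / 2) * X i = 0 := by
    ext j k
    exact congrFun₂ h3 (i, j) k
  have h5 : mpow S (s / 2) * (mpow S (-s / 2) * X i) = X i := by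
    rw [← Matrix.mul_assoc, mpow_mul_mpow hS, neg_div, add_neg_cancel, mpow_zero hS.1,
      Matrix.one_mul]
  rw [← h5, h4, Matrix.mul_zero]
  rfl

lemma IsDensity.normalize_fillKer [Nonempty n] {ω : Matrix n n ℂ} (hω : IsDensity ω) {δ : ℝ}
    (hδ : 0 < δ) :
    IsPosDensity ((((1 + δ * (kerProj ω).trace.re)⁻¹ : ℝ) : ℂ) • fillKer ω δ) := by
  have := isPosDensity_normalize (fillKer_posDef hω.1 hδ)
  rw [trace_fillKer, hω.2, Complex.one_re] at this
  exact_mod_cast this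

lemma trace_kerProj_nonneg {A : Matrix n n ℂ} (hA : A.IsHermitian) : 0 ≤ (kerProj A).trace.re :=
  (Complex.le_def.mp (kerProj_posSemidef hA).trace_nonneg).1

lemma tendsto_one_add_mul_rpow (k p : ℝ) :
    Filter.Tendsto (fun δ : ℝ => (1 + δ * k)⁻¹ ^ p) (nhdsWithin 0 (Set.Ioi 0)) (nhds 1) := by
  have : ContinuousAt (fun δ : ℝ => (1 + δ * k)⁻¹ ^ p) 0 :=
    ((continuousAt_const.add (continuousAt_id.mul continuousAt_const)).inv₀ (by simp)).rpow_const
      (by simp)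
  have h := this.tendsto
  simp only [zero_mul, add_zero, inv_one, Real.one_rpow] at h
  exact h.mono_left nhdsWithin_le_nhds

/-- The value bounds the norm at singular densities as well, as long as the support condition
holds: fill the kernel with `δ`, normalize, and let `δ → 0`. -/
lemma IsMinimaxValue.le_condNorm_of_isDensity [Nonempty n] [Nonempty d] {s v : ℝ}
    {X : e → Matrix n d ℂ} (hv : IsMinimaxValue s X v) (h0 : 0 < s) (h1 : s < 1)
    {ω : Matrix n n ℂ} (hω : IsDensity ω) (hX : ∀ i, kerProj ω * X i = 0) :
    v ≤ condNorm s X ω := by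
  have hlim := (tendsto_one_add_mul_rpow (kerProj ω).trace.re (-s)).mul_const (condNorm s X ω)
  rw [one_mul] at hlim
  refine ge_of_tendsto hlim (Filter.eventually_of_mem self_mem_nhdsWithin fun δ hδ => ?_)
  have hc : 0 < 1 + δ * (kerProj ω).trace.re := by
    have := mul_nonneg (le_of_lt hδ) (trace_kerProj_nonneg hω.1.1)
    linarith
  have := hv.le_condNorm h0 h1 (hω.normalize_fillKer hδ)
  rwa [condNorm_smul X (fillKer_posDef hω.1 hδ).posSemidef (inv_pos.mpr hc) h1,
    condNorm_fillKer hω.1 hX δ h0.ne'] at this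

lemma IsMinimaxValue.condNorm_neg_le_of_isDensity [Nonempty n] [Nonempty d] {u v : ℝ}
    {X : e → Matrix n d ℂ} (hv : IsMinimaxValue u (fun i => (X i)ᴴ) v) (h0 : 0 < u)
    {ω : Matrix n n ℂ} (hω : IsDensity ω) : condNorm (-u) X ω ≤ v := by
  have hlim := (tendsto_one_add_mul_rpow (kerProj ω).trace.re u).mul_const (condNorm (-u) X ω)
  rw [one_mul] at hlim
  refine le_of_tendsto hlim (Filter.eventually_of_mem self_mem_nhdsWithin fun δ hδ => ?_)
  have hc : 0 < 1 + δ * (kerProj ω).trace.re := by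
    have := mul_nonneg (le_of_lt hδ) (trace_kerProj_nonneg hω.1.1)
    linarith
  have := hv.condNorm_neg_le h0 (hω.normalize_fillKer hδ)
  rw [condNorm_smul X (fillKer_posDef hω.1 hδ).posSemidef (inv_pos.mpr hc) (by linarith),
    neg_neg] at this
  exact (mul_le_mul_of_nonneg_left (condNorm_neg_le_fillKer X hω.1 hδ h0)
    (Real.rpow_nonneg (inv_pos.mpr hc).le _)).trans this

lemma IsMinimaxValue.exists_le_condNorm_neg [Nonempty d] {u v : ℝ} {X : e → Matrix n d ℂ}
    (hv : IsMinimaxValue u (fun i => (X i)ᴴ) v) (h0 : 0 < u) {v' : ℝ} (h : v' < v) :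
    ∃ ω, IsPosDensity ω ∧ v' ≤ condNorm (-u) X ω := by
  obtain ⟨τ, hτ, h⟩ := hv.exists_ge v' h
  refine ⟨τ, hτ, le_condNorm_neg X hτ.1.posSemidef h0 fun κ hκ => ?_⟩
  rw [← pairing_conjTranspose]
  exact h κ hκ

end Support

section Entropy

variable {n d e : Type*} [Fintype n] [DecidableEq n] [Fintype d] [DecidableEq d]
  [Fintype e] [DecidableEq e]

lemma sandwichedTrace_eq {α : ℝ} (hα0 : α ≠ 0) (hα1 : α ≠ 1) (X : e → Matrix n d ℂ)
    {σ : Matrix n n ℂ} (hσ : σ.PosSemidef) :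
    sandwichedTrace α (stackRows X * (stackRows X)ᴴ) ((1 : Matrix e e ℂ) ⊗ₖ σ) =
      (mpow (contract X (mpow σ (-((α - 1) / α)))) α).trace.re := by
  set s := (α - 1) / α with hs
  have hs0 : s ≠ 0 := div_ne_zero (sub_ne_zero.mpr hα1) hα0
  have hH : (mpow σ (-s / 2))ᴴ = mpow σ (-s / 2) := (mpow_posSemidef hσ _).1
  have h : mpow ((1 : Matrix e e ℂ) ⊗ₖ σ) (-s / 2) * (stackRows X * (stackRows X)ᴴ) *
      mpow ((1 : Matrix e e ℂ) ⊗ₖ σ) (-s / 2) =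
      (((1 : Matrix e e ℂ) ⊗ₖ mpow σ (-s / 2)) * stackRows X) *
        (((1 : Matrix e e ℂ) ⊗ₖ mpow σ (-s / 2)) * stackRows X)ᴴ := by
    rw [mpow_one_kronecker hσ.1, conjTranspose_mul, conjTranspose_kronecker, conjTranspose_one, hH]
    simp only [Matrix.mul_assoc]
  rw [sandwichedTrace, ← hs, h, trace_mpow_mul_conjTranspose _ hα0, conjTranspose_mul,
    conjTranspose_kronecker, conjTranspose_one, hH, Matrix.mul_assoc,
    ← Matrix.mul_assoc _ _ (stackRows X), ← mul_kronecker_mul, Matrix.one_mul,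
    mpow_mul_mpow_of_posSemidef hσ (by simpa using hs0), add_halves, ← Matrix.mul_assoc,
    conjTranspose_stackRows_mul]

lemma elog_rpow {x p : ℝ} (hx : 0 ≤ x) (hp : 0 < p) : elog (x ^ p) = (p : EReal) * elog x := by
  rcases hx.eq_or_lt with rfl | hx
  · rw [Real.zero_rpow hp.ne', elog, if_pos rfl, EReal.coe_mul_bot_of_pos hp]
  · rw [elog, if_neg (Real.rpow_pos_of_pos hx p).ne', elog, if_neg hx.ne',
      Real.logb_rpow_eq_mul_logb_of_pos hx, EReal.coe_mul]

/-- For `α < 1` both sides are `⊤` when the norm vanishes, the factor of `elog 0 = ⊥` being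
negative. -/
lemma divergence_eq {α : ℝ} (hα0 : 0 < α) (hα1 : α ≠ 1) {X : e → Matrix n d ℂ}
    (hX : (stackRows X * (stackRows X)ᴴ).trace = 1) {σ : Matrix n n ℂ} (hσ : σ.PosSemidef)
    (h : 1 < α → ∀ i, kerProj σ * X i = 0) :
    divergence α (stackRows X * (stackRows X)ᴴ) ((1 : Matrix e e ℂ) ⊗ₖ σ) =
      ((1 / ((α - 1) / α) : ℝ) : EReal) * elog (condNorm ((α - 1) / α) X σ) := by
  have hs : 1 - (α - 1) / α = 1 / α := by field_simp; ring
  have hN := contract_posSemidef X (mpow_posSemidef hσ (-((α - 1) / α)))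
  rw [divergence, if_neg, hX, Complex.one_re, div_one, one_mul, sandwichedTrace_eq hα0.ne' hα1 X hσ,
    condNorm, hs, one_div_one_div, elog_rpow (trace_mpow_nonneg hN _) (by positivity), ← mul_assoc,
    ← EReal.coe_mul]
  · congr 2
    have := sub_ne_zero.mpr hα1
    field_simp
  · rw [supp_stackRows_le_iff X hσ.1]
    exact fun ⟨h1, h2⟩ => h2 (h h1)

lemma ne_zero_of_trace {X : e → Matrix n d ℂ}
    (hX : (stackRows X * (stackRows X)ᴴ).trace = 1) : X ≠ 0 := by
  rintro rfl
  have : stackRows (0 : e → Matrix n d ℂ) = 0 := rfl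
  simp [this] at hX

/-- Under the support condition `σ` may be replaced by a positive definite matrix, so that the norm
is positive and the entropy finite. -/
lemma condEntropyRel_eq {α : ℝ} (hα0 : 0 < α) (hα1 : α ≠ 1) {X : e → Matrix n d ℂ}
    (hX : (stackRows X * (stackRows X)ᴴ).trace = 1) {σ : Matrix n n ℂ} (hσ : σ.PosSemidef)
    (h : ∀ i, kerProj σ * X i = 0) :
    condEntropyRel α (stackRows X * (stackRows X)ᴴ) σ =
      ((-(1 / ((α - 1) / α) * Real.logb 2 (condNorm ((α - 1) / α) X (fillKer σ 1))) : ℝ) :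
        EReal) := by
  rw [condEntropyRel, divergence_eq hα0 hα1 hX hσ fun _ => h, ← condNorm_fillKer hσ h 1
    (div_ne_zero (sub_ne_zero.mpr hα1) hα0.ne'), elog,
    if_neg (condNorm_pos (ne_zero_of_trace hX) (fillKer_posDef hσ one_pos) _).ne', ← EReal.coe_mul,
    ← EReal.coe_neg]

lemma condEntropyRel_eq_bot {α : ℝ} (hα1 : 1 < α) {X : e → Matrix n d ℂ} {σ : Matrix n n ℂ}
    (hσ : σ.PosSemidef) (h : ¬ ∀ i, kerProj σ * X i = 0) :
    condEntropyRel α (stackRows X * (stackRows X)ᴴ) σ = ⊥ := by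
  rw [condEntropyRel, divergence, if_pos ⟨hα1, by rwa [supp_stackRows_le_iff X hσ.1]⟩,
    EReal.neg_top]

lemma condEntropy_of_one_lt [Nonempty n] [Nonempty d] {α : ℝ} (hα : 1 < α)
    {X : e → Matrix n d ℂ} (hX : (stackRows X * (stackRows X)ᴴ).trace = 1) {v : ℝ}
    (hv : IsMinimaxValue ((α - 1) / α) X v) :
    condEntropy α (stackRows X * (stackRows X)ᴴ) =
      ((-(1 / ((α - 1) / α) * Real.logb 2 v) : ℝ) : EReal) := by
  have hα0 : 0 < α := by linarith
  set s := (α - 1) / α with hs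
  have hs0 : 0 < s := div_pos (by linarith) hα0
  have hs1 : s < 1 := by rw [hs, div_lt_one hα0]; linarith
  rw [condEntropy, EReal.coe_neg, neg_inj]
  refine le_antisymm ?_ (le_iInf₂ fun ω hω => ?_)
  · refine EReal.le_of_forall_lt_iff_le.mp fun z hz => ?_
    have hz' : v < 2 ^ (s * z) := by
      rw [← Real.logb_lt_iff_lt_rpow (by norm_num) hv.pos, mul_comm, ← div_lt_iff₀ hs0,
        div_eq_mul_one_div, mul_comm]
      exact_mod_cast hz
    obtain ⟨ω, hω, hle⟩ := hv.exists_condNorm_le hs0 hs1 hz'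
    refine (iInf₂_le ω hω.isDensity).trans ?_
    rw [divergence_eq hα0 hα.ne' hX hω.1.posSemidef fun _ i => by
      rw [kerProj_of_posDef hω.1, Matrix.zero_mul], ← hs]
    have hpos := hv.pos.trans_le (hv.le_condNorm hs0 hs1 hω)
    rw [elog, if_neg hpos.ne', ← EReal.coe_mul, EReal.coe_le_coe_iff, one_div,
      inv_mul_le_iff₀ hs0]
    exact (Real.logb_le_iff_le_rpow (by norm_num) hpos).mpr hle
  · by_cases h : ∀ i, kerProj ω * X i = 0
    · rw [divergence_eq hα0 hα.ne' hX hω.1 fun _ => h, ← hs]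
      have hle := hv.le_condNorm_of_isDensity hs0 hs1 hω h
      rw [elog, if_neg (hv.pos.trans_le hle).ne', ← EReal.coe_mul, EReal.coe_le_coe_iff]
      exact mul_le_mul_of_nonneg_left (Real.logb_le_logb_of_le (by norm_num) hv.pos hle)
        (by positivity)
    · rw [divergence, if_pos ⟨hα, by rwa [supp_stackRows_le_iff X hω.1.1]⟩]
      exact le_top

lemma condEntropy_of_lt_one [Nonempty n] [Nonempty d] {α : ℝ} (hα0 : 0 < α) (hα : α < 1)
    {X : e → Matrix n d ℂ} (hX : (stackRows X * (stackRows X)ᴴ).trace = 1) {v : ℝ}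
    (hv : IsMinimaxValue ((1 - α) / α) (fun i => (X i)ᴴ) v) :
    condEntropy α (stackRows X * (stackRows X)ᴴ) =
      ((1 / ((1 - α) / α) * Real.logb 2 v : ℝ) : EReal) := by
  have hs : (α - 1) / α = -((1 - α) / α) := by ring
  set u := (1 - α) / α with hu
  have hu0 : 0 < u := div_pos (by linarith) hα0
  rw [condEntropy, neg_eq_iff_eq_neg, ← EReal.coe_neg]
  refine le_antisymm ?_ (le_iInf₂ fun ω hω => ?_)
  · refine EReal.le_of_forall_lt_iff_le.mp fun z hz => ?_
    have hz' : 2 ^ (-(u * z)) < v := by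
      rw [← Real.lt_logb_iff_rpow_lt (by norm_num) hv.pos, neg_lt, ← div_lt_iff₀' hu0,
        div_eq_mul_one_div, neg_mul, mul_comm]
      exact_mod_cast hz
    obtain ⟨ω, hω, hle⟩ := hv.exists_le_condNorm_neg hu0 hz'
    refine (iInf₂_le ω hω.isDensity).trans ?_
    rw [divergence_eq hα0 hα.ne hX hω.1.posSemidef fun h => absurd h hα.not_gt, hs]
    have hpos := (Real.rpow_pos_of_pos (by norm_num) _).trans_le hle
    rw [elog, if_neg hpos.ne', ← EReal.coe_mul, EReal.coe_le_coe_iff, one_div, inv_neg, neg_mul,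
      neg_le, le_inv_mul_iff₀ hu0, mul_neg]
    exact (Real.le_logb_iff_rpow_le (by norm_num) hpos).mpr hle
  · rw [divergence_eq hα0 hα.ne hX hω.1 fun h => absurd h hα.not_gt, hs]
    have hle := hv.condNorm_neg_le_of_isDensity hu0 hω
    by_cases h : condNorm (-u) X ω = 0
    · rw [h, elog, if_pos rfl, EReal.coe_mul_bot_of_neg (by
        rw [one_div, inv_neg, neg_lt_zero]; positivity)]
      exact le_top
    · rw [elog, if_neg h, ← EReal.coe_mul, EReal.coe_le_coe_iff, one_div, one_div, inv_neg, neg_mul,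
        neg_le_neg_iff]
      exact mul_le_mul_of_nonneg_left (Real.logb_le_logb_of_le (by norm_num)
        ((condNorm_nonneg _ _ hω.1).lt_of_ne' h) hle) (by positivity)

end Entropy

/-! ### The chain rule for the entropies of a pure state -/

section Purification

variable {a b c d : Type*} [Fintype a] [DecidableEq a] [Fintype b] [DecidableEq b]
  [Fintype c] [DecidableEq c] [Fintype d] [DecidableEq d]

/-- Every density operator is the `a`, `b`, `c` marginal of a pure state, whose amplitudes are the
entries of its square root. -/
lemma IsDensity.exists_purification {ρ : Matrix (a × b × c) (a × b × c) ℂ} (hρ : IsDensity ρ) :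
    ∃ ψ : a → b → c → (a × b × c) → ℂ,
      ρ = stackRows (familyA ψ) * (stackRows (familyA ψ))ᴴ := by
  refine ⟨fun i j k l => mpow ρ (1 / 2) (i, j, k) l, ?_⟩
  have h : stackRows (familyA fun i j k l => mpow ρ (1 / 2) (i, j, k) l) = mpow ρ (1 / 2) := rfl
  rw [h, (mpow_posSemidef hρ.1 _).1, mpow_mul_mpow_of_posSemidef hρ.1 (by norm_num), add_halves,
    mpow_one hρ.1.1]

lemma regroup_stackRows (ψ : a → b → c → d → ℂ) :
    regroup (stackRows (familyA ψ) * (stackRows (familyA ψ))ᴴ) =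
      stackRows (familyAB ψ) * (stackRows (familyAB ψ))ᴴ :=
  rfl

lemma traceFst_stackRows (ψ : a → b → c → d → ℂ) :
    traceFst (stackRows (familyA ψ) * (stackRows (familyA ψ))ᴴ) =
      stackRows (familyB ψ) * (stackRows (familyB ψ))ᴴ := by
  ext ⟨j, k⟩ ⟨j', k'⟩
  simp [traceFst, mul_apply, stackRows, familyA, familyB, Fintype.sum_prod_type]

lemma trace_regroup (ρ : Matrix (a × b × c) (a × b × c) ℂ) : (regroup ρ).trace = ρ.trace :=
  Equiv.sum_comp (Equiv.prodAssoc a b c) fun p => ρ p p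

lemma trace_traceFst (ρ : Matrix (a × b) (a × b) ℂ) : (traceFst ρ).trace = ρ.trace := by
  simp only [trace, diag, traceFst, Fintype.sum_prod_type, of_apply]
  exact Finset.sum_comm

lemma kerProj_mul_familyB_iff (ψ : a → b → c → d → ℂ) (P : Matrix c c ℂ) :
    (∀ j, P * familyB ψ j = 0) ↔ ∀ p, P * familyAB ψ p = 0 := by
  constructor
  · rintro h ⟨i, j⟩
    ext k l
    exact congrFun₂ (h j) k (i, l)
  · intro h j
    ext k ⟨i, l⟩
    exact congrFun₂ (h (i, j)) k l

/-- The conjugate state in which `a` and `b`, and also `c` and `d`, exchange roles. Since its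
families are the conjugate transposes of those of `ψ`, it turns parameters below `1` into parameters
above `1`. -/
def dualState (ψ : a → b → c → d → ℂ) : b → a → d → c → ℂ :=
  fun j i l k => star (ψ i j k l)

lemma familyA_dualState (ψ : a → b → c → d → ℂ) :
    familyA (dualState ψ) = fun j => (familyB ψ j)ᴴ := rfl

lemma familyB_dualState (ψ : a → b → c → d → ℂ) :
    familyB (dualState ψ) = fun i => (familyA ψ i)ᴴ := rfl

lemma nonempty_of_trace_eq_one {n : Type*} [Fintype n] {M : Matrix n n ℂ} (h : M.trace = 1) :
    Nonempty n := by
  by_contra hn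
  rw [not_nonempty_iff] at hn
  simp [trace] at h

end Purification

section ChainRule

variable {n d e : Type*} [Fintype n] [DecidableEq n] [Fintype d] [DecidableEq d]
  [Fintype e] [DecidableEq e]

lemma exists_condEntropy_of_one_lt [Nonempty n] [Nonempty d] {α : ℝ} (hα : 1 < α)
    {X : e → Matrix n d ℂ} (hX : (stackRows X * (stackRows X)ᴴ).trace = 1) :
    ∃ v, IsMinimaxValue ((α - 1) / α) X v ∧ condEntropy α (stackRows X * (stackRows X)ᴴ) =
      ((-(1 / ((α - 1) / α) * Real.logb 2 v) : ℝ) : EReal) := by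
  have hα0 : 0 < α := by linarith
  obtain ⟨v, hv⟩ := exists_isMinimaxValue (s := (α - 1) / α) (div_pos (by linarith) hα0)
    (by rw [div_lt_one hα0]; linarith) (ne_zero_of_trace hX)
  exact ⟨v, hv, condEntropy_of_one_lt hα hX hv⟩

lemma exists_condEntropy_of_lt_one [Nonempty n] [Nonempty d] {α : ℝ} (hα0 : 1 / 2 < α)
    (hα : α < 1) {X : e → Matrix n d ℂ} (hX : (stackRows X * (stackRows X)ᴴ).trace = 1) :
    ∃ v, IsMinimaxValue ((1 - α) / α) (fun i => (X i)ᴴ) v ∧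
      condEntropy α (stackRows X * (stackRows X)ᴴ) =
        ((1 / ((1 - α) / α) * Real.logb 2 v : ℝ) : EReal) := by
  have hα0' : 0 < α := by linarith
  obtain ⟨v, hv⟩ := exists_isMinimaxValue (s := (1 - α) / α) (div_pos (by linarith) hα0')
    (by rw [div_lt_one hα0']; linarith) (X := fun i => (X i)ᴴ) fun h =>
      ne_zero_of_trace hX (funext fun i => conjTranspose_eq_zero.mp (congrFun h i))
  exact ⟨v, hv, condEntropy_of_lt_one hα0' hα hX hv⟩

variable {a b c d : Type*} [Fintype a] [DecidableEq a] [Fintype b] [DecidableEq b]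
  [Fintype c] [DecidableEq c] [Fintype d] [DecidableEq d]
  [Nonempty a] [Nonempty b] [Nonempty c] [Nonempty d]

lemma param_pos {α : ℝ} (hα : 1 < α) : 0 < (α - 1) / α ∧ (α - 1) / α < 1 := by
  have h0 : 0 < α := by linarith
  exact ⟨div_pos (by linarith) h0, by rw [div_lt_one h0]; linarith⟩

lemma param_neg {α : ℝ} (h0 : 1 / 2 < α) (h1 : α < 1) : 0 < (1 - α) / α ∧ (1 - α) / α < 1 := by
  have h0' : 0 < α := by linarith
  exact ⟨div_pos (by linarith) h0', by rw [div_lt_one h0']; linarith⟩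

lemma one_div_param (α : ℝ) :
    1 / ((α - 1) / α) = α / (α - 1) ∧ 1 / ((1 - α) / α) = -(α / (α - 1)) := by
  rw [one_div_div, one_div_div, ← neg_sub α 1, div_neg]
  exact ⟨rfl, rfl⟩

variable {ψ : a → b → c → d → ℂ} {α β γ : ℝ}

lemma params_eq (h : α / (α - 1) = β / (β - 1) + γ / (γ - 1)) :
    1 / ((α - 1) / α) = 1 / ((β - 1) / β) + 1 / ((γ - 1) / γ) := by
  rw [(one_div_param α).1, (one_div_param β).1, (one_div_param γ).1, h]

/-- The eight sign patterns of the parameters. The hypothesis `h` excludes two of them, and the three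
with `α < 1` are treated through `dualState`, which exchanges `β` and `γ`. -/
theorem condEntropy_chain (hA : (stackRows (familyA ψ) * (stackRows (familyA ψ))ᴴ).trace = 1)
    (hB : (stackRows (familyB ψ) * (stackRows (familyB ψ))ᴴ).trace = 1)
    (hAB : (stackRows (familyAB ψ) * (stackRows (familyAB ψ))ᴴ).trace = 1)
    (hα : α ∈ Set.Ioo (1 / 2 : ℝ) 1 ∪ Set.Ioi 1) (hβ : β ∈ Set.Ioo (1 / 2 : ℝ) 1 ∪ Set.Ioi 1)
    (hγ : γ ∈ Set.Ioo (1 / 2 : ℝ) 1 ∪ Set.Ioi 1)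
    (h : α / (α - 1) = β / (β - 1) + γ / (γ - 1)) :
    (0 < (α - 1) * (β - 1) * (γ - 1) →
      condEntropy β (stackRows (familyA ψ) * (stackRows (familyA ψ))ᴴ) +
        condEntropy γ (stackRows (familyB ψ) * (stackRows (familyB ψ))ᴴ) ≤
          condEntropy α (stackRows (familyAB ψ) * (stackRows (familyAB ψ))ᴴ)) ∧
    ((α - 1) * (β - 1) * (γ - 1) < 0 →
      condEntropy α (stackRows (familyAB ψ) * (stackRows (familyAB ψ))ᴴ) ≤
        condEntropy β (stackRows (familyA ψ) * (stackRows (familyA ψ))ᴴ) +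
          condEntropy γ (stackRows (familyB ψ) * (stackRows (familyB ψ))ᴴ)) := by
  have hp := one_div_param
  rcases hα with ⟨hα0, hα1⟩ | (hα : 1 < α) <;> rcases hβ with ⟨hβ0, hβ1⟩ | (hβ : 1 < β) <;>
    rcases hγ with ⟨hγ0, hγ1⟩ | (hγ : 1 < γ)
  · obtain ⟨x, hx, hxe⟩ := exists_condEntropy_of_lt_one hα0 hα1 hAB
    obtain ⟨y, hy, hye⟩ := exists_condEntropy_of_lt_one hβ0 hβ1 hA
    obtain ⟨z, hz, hze⟩ := exists_condEntropy_of_lt_one hγ0 hγ1 hB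
    refine ⟨fun hpos => absurd hpos (not_lt.mpr ?_), fun _ => ?_⟩
    · have := mul_pos (mul_pos (sub_pos.mpr hα1) (sub_pos.mpr hβ1)) (sub_pos.mpr hγ1)
      nlinarith
    · have := IsMinimaxValue.chain_pos (ψ := dualState ψ) (param_neg hα0 hα1).1
        (param_neg hα0 hα1).2 (param_neg hγ0 hγ1).1 (param_neg hγ0 hγ1).2 (param_neg hβ0 hβ1).1
        (param_neg hβ0 hβ1).2 (by rw [(hp α).2, (hp β).2, (hp γ).2, h]; ring)
        (hx.reindex (Equiv.prodComm b a)) hz hy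
      rw [hxe, hye, hze, ← EReal.coe_add, EReal.coe_le_coe_iff]
      linarith
  · obtain ⟨x, hx, hxe⟩ := exists_condEntropy_of_lt_one hα0 hα1 hAB
    obtain ⟨y, hy, hye⟩ := exists_condEntropy_of_lt_one hβ0 hβ1 hA
    obtain ⟨z, hz, hze⟩ := exists_condEntropy_of_one_lt hγ hB
    refine ⟨fun _ => ?_, fun hneg => absurd hneg (not_lt.mpr ?_)⟩
    · have := IsMinimaxValue.chain_left_neg (ψ := dualState ψ) (param_neg hα0 hα1).1
        (param_neg hα0 hα1).2 (param_pos hγ).1 (param_pos hγ).2 (param_neg hβ0 hβ1).1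
        (param_neg hβ0 hβ1).2 (by rw [(hp α).2, (hp β).2, (hp γ).1, h]; ring)
        (hx.reindex (Equiv.prodComm b a)) (by simpa [familyA_dualState] using hz) hy
      rw [hxe, hye, hze, ← EReal.coe_add, EReal.coe_le_coe_iff]
      linarith
    · have := mul_pos (mul_pos (sub_pos.mpr hα1) (sub_pos.mpr hβ1)) (sub_pos.mpr hγ)
      nlinarith
  · obtain ⟨x, hx, hxe⟩ := exists_condEntropy_of_lt_one hα0 hα1 hAB
    obtain ⟨y, hy, hye⟩ := exists_condEntropy_of_one_lt hβ hA
    obtain ⟨z, hz, hze⟩ := exists_condEntropy_of_lt_one hγ0 hγ1 hB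
    refine ⟨fun _ => ?_, fun hneg => absurd hneg (not_lt.mpr ?_)⟩
    · have := IsMinimaxValue.chain_right_neg (ψ := dualState ψ) (param_neg hα0 hα1).1
        (param_neg hα0 hα1).2 (param_neg hγ0 hγ1).1 (param_pos hβ).1 (param_pos hβ).2
        (by rw [(hp α).2, (hp β).1, (hp γ).2, h]; ring)
        (hx.reindex (Equiv.prodComm b a)) hz (by simpa [familyB_dualState] using hy)
      rw [hxe, hye, hze, ← EReal.coe_add, EReal.coe_le_coe_iff]
      linarith
    · have := mul_pos (mul_pos (sub_pos.mpr hα1) (sub_pos.mpr hβ)) (sub_pos.mpr hγ1)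
      nlinarith
  · have h1 := div_neg_of_pos_of_neg (a := α) (by linarith) (sub_neg.mpr hα1)
    have h2 := div_pos (a := β) (by linarith) (sub_pos.mpr hβ)
    have h3 := div_pos (a := γ) (by linarith) (sub_pos.mpr hγ)
    linarith
  · have h1 := div_pos (a := α) (by linarith) (sub_pos.mpr hα)
    have h2 := div_neg_of_pos_of_neg (a := β) (by linarith) (sub_neg.mpr hβ1)
    have h3 := div_neg_of_pos_of_neg (a := γ) (by linarith) (sub_neg.mpr hγ1)
    linarith
  · obtain ⟨x, hx, hxe⟩ := exists_condEntropy_of_one_lt hα hAB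
    obtain ⟨y, hy, hye⟩ := exists_condEntropy_of_lt_one hβ0 hβ1 hA
    obtain ⟨z, hz, hze⟩ := exists_condEntropy_of_one_lt hγ hB
    refine ⟨fun hpos => absurd hpos (not_lt.mpr ?_), fun _ => ?_⟩
    · have := mul_pos (mul_pos (sub_pos.mpr hα) (sub_pos.mpr hβ1)) (sub_pos.mpr hγ)
      nlinarith
    · have := hx.chain_left_neg (param_pos hα).1 (param_pos hα).2 (param_neg hβ0 hβ1).1
        (param_neg hβ0 hβ1).2 (param_pos hγ).1 (param_pos hγ).2
        (by rw [(hp α).1, (hp β).2, (hp γ).1, h]; ring) hy hz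
      rw [hxe, hye, hze, ← EReal.coe_add, EReal.coe_le_coe_iff]
      linarith
  · obtain ⟨x, hx, hxe⟩ := exists_condEntropy_of_one_lt hα hAB
    obtain ⟨y, hy, hye⟩ := exists_condEntropy_of_one_lt hβ hA
    obtain ⟨z, hz, hze⟩ := exists_condEntropy_of_lt_one hγ0 hγ1 hB
    refine ⟨fun hpos => absurd hpos (not_lt.mpr ?_), fun _ => ?_⟩
    · have := mul_pos (mul_pos (sub_pos.mpr hα) (sub_pos.mpr hβ)) (sub_pos.mpr hγ1)
      nlinarith
    · have := hx.chain_right_neg (param_pos hα).1 (param_pos hα).2 (param_pos hβ).1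
        (param_neg hγ0 hγ1).1 (param_neg hγ0 hγ1).2
        (by rw [(hp α).1, (hp β).1, (hp γ).2, h]; ring) hy hz
      rw [hxe, hye, hze, ← EReal.coe_add, EReal.coe_le_coe_iff]
      linarith
  · obtain ⟨x, hx, hxe⟩ := exists_condEntropy_of_one_lt hα hAB
    obtain ⟨y, hy, hye⟩ := exists_condEntropy_of_one_lt hβ hA
    obtain ⟨z, hz, hze⟩ := exists_condEntropy_of_one_lt hγ hB
    refine ⟨fun _ => ?_, fun hneg => absurd hneg (not_lt.mpr ?_)⟩
    · have := hx.chain_pos (param_pos hα).1 (param_pos hα).2 (param_pos hβ).1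
        (param_pos hβ).2 (param_pos hγ).1 (param_pos hγ).2 (params_eq h) hy hz
      rw [hxe, hye, hze, ← EReal.coe_add, EReal.coe_le_coe_iff]
      linarith
    · have := mul_pos (mul_pos (sub_pos.mpr hα) (sub_pos.mpr hβ)) (sub_pos.mpr hγ)
      linarith

/-- The chain rule with a fixed operator on `c`. In the first case the hypothesis `h` forces `γ > 1`,
so a failure of the support condition makes both relative entropies `⊥`. -/
theorem condEntropyRel_chain (hA : (stackRows (familyA ψ) * (stackRows (familyA ψ))ᴴ).trace = 1)
    (hB : (stackRows (familyB ψ) * (stackRows (familyB ψ))ᴴ).trace = 1)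
    (hAB : (stackRows (familyAB ψ) * (stackRows (familyAB ψ))ᴴ).trace = 1)
    (hα : 1 < α) (hβ : β ∈ Set.Ioo (1 / 2 : ℝ) 1 ∪ Set.Ioi 1)
    (hγ : γ ∈ Set.Ioo (1 / 2 : ℝ) 1 ∪ Set.Ioi 1)
    (h : α / (α - 1) = β / (β - 1) + γ / (γ - 1)) {σ : Matrix c c ℂ} (hσ : σ.PosSemidef) :
    (0 < (α - 1) * (β - 1) * (γ - 1) →
      condEntropy β (stackRows (familyA ψ) * (stackRows (familyA ψ))ᴴ) +
        condEntropyRel γ (stackRows (familyB ψ) * (stackRows (familyB ψ))ᴴ) σ ≤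
          condEntropyRel α (stackRows (familyAB ψ) * (stackRows (familyAB ψ))ᴴ) σ) ∧
    ((α - 1) * (β - 1) * (γ - 1) < 0 →
      condEntropyRel α (stackRows (familyAB ψ) * (stackRows (familyAB ψ))ᴴ) σ ≤
        condEntropy β (stackRows (familyA ψ) * (stackRows (familyA ψ))ᴴ) +
          condEntropyRel γ (stackRows (familyB ψ) * (stackRows (familyB ψ))ᴴ) σ) := by
  have hp := one_div_param
  have hα0 : 0 < α := by linarith
  by_cases hs : ∀ p, kerProj σ * familyAB ψ p = 0
  swap
  · refine ⟨fun hpos => ?_, fun _ => ?_⟩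
    · have hγ1 : 1 < γ := by
        rcases hγ with ⟨hγ0, hγ1⟩ | hγ
        · exfalso
          have h1 := div_pos (a := α) (by linarith) (sub_pos.mpr hα)
          have h3 := div_neg_of_pos_of_neg (a := γ) (by linarith) (sub_neg.mpr hγ1)
          rcases hβ with ⟨hβ0, hβ1⟩ | hβ
          · have h2 := div_neg_of_pos_of_neg (a := β) (by linarith) (sub_neg.mpr hβ1)
            linarith
          · have := mul_pos (mul_pos (sub_pos.mpr hα) (sub_pos.mpr hβ)) (sub_pos.mpr hγ1)
            nlinarith
        · exact hγ
      rw [condEntropyRel_eq_bot hγ1 hσ (by rwa [kerProj_mul_familyB_iff]), EReal.add_bot]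
      exact bot_le
    · rw [condEntropyRel_eq_bot hα hσ hs]
      exact bot_le
  have hs' := (kerProj_mul_familyB_iff ψ _).mpr hs
  have hS := fillKer_posDef hσ one_pos
  have hγ0 : 0 < γ := by
    rcases hγ with hγ | hγ
    · linarith [hγ.1]
    · exact one_pos.trans hγ
  have hγ1 : γ ≠ 1 := by
    rcases hγ with hγ | hγ
    · exact hγ.2.ne
    · exact (Set.mem_Ioi.mp hγ).ne'
  have hxe := condEntropyRel_eq hα0 hα.ne' hAB hσ hs
  have hze := condEntropyRel_eq hγ0 hγ1 hB hσ hs'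
  have hx := condNorm_pos (ne_zero_of_trace hAB) hS ((α - 1) / α)
  have hz := condNorm_pos (ne_zero_of_trace hB) hS ((γ - 1) / γ)
  rcases hβ with ⟨hβ0, hβ1⟩ | (hβ : 1 < β) <;>
    rcases hγ with ⟨hγ0, hγ1⟩ | (hγ : 1 < γ)
  · have h1 := div_pos (a := α) (by linarith) (sub_pos.mpr hα)
    have h2 := div_neg_of_pos_of_neg (a := β) (by linarith) (sub_neg.mpr hβ1)
    have h3 := div_neg_of_pos_of_neg (a := γ) (by linarith) (sub_neg.mpr hγ1)
    linarith
  · obtain ⟨y, hy, hye⟩ := exists_condEntropy_of_lt_one hβ0 hβ1 hA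
    refine ⟨fun hpos => absurd hpos (not_lt.mpr ?_), fun _ => ?_⟩
    · have := mul_pos (mul_pos (sub_pos.mpr hα) (sub_pos.mpr hβ1)) (sub_pos.mpr hγ)
      nlinarith
    · have := log_le_of_le_rpow_mul_rpow hz hx hy.pos (param_pos hγ).1
        (condNorm_le_of_neg hS (param_pos hα).1 (param_pos hα).2 (param_neg hβ0 hβ1).1
          (param_neg hβ0 hβ1).2 (param_pos hγ).1 (param_pos hγ).2
          (by rw [(hp α).1, (hp β).2, (hp γ).1, h]; ring) hy)
      rw [hxe, hye, hze, ← EReal.coe_add, EReal.coe_le_coe_iff]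
      linarith
  · obtain ⟨y, hy, hye⟩ := exists_condEntropy_of_one_lt hβ hA
    refine ⟨fun hpos => absurd hpos (not_lt.mpr ?_), fun _ => ?_⟩
    · have := mul_pos (mul_pos (sub_pos.mpr hα) (sub_pos.mpr hβ)) (sub_pos.mpr hγ1)
      nlinarith
    · have hn : (γ - 1) / γ = -((1 - γ) / γ) := by ring
      rw [hn] at hz hze
      have := log_le_of_le_rpow_mul_rpow hy.pos hz hx (param_pos hβ).1
        (le_condNorm_neg_mul hS (param_pos hα).1 (param_pos hα).2 (param_pos hβ).1
          (param_neg hγ0 hγ1).1 (param_neg hγ0 hγ1).2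
          (by rw [(hp α).1, (hp β).1, (hp γ).2, h]; ring) hy)
      rw [hxe, hye, hze, ← EReal.coe_add, EReal.coe_le_coe_iff, one_div (-((1 - γ) / γ)), inv_neg,
        ← one_div]
      linarith
  · obtain ⟨y, hy, hye⟩ := exists_condEntropy_of_one_lt hβ hA
    refine ⟨fun _ => ?_, fun hneg => absurd hneg (not_lt.mpr ?_)⟩
    · have := log_le_of_le_rpow_mul_rpow hx hz hy.pos (param_pos hα).1
        (condNorm_le_of_pos hS (param_pos hα).1 (param_pos hα).2 (param_pos hβ).1
          (param_pos hβ).2 (param_pos hγ).1 (param_pos hγ).2 (params_eq h) hy)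
      rw [hxe, hye, hze, ← EReal.coe_add, EReal.coe_le_coe_iff]
      linarith
    · have := mul_pos (mul_pos (sub_pos.mpr hα) (sub_pos.mpr hβ)) (sub_pos.mpr hγ)
      linarith

end ChainRule

end RenyiChain

end

theorem theorem1 {a b c : Type*} [Fintype a] [DecidableEq a] [Fintype b] [DecidableEq b]
    [Fintype c] [DecidableEq c]
    (ρ : Matrix (a × b × c) (a × b × c) ℂ) (hρ : RenyiChain.IsDensity ρ)
    (α β γ : ℝ)
    (hα : α ∈ Set.Ioo (1 / 2 : ℝ) 1 ∪ Set.Ioi 1)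
    (hβ : β ∈ Set.Ioo (1 / 2 : ℝ) 1 ∪ Set.Ioi 1)
    (hγ : γ ∈ Set.Ioo (1 / 2 : ℝ) 1 ∪ Set.Ioi 1)
    (hαβγ : α / (α - 1) = β / (β - 1) + γ / (γ - 1)) :
    -- `H_α(AB|C) ≥ H_β(A|BC) + H_γ(B|C)` in the first case
    (0 < (α - 1) * (β - 1) * (γ - 1) →
      RenyiChain.condEntropy α (RenyiChain.regroup ρ) ≥
        RenyiChain.condEntropy β ρ + RenyiChain.condEntropy γ (RenyiChain.traceFst ρ)) ∧
    -- `H_α(AB|C) ≤ H_β(A|BC) + H_γ(B|C)` in the second case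
    ((α - 1) * (β - 1) * (γ - 1) < 0 →
      RenyiChain.condEntropy α (RenyiChain.regroup ρ) ≤
        RenyiChain.condEntropy β ρ + RenyiChain.condEntropy γ (RenyiChain.traceFst ρ)) ∧
    -- for `α > 1`, the same two inequalities with a fixed `σ_C` in the `AB|C` and `B|C` terms
    (1 < α → ∀ σ : Matrix c c ℂ, RenyiChain.IsDensity σ →
      (0 < (α - 1) * (β - 1) * (γ - 1) →
        RenyiChain.condEntropyRel α (RenyiChain.regroup ρ) σ ≥
          RenyiChain.condEntropy β ρ +
            RenyiChain.condEntropyRel γ (RenyiChain.traceFst ρ) σ) ∧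
      ((α - 1) * (β - 1) * (γ - 1) < 0 →
        RenyiChain.condEntropyRel α (RenyiChain.regroup ρ) σ ≤
          RenyiChain.condEntropy β ρ +
            RenyiChain.condEntropyRel γ (RenyiChain.traceFst ρ) σ)) := by
  obtain ⟨ψ, rfl⟩ := hρ.exists_purification
  obtain ⟨i, j, k⟩ := RenyiChain.nonempty_of_trace_eq_one hρ.2
  have : Nonempty a := ⟨i⟩
  have : Nonempty b := ⟨j⟩
  have : Nonempty c := ⟨k⟩
  have hB := (RenyiChain.trace_traceFst _).trans hρ.2
  have hAB := (RenyiChain.trace_regroup _).trans hρ.2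
  rw [RenyiChain.traceFst_stackRows] at hB ⊢
  rw [RenyiChain.regroup_stackRows] at hAB ⊢
  have h12 := RenyiChain.condEntropy_chain hρ.2 hB hAB hα hβ hγ hαβγ
  exact ⟨h12.1, h12.2, fun h1 σ hσ =>
    RenyiChain.condEntropyRel_chain hρ.2 hB hAB h1 hβ hγ hαβγ hσ.1⟩
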